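/- Let $G$ be a graded Lie group: a connected, simply connected Lie group whose Lie algebra has a vector space decomposition $\mathfrak g=\bigoplus_{\ell\ge 1}\mathfrak g_\ell$ with $[\mathfrak g_\ell,\mathfrak g_{\ell'}]\subset\mathfrak g_{\ell+\ell'}$. Identify $G$ with the vector space $\mathfrak g$ through the exponential map, write $D_r x=r\cdot x$ for the dilations ($D_r=r^\ell$ on $\mathfrak g_\ell$, $r>0$), $Q=\sum_\ell \ell\dim\mathfrak g_\ell$, and let $\mathcal S(G)$ be the Schwartz space of $\mathfrak g$. Fix a Haar measure $dx$ on $G$. Let $\Gamma$ be a discrete co-compact subgroup of $G$, $M=\Gamma\backslash G$ with points $\dot x=\Gamma x$, and let $d\dot x$ be the measure on $M$ with $\int_G F(x)\,dx=\int_M\sum_{\gamma\in\Gamma}F(\gamma x)\,d\dot x$ for all measurable $F\ge 0$. Let $\mathcal A_0$ be the class of fields of operators $\sigma(\dot x,\pi)\in\mathcal L(\mathcal H_\pi)$, $\dot x\in M$, $\pi$ a (strongly continuous) unitary irreducible representation of $G$ on a separable Hilbert space $\mathcal H_\pi$, of the form $\sigma(\dot x,\pi)=\int_G\kappa_{\dot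 x}(z)\pi(z)^*\,dz$, where $\dot x\mapsto\kappa_{\dot x}$ is a smooth map from $M$ to $\mathcal S(G)$, called the associated kernel of $\sigma$. For $\varepsilon\in(0,1]$ the symbol $\sigma^{(\varepsilon)}(\dot x,\pi)=\sigma(\dot x,\varepsilon\cdot\pi)$, with $(\varepsilon\cdot\pi)(z)=\pi(\varepsilon\cdot z)$, has associated kernel $\kappa^{(\varepsilon)}_{\dot x}(z)=\varepsilon^{-Q}\kappa_{\dot x}(\varepsilon^{-1}\cdot z)$, and $\mathrm{Op}^{\varepsilon}(\sigma)$ is the operator on $L^2(M)$ given by $$\mathrm{Op}^{\varepsilon}(\sigma)f(\dot x)=\int_G f(\dot y)\,\kappa^{(\varepsilon)}_{\dot x}(y^{-1}x)\,dy .$$ Let $\sigma\in\mathcal A_0$ with associated kernel $\kappa_{\dot x}(z)$. Then for every $\varepsilon\in(0,1]$ the operator $\mathrm{Op}^{\varepsilon}(\sigma)$ is (well defined, bounded,) Hilbert–Schmidt and trace class on $L^2(M)$, and for every $N\in\mathbb N$ there is a constant $C>0$ (depending on $N,\sigma,G,\Gamma$ but not on $\varepsilon$) such that for all $\varepsilon\in(0,1]$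 $$\Big|\,\|\mathrm{Op}^{\varepsilon}(\sigma)\|_{HS}^2-\varepsilon^{-Q}\iint_{G\times M}|\kappa_{\dot x}(z)|^2\,dz\,d\dot x\Big|\le C\varepsilon^N,\qquad \Big|\mathrm{Tr}\big(\mathrm{Op}^{\varepsilon}(\sigma)\big)-\varepsilon^{-Q}\int_M\kappa_{\dot x}(0)\,d\dot x\Big|\le C\varepsilon^N .$$ -/

import Mathlib

open MeasureTheory Filter Topology
open scoped Manifold ContDiff SchwartzMap ENNReal InnerProductSpace

universe u

noncomputable section

/-! ### Graded Lie groups in exponential coordinates -/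

section Group

/-- The group law of `G` is written in exponential coordinates: the manifold `G` is the vector space
`T₁G` itself and each line `t ↦ t • x` is a one-parameter subgroup, so that the exponential map is
the identity. A connected simply connected nilpotent Lie group is always put in this form by
identifying it with its Lie algebra through the exponential map. -/
def IsExponentialCoordinates (G : Type u) [NormedAddCommGroup G] [NormedSpace ℝ G] [Group G] :
    Prop :=
  ∀ (s t : ℝ) (x : G), (s • x) * (t • x) = (s + t) • x

/-- The Lie bracket of the Lie group `G` (Mathlib's bracket on the tangent space at the identity),
as an operation on the vector space `G`. -/
def groupBracket {G : Type u} [NormedAddCommGroup G] [NormedSpace ℝ G] [Group G] (x y : G) : G :=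
  @Bracket.bracket (GroupLieAlgebra 𝓘(ℝ, G) G) (GroupLieAlgebra 𝓘(ℝ, G) G) inferInstance x y

/-- The direct sum decomposition `G = ⨁ 𝒱 ℓ` (given by `DirectSum.Decomposition 𝒱`) is a gradation,
by the positive integers, of the Lie algebra of `G`. -/
structure IsLieGradation {G : Type u} [NormedAddCommGroup G] [NormedSpace ℝ G] [Group G]
    (𝒱 : ℕ → Submodule ℝ G) : Prop where
  zero_eq_bot : 𝒱 0 = ⊥
  bracket_mem : ∀ (i j : ℕ) (x y : G), x ∈ 𝒱 i → y ∈ 𝒱 j → groupBracket x y ∈ 𝒱 (i + j)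

/-- The dilation `D_r`, the linear map equal to `r ^ ℓ` on `𝒱 ℓ`. -/
def dilation {G : Type u} [NormedAddCommGroup G] [NormedSpace ℝ G]
    (𝒱 : ℕ → Submodule ℝ G) [DirectSum.Decomposition 𝒱] (r : ℝ) : G →ₗ[ℝ] G :=
  (DirectSum.toModule ℝ ℕ G fun ℓ => r ^ ℓ • (𝒱 ℓ).subtype) ∘ₗ
    (DirectSum.decomposeLinearEquiv 𝒱).toLinearMap

/-- The homogeneous dimension `Q = ∑ ℓ, ℓ * dim 𝒱 ℓ`. -/
def homogeneousDim {G : Type u} [NormedAddCommGroup G] [NormedSpace ℝ G]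
    (𝒱 : ℕ → Submodule ℝ G) : ℕ :=
  ∑ᶠ ℓ : ℕ, ℓ * Module.finrank ℝ (𝒱 ℓ)

end Group

/-! ### The nil-manifold `M = Γ \ G` and its measure -/

section Nilmanifold

/-- The quotient `Γ \ G` of `G` by the left action of `Γ`, that is, the space of classes `Γ x`. -/
abbrev NilManifold {G : Type u} [Group G] (Γ : Subgroup G) : Type u :=
  Quotient (QuotientGroup.rightRel Γ)

/-- The class `Γ x`. -/
def NilManifold.mk {G : Type u} [Group G] (Γ : Subgroup G) (x : G) : NilManifold Γ :=
  Quotient.mk (QuotientGroup.rightRel Γ) x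

theorem NilManifold.mk_mul {G : Type u} [Group G] (Γ : Subgroup G) (γ : Γ) (x : G) :
    NilManifold.mk Γ ((γ : G) * x) = NilManifold.mk Γ x := by
  apply Quotient.sound
  change QuotientGroup.rightRel Γ _ _
  rw [QuotientGroup.rightRel_apply]
  simp

theorem NilManifold.rel_exists {G : Type u} [Group G] {Γ : Subgroup G} {x y : G}
    (h : QuotientGroup.rightRel Γ x y) : ∃ γ : Γ, y = (γ : G) * x :=
  ⟨⟨y * x⁻¹, QuotientGroup.rightRel_apply.1 h⟩, by simp⟩

/-- The periodisation `Γ x ↦ ∑ γ, F (γ x)`, as a function on `Γ \ G`. -/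
def periodization {G : Type u} [Group G] (Γ : Subgroup G) (F : G → ℝ≥0∞) : NilManifold Γ → ℝ≥0∞ :=
  Quotient.lift (fun x => ∑' γ : Γ, F ((γ : G) * x)) (by
    intro x y h
    obtain ⟨δ, rfl⟩ := NilManifold.rel_exists h
    rw [← (Equiv.mulRight δ).tsum_eq (fun γ : Γ => F ((γ : G) * x))]
    simp [mul_assoc])

/-- `ν` is the measure `dẋ` on `M = Γ \ G` associated with the measure `μ` on `G`:
`∫_G F dμ = ∫_M ∑ γ, F (γ x) dν(ẋ)` for every measurable `F ≥ 0`. -/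
def IsQuotientMeasure {G : Type u} [Group G] [MeasurableSpace G] (Γ : Subgroup G)
    (μ : Measure G) (ν : Measure (NilManifold Γ)) : Prop :=
  ∀ F : G → ℝ≥0∞, Measurable F → ∫⁻ x, F x ∂μ = ∫⁻ p, periodization Γ F p ∂ν

end Nilmanifold

/-! ### Symbols -/

section Symbols

/-- A strongly continuous unitary irreducible representation of `G` on `H`. -/
structure UnitaryIrrep (G : Type u) [Group G] [TopologicalSpace G]
    (H : Type) [NormedAddCommGroup H] [InnerProductSpace ℂ H] where
  toHom : G →* (H ≃ₗᵢ[ℂ] H)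
  continuous_apply : ∀ v : H, Continuous fun g => toHom g v
  nontrivial : Nontrivial H
  irreducible : ∀ W : Submodule ℂ H, IsClosed (W : Set H) →
    (∀ g, ∀ v ∈ W, toHom g v ∈ W) → W = ⊥ ∨ W = ⊤

/-- Fields `σ(ẋ, π)` of bounded operators over `M` and the unitary irreducible representations of
`G` on separable Hilbert spaces. -/
def SymbolField {G : Type u} [Group G] [TopologicalSpace G] (Γ : Subgroup G) : Type (max u 1) :=
  NilManifold Γ → ∀ (H : Type) [NormedAddCommGroup H] [InnerProductSpace ℂ H] [CompleteSpace H]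
    [TopologicalSpace.SeparableSpace H], UnitaryIrrep G H → (H →L[ℂ] H)

/-- `A` is the group Fourier transform `∫_G f(z) π(z)^* dμ(z)` of `f` at `π` (an integral in the
strong sense; `π(z)^* = π(z)⁻¹`). -/
def IsFourierTransformAt {G : Type u} [Group G] [TopologicalSpace G] [MeasurableSpace G]
    (μ : Measure G) (f : G → ℂ) {H : Type} [NormedAddCommGroup H] [InnerProductSpace ℂ H]
    (π : UnitaryIrrep G H) (A : H →L[ℂ] H) : Prop :=
  ∀ v : H, A v = ∫ z, f z • (π.toHom z)⁻¹ v ∂μ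

/-- `f : E → F` is of class `C^k`, for `F` a topological vector space: the iterated directional
derivatives of order at most `k` exist everywhere, in the topology of `F`, and are continuous. -/
def IsCkInto {E : Type*} [NormedAddCommGroup E] [NormedSpace ℝ E]
    {F : Type*} [AddCommGroup F] [Module ℝ F] [TopologicalSpace F] : ℕ → (E → F) → Prop
  | 0, f => Continuous f
  | k + 1, f => Continuous f ∧ ∀ v : E, ∃ g : E → F,
      (∀ x, Tendsto (fun t : ℝ => t⁻¹ • (f (x + t • v) - f x)) (𝓝[≠] 0) (𝓝 (g x))) ∧
        IsCkInto k g

variable {G : Type u} [NormedAddCommGroup G] [NormedSpace ℝ G] [Group G] [MeasurableSpace G]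

/-- `ẋ ↦ κ_ẋ` is a smooth map from `M = Γ \ G` to the Schwartz space `𝓢(G)`, i.e. the `Γ`-periodic
map `x ↦ κ_ẋ` from `G` to `𝓢(G)` is smooth. -/
def IsSmoothKernel (Γ : Subgroup G) (κ : NilManifold Γ → 𝓢(G, ℂ)) : Prop :=
  ∀ k : ℕ, IsCkInto k fun x : G => κ (NilManifold.mk Γ x)

/-- The field `σ` belongs to the symbol class `𝒜₀`, with associated kernel `κ`: the map `κ` is
smooth from `M` to `𝓢(G)`, and `σ(ẋ, π)` is the Fourier transform of `κ_ẋ` at `π`. -/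
structure IsSymbolWithKernel (μ : Measure G) (Γ : Subgroup G) (σ : SymbolField Γ)
    (κ : NilManifold Γ → 𝓢(G, ℂ)) : Prop where
  smooth : IsSmoothKernel Γ κ
  fourier : ∀ (p : NilManifold Γ) (H : Type) [NormedAddCommGroup H] [InnerProductSpace ℂ H]
    [CompleteSpace H] [TopologicalSpace.SeparableSpace H] (π : UnitaryIrrep G H),
    IsFourierTransformAt μ (κ p) π (σ p H π)

/-- The kernel `κ^{(ε)}_ẋ(z) = ε^{-Q} κ_ẋ(ε⁻¹ · z)`. -/
def dilatedKernel (𝒱 : ℕ → Submodule ℝ G) [DirectSum.Decomposition 𝒱] {Γ : Subgroup G}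
    (κ : NilManifold Γ → 𝓢(G, ℂ)) (ε : ℝ) : NilManifold Γ → G → ℂ :=
  fun p z => (((ε ^ homogeneousDim 𝒱)⁻¹ : ℝ) : ℂ) * κ p (dilation 𝒱 ε⁻¹ z)

/-- The functions `k_ẋ` form the kernel of the symbol `σ^{(ε)}(ẋ, π) = σ(ẋ, ε · π)`, where
`ε · π` is the representation `z ↦ π(D_ε z)`. -/
def IsKernelOfDilatedSymbol (𝒱 : ℕ → Submodule ℝ G) [DirectSum.Decomposition 𝒱] (μ : Measure G)
    {Γ : Subgroup G} (σ : SymbolField Γ) (ε : ℝ) (k : NilManifold Γ → G → ℂ) : Prop :=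
  ∀ (p : NilManifold Γ) (H : Type) [NormedAddCommGroup H] [InnerProductSpace ℂ H]
    [CompleteSpace H] [TopologicalSpace.SeparableSpace H] (π επ : UnitaryIrrep G H),
    (∀ z, επ.toHom z = π.toHom (dilation 𝒱 ε z)) → IsFourierTransformAt μ (k p) π (σ p H επ)

end Symbols

/-! ### The quantization -/

section Quantization

variable {G : Type u} [NormedAddCommGroup G] [NormedSpace ℝ G] [Group G] [MeasurableSpace G]

/-- The function `Γ x ↦ (f_G * k_ẋ)(x) = ∫_G f(Γ y) k_ẋ(y⁻¹ x) dy` on `M`. -/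
def opFun [BorelSpace G] [LieGroup 𝓘(ℝ, G) ∞ G] (μ : Measure G) [μ.IsMulLeftInvariant]
    (Γ : Subgroup G) (k : NilManifold Γ → G → ℂ) (f : NilManifold Γ → ℂ) : NilManifold Γ → ℂ :=
  Quotient.lift
    (fun x => ∫ y, f (NilManifold.mk Γ y) * k (NilManifold.mk Γ x) (y⁻¹ * x) ∂μ) (by
      intro x y h
      obtain ⟨γ, rfl⟩ := NilManifold.rel_exists h
      have : IsTopologicalGroup G := topologicalGroup_of_lieGroup 𝓘(ℝ, G) ∞
      have hm : NilManifold.mk Γ ((γ : G) * x) = NilManifold.mk Γ x := NilManifold.mk_mul Γ γ x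
      simp only [hm]
      rw [← integral_mul_left_eq_self (fun y => f (NilManifold.mk Γ y) *
        k (NilManifold.mk Γ x) (y⁻¹ * ((γ : G) * x))) (γ : G)]
      simp [NilManifold.mk_mul, mul_assoc])

/-- The bounded operator `T` on `L²(M)` is the operator with kernel `k`: for each `f ∈ L²(M)`, the
integrals defining `f_G * k_ẋ` converge and `T f (ẋ) = (f_G * k_ẋ)(x)`. -/
def IsOp [BorelSpace G] [LieGroup 𝓘(ℝ, G) ∞ G] (μ : Measure G) [μ.IsMulLeftInvariant]
    (Γ : Subgroup G) (ν : Measure (NilManifold Γ)) (k : NilManifold Γ → G → ℂ)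
    (T : Lp ℂ 2 ν →L[ℂ] Lp ℂ 2 ν) : Prop :=
  ∀ f : Lp ℂ 2 ν,
    (∀ x : G, Integrable
      (fun y => f (NilManifold.mk Γ y) * k (NilManifold.mk Γ x) (y⁻¹ * x)) μ) ∧
    T f =ᵐ[ν] opFun μ Γ k f

end Quantization

/-! ### Hilbert–Schmidt and trace-class operators -/

section Operators

variable {H : Type u} [NormedAddCommGroup H] [InnerProductSpace ℂ H] [CompleteSpace H]

/-- `T` is Hilbert–Schmidt with norm `s`: `∑ ‖T eᵢ‖² = s²` for every orthonormal basis. -/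
def HasHilbertSchmidtNorm (T : H →L[ℂ] H) (s : ℝ) : Prop :=
  0 ≤ s ∧ ∀ (ι : Type u) (e : HilbertBasis ι ℂ H), HasSum (fun i => ‖T (e i)‖ ^ 2) (s ^ 2)

/-- `T` is trace class: `∑ ⟨eᵢ, |T| eᵢ⟩ < ∞` for every orthonormal basis, `|T| = (T^* T)^{1/2}`. -/
def IsTraceClass (T : H →L[ℂ] H) : Prop :=
  ∀ (ι : Type u) (e : HilbertBasis ι ℂ H),
    Summable fun i => (inner ℂ (e i) (CFC.abs T (e i))).re

/-- `T` has trace `τ`: `∑ ⟨eᵢ, T eᵢ⟩ = τ` for every orthonormal basis, with absolute convergence. -/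
def HasTrace (T : H →L[ℂ] H) (τ : ℂ) : Prop :=
  ∀ (ι : Type u) (e : HilbertBasis ι ℂ H), HasSum (fun i => inner ℂ (e i) (T (e i))) τ

end Operators

end

/-!
Lie algebra morphisms integrate to group morphisms, so the dilations are group automorphisms. Hence
the Haar measure is a Lebesgue measure, the group law has polynomial growth, and `Γ` has polynomial
growth as well.

The operator with kernel `k` has integral kernel `K(ẋ, ẏ) = ∑ γ, k_ẋ(y⁻¹ γ x)` on `M × M`, so that
its squared Hilbert–Schmidt norm is `∬ |K|²` and its trace is `∫ K(ẋ, ẋ)`. It is trace class because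
a Fourier expansion of `K` in the second variable writes it as an absolutely convergent integral of
operators of rank one.

For the kernel `κ^{(ε)}`, the term `γ = 1` alone gives the two main terms: `K(ẋ, ẋ)` contains
`ε^{-Q} κ_ẋ(0)`, and unfolding `∫ |K(ẋ, ·)|²` against the sum over `Γ` leaves
`∫_G |κ^{(ε)}_ẋ(z)|² dz`. For `γ ≠ 1` the points `x⁻¹ γ x`, with `x` in a compact set, stay away
from `0`, hence their images under the dilation by `ε⁻¹` are at distance at least `c / ε`, and the
Schwartz decay of `κ_ẋ` makes all the other terms `O(ε^N)`.
-/

noncomputable section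

section IntegralCurve

theorem eq_of_hasDerivAt_of_contDiff {E : Type*} [NormedAddCommGroup E] [NormedSpace ℝ E]
    {v : E → E} (hv : ContDiff ℝ 1 v) {γ γ' : ℝ → E} (hγ : ∀ t, HasDerivAt γ (v (γ t)) t)
    (hγ' : ∀ t, HasDerivAt γ' (v (γ' t)) t) {t₀ : ℝ} (h₀ : γ t₀ = γ' t₀) : γ = γ' := by
  refine isMIntegralCurve_Ioo_eq_of_contMDiff_boundaryless (I := 𝓘(ℝ, E)) (v := v)
    (contMDiff_vectorSpace_iff_contDiff.2 hv) (fun t => ?_) (fun t => ?_) h₀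
  · exact (hγ t).hasFDerivAt.hasMFDerivAt
  · exact (hγ' t).hasFDerivAt.hasMFDerivAt

theorem mlieBracket_eq_lieBracket {E : Type*} [NormedAddCommGroup E] [NormedSpace ℝ E]
    (V W : E → E) (g : E) :
    VectorField.mlieBracket 𝓘(ℝ, E) (M := E) V W g = VectorField.lieBracket ℝ V W g := by
  rw [← VectorField.lieBracketWithin_univ]
  exact congrFun (VectorField.mlieBracketWithin_eq_lieBracketWithin (s := Set.univ)) g

end IntegralCurve

section LeftTranslation

variable {G : Type u} [NormedAddCommGroup G] [NormedSpace ℝ G] [Group G]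

/-- The derivative at the identity of the left translation by `g`. -/
def leftDeriv (g : G) : G →L[ℝ] G := fderiv ℝ (fun a => g * a) 1

/-- The left Maurer–Cartan form: the derivative at `g` of the left translation by `g⁻¹`, which is
the inverse of `leftDeriv g`. -/
def maurerCartan (g : G) : G →L[ℝ] G := fderiv ℝ (fun a => g⁻¹ * a) g

theorem leftDeriv_one : leftDeriv (1 : G) = .id ℝ G := by
  simp [leftDeriv]

variable [LieGroup 𝓘(ℝ, G) ∞ G]

theorem contDiff_groupMul : ContDiff ℝ ∞ fun p : G × G => p.1 * p.2 := by
  rw [← contMDiff_iff_contDiff, modelWithCornersSelf_prod, ← chartedSpaceSelf_prod]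
  exact contMDiff_mul 𝓘(ℝ, G) ∞

theorem contDiff_groupInv : ContDiff ℝ ∞ fun x : G => x⁻¹ :=
  contMDiff_iff_contDiff.1 (contMDiff_inv 𝓘(ℝ, G) ∞)

theorem contDiff_groupMul_left (g : G) : ContDiff ℝ ∞ fun a : G => g * a :=
  contDiff_groupMul.comp (contDiff_const.prodMk contDiff_id)

theorem hasFDerivAt_mul_left_one (g : G) : HasFDerivAt (fun a => g * a) (leftDeriv g) 1 :=
  ((contDiff_groupMul_left g).differentiable (by simp)).differentiableAt.hasFDerivAt

theorem hasFDerivAt_inv_mul_left (g : G) : HasFDerivAt (fun a => g⁻¹ * a) (maurerCartan g) g :=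
  ((contDiff_groupMul_left g⁻¹).differentiable (by simp)).differentiableAt.hasFDerivAt

theorem contDiff_leftDeriv : ContDiff ℝ ∞ (leftDeriv : G → G →L[ℝ] G) :=
  ContDiff.fderiv (f := fun g a : G => g * a) (n := ∞) contDiff_groupMul contDiff_const (by simp)

theorem contDiff_maurerCartan : ContDiff ℝ ∞ (maurerCartan : G → G →L[ℝ] G) := by
  refine ContDiff.fderiv (f := fun g a : G => g⁻¹ * a) (n := ∞) (m := ∞) ?_ contDiff_id (by simp)
  exact contDiff_groupMul.comp ((contDiff_groupInv.comp contDiff_fst).prodMk contDiff_snd)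

theorem hasFDerivAt_leftDeriv (g : G) :
    HasFDerivAt (leftDeriv : G → G →L[ℝ] G) (fderiv ℝ leftDeriv g) g :=
  (contDiff_leftDeriv.differentiable (by simp)).differentiableAt.hasFDerivAt

theorem hasFDerivAt_maurerCartan (g : G) :
    HasFDerivAt (maurerCartan : G → G →L[ℝ] G) (fderiv ℝ maurerCartan g) g :=
  (contDiff_maurerCartan.differentiable (by simp)).differentiableAt.hasFDerivAt

theorem maurerCartan_leftDeriv (g v : G) : maurerCartan g (leftDeriv g v) = v := by
  have h_inv : HasFDerivAt (fun a => g⁻¹ * a) (maurerCartan g) (g * 1) := by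
    rw [mul_one]; exact hasFDerivAt_inv_mul_left g
  have h := h_inv.comp 1 (hasFDerivAt_mul_left_one g)
  simp only [Function.comp_def, inv_mul_cancel_left] at h
  exact DFunLike.congr_fun (h.unique (hasFDerivAt_id _)) v

theorem leftDeriv_maurerCartan (g v : G) : leftDeriv g (maurerCartan g v) = v := by
  have h_mul : HasFDerivAt (fun a => g * a) (leftDeriv g) (g⁻¹ * g) := by
    rw [inv_mul_cancel]; exact hasFDerivAt_mul_left_one g
  have h := h_mul.comp g (hasFDerivAt_inv_mul_left g)
  simp only [Function.comp_def, mul_inv_cancel_left] at h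
  exact DFunLike.congr_fun (h.unique (hasFDerivAt_id _)) v

end LeftTranslation

section Bracket

variable {G : Type u} [NormedAddCommGroup G] [NormedSpace ℝ G] [Group G]

theorem mulInvariantVectorField_eq_leftDeriv (v : G) :
    (mulInvariantVectorField (I := 𝓘(ℝ, G)) (G := G) v : G → G) = fun g => leftDeriv g v := by
  ext g
  simp only [mulInvariantVectorField, leftDeriv, mfderiv_eq_fderiv]
  rfl

variable [LieGroup 𝓘(ℝ, G) ∞ G] [CompleteSpace G]

theorem lieBracket_leftDeriv (v w g : G) :
    VectorField.lieBracket ℝ (fun h => leftDeriv h v) (fun h => leftDeriv h w) g =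
      leftDeriv g (groupBracket v w) := by
  have : LieGroup 𝓘(ℝ, G) (minSmoothness ℝ 3) G := by
    refine LieGroup.of_le (n := ∞) ?_
    rw [minSmoothness_of_isRCLikeNormedField]
    exact WithTop.coe_le_coe.2 (le_top : (3 : ℕ∞) ≤ ⊤)
  have mlieBracket_eq : ∀ V W : (x : G) → TangentSpace 𝓘(ℝ, G) x,
      mulInvariantVectorField (I := 𝓘(ℝ, G)) (G := G) v = V →
      mulInvariantVectorField (I := 𝓘(ℝ, G)) (G := G) w = W →
      VectorField.mlieBracket 𝓘(ℝ, G) V W g =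
        mulInvariantVectorField (I := 𝓘(ℝ, G)) (G := G) (groupBracket (G := G) v w) g := by
    rintro _ _ rfl rfl
    exact (congrFun (mulInvariantVector_mlieBracket (I := 𝓘(ℝ, G)) (G := G) v w) g).symm
  exact (mlieBracket_eq_lieBracket _ _ g).symm.trans
    ((mlieBracket_eq _ _ (mulInvariantVectorField_eq_leftDeriv v)
      (mulInvariantVectorField_eq_leftDeriv w)).trans
      (congrFun (mulInvariantVectorField_eq_leftDeriv (groupBracket v w)) g))

theorem fderiv_leftDeriv_sub (g v w : G) :
    fderiv ℝ leftDeriv g (leftDeriv g v) w - fderiv ℝ leftDeriv g (leftDeriv g w) v =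
      leftDeriv g (groupBracket v w) := by
  have hd (v : G) : fderiv ℝ (fun h => leftDeriv h v) g = (fderiv ℝ leftDeriv g).flip v := by
    refine (((hasFDerivAt_leftDeriv g).clm_apply (hasFDerivAt_const v g)).congr_fderiv ?_).fderiv
    ext; simp
  have h := lieBracket_leftDeriv v w g
  simp only [VectorField.lieBracket, hd] at h
  exact h

/-- The Lie bracket of `G` as a continuous bilinear map: the antisymmetric part of the second
derivative of the group law at the identity. -/
def bracketCLM (G : Type u) [NormedAddCommGroup G] [NormedSpace ℝ G] [Group G] :
    G →L[ℝ] G →L[ℝ] G :=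
  fderiv ℝ leftDeriv (1 : G) - (fderiv ℝ leftDeriv (1 : G)).flip

theorem groupBracket_eq_bracketCLM (v w : G) : groupBracket v w = bracketCLM G v w := by
  simpa [bracketCLM, leftDeriv_one] using (fderiv_leftDeriv_sub 1 v w).symm

/-- The Maurer–Cartan structure equation `dω + [ω, ω] = 0`. -/
theorem fderiv_maurerCartan_sub (g x y : G) :
    fderiv ℝ maurerCartan g x y - fderiv ℝ maurerCartan g y x =
      -groupBracket (maurerCartan g x) (maurerCartan g y) := by
  have product_rule (x w : G) : fderiv ℝ maurerCartan g x (leftDeriv g w) =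
      -maurerCartan g (fderiv ℝ leftDeriv g x w) := by
    have h := (hasFDerivAt_maurerCartan g).clm_apply
      ((hasFDerivAt_leftDeriv g).clm_apply (hasFDerivAt_const w g))
    simp only [maurerCartan_leftDeriv] at h
    have h' := DFunLike.congr_fun (h.unique (hasFDerivAt_const w g)) x
    refine eq_neg_of_add_eq_zero_right ?_
    simpa using h'
  have h := fderiv_leftDeriv_sub g (maurerCartan g x) (maurerCartan g y)
  rw [leftDeriv_maurerCartan, leftDeriv_maurerCartan] at h
  rw [← maurerCartan_leftDeriv g (groupBracket _ _), ← h, map_sub, ← neg_neg (maurerCartan g _),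
    ← product_rule, ← neg_neg (maurerCartan g (fderiv ℝ leftDeriv g y _)), ← product_rule,
    leftDeriv_maurerCartan, leftDeriv_maurerCartan]
  abel

end Bracket

section ExponentialCoordinates

variable {G : Type u} [NormedAddCommGroup G] [NormedSpace ℝ G] [Group G]

theorem IsExponentialCoordinates.one_eq_zero (hG : IsExponentialCoordinates G) : (1 : G) = 0 := by
  have h := hG 0 0 (0 : G)
  simp only [zero_smul, add_zero] at h
  exact (mul_eq_left.1 h).symm

theorem IsExponentialCoordinates.inv_eq_neg (hG : IsExponentialCoordinates G) (x : G) :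
    x⁻¹ = -x := by
  have h := hG 1 (-1) x
  simp only [one_smul, neg_smul, add_neg_cancel, zero_smul, ← hG.one_eq_zero] at h
  exact (eq_inv_of_mul_eq_one_right h).symm

variable [LieGroup 𝓘(ℝ, G) ∞ G]

theorem IsExponentialCoordinates.hasDerivAt_mul_smul (hG : IsExponentialCoordinates G) (x v : G)
    (t : ℝ) : HasDerivAt (fun t : ℝ => x * (t • v)) (leftDeriv (x * t • v) v) t := by
  have h_line : HasDerivAt (fun s : ℝ => (s - t) • v) v t := by
    simpa using ((hasDerivAt_id t).sub_const t).smul_const v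
  have h_mul : HasFDerivAt (fun a => (x * t • v) * a) (leftDeriv (x * t • v)) ((t - t) • v) := by
    rw [sub_self, zero_smul, ← hG.one_eq_zero]
    exact hasFDerivAt_mul_left_one _
  refine (h_mul.comp_hasDerivAt t h_line).congr_of_eventuallyEq (.of_forall fun s => ?_)
  simp only [Function.comp_apply, mul_assoc, hG t, add_sub_cancel]

theorem IsExponentialCoordinates.maurerCartan_smul_self (hG : IsExponentialCoordinates G) (s : ℝ)
    (a : G) : maurerCartan (s • a) a = a := by
  have h := hG.hasDerivAt_mul_smul 1 a s
  simp only [one_mul] at h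
  have h_eq : leftDeriv (s • a) a = a := h.unique (by simpa using (hasDerivAt_id s).smul_const a)
  simpa only [h_eq] using maurerCartan_leftDeriv (s • a) a

theorem IsExponentialCoordinates.maurerCartan_add_fderiv (hG : IsExponentialCoordinates G) (s : ℝ)
    (a u : G) : maurerCartan (s • a) u + s • fderiv ℝ maurerCartan (s • a) u a = u := by
  have h_smul : HasFDerivAt (fun b : G => s • b) (s • ContinuousLinearMap.id ℝ G) a :=
    (hasFDerivAt_id a).const_smul s
  have h := (HasFDerivAt.comp a (hasFDerivAt_maurerCartan (s • a)) h_smul).clm_apply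
    (hasFDerivAt_id a)
  simp only [Function.comp_apply, id_eq, hG.maurerCartan_smul_self] at h
  simpa using DFunLike.congr_fun (h.unique (hasFDerivAt_id a)) u

/-- Up to the factor `s`, the curve `s • ω (s • a) u` is the derivative of the exponential map; it
solves an affine equation whose coefficients only involve the Lie bracket. -/
theorem IsExponentialCoordinates.hasDerivAt_smul_maurerCartan [CompleteSpace G]
    (hG : IsExponentialCoordinates G) (a u : G) (s : ℝ) :
    HasDerivAt (fun s : ℝ => s • maurerCartan (s • a) u)
      (u - bracketCLM G a (s • maurerCartan (s • a) u)) s := by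
  have h_line : HasDerivAt (fun s : ℝ => s • a) a s := by
    simpa using (hasDerivAt_id s).smul_const a
  have h_form : HasDerivAt (fun s : ℝ => maurerCartan (s • a) u)
      (fderiv ℝ maurerCartan (s • a) a u) s := by
    have h : HasDerivAt (fun s : ℝ => maurerCartan (s • a)) (fderiv ℝ maurerCartan (s • a) a) s :=
      HasFDerivAt.comp_hasDerivAt (l := maurerCartan) s (hasFDerivAt_maurerCartan (s • a)) h_line
    simpa using h.clm_apply (hasDerivAt_const s u)
  refine ((hasDerivAt_id s).smul h_form).congr_deriv ?_
  have h_swap := fderiv_maurerCartan_sub (s • a) a u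
  rw [hG.maurerCartan_smul_self, groupBracket_eq_bracketCLM, sub_eq_iff_eq_add] at h_swap
  conv_rhs => enter [1]; rw [← hG.maurerCartan_add_fderiv s a u]
  simp only [h_swap, id_eq, map_smul, one_smul, smul_add, smul_neg]
  abel

end ExponentialCoordinates

section Morphism

variable {G : Type u} [NormedAddCommGroup G] [NormedSpace ℝ G] [Group G]
  [LieGroup 𝓘(ℝ, G) ∞ G] [CompleteSpace G]
  {G' : Type*} [NormedAddCommGroup G'] [NormedSpace ℝ G'] [Group G']
  [LieGroup 𝓘(ℝ, G') ∞ G'] [CompleteSpace G']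

theorem map_maurerCartan_of_map_groupBracket (hG : IsExponentialCoordinates G)
    (hG' : IsExponentialCoordinates G') (φ : G →L[ℝ] G')
    (hφ : ∀ x y, φ (groupBracket x y) = groupBracket (φ x) (φ y)) (a u : G) :
    φ (maurerCartan a u) = maurerCartan (φ a) (φ u) := by
  simp only [groupBracket_eq_bracketCLM] at hφ
  have h_affine : ContDiff ℝ 1 fun y : G' => φ u - bracketCLM G' (φ a) y :=
    contDiff_const.sub (bracketCLM G' (φ a)).contDiff
  have h := eq_of_hasDerivAt_of_contDiff h_affine
    (γ := fun s : ℝ => φ (s • maurerCartan (s • a) u))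
    (γ' := fun s : ℝ => s • maurerCartan (s • φ a) (φ u)) (t₀ := 0)
    (fun s => ((φ.hasFDerivAt.comp_hasDerivAt s
      (hG.hasDerivAt_smul_maurerCartan a u s)).congr_deriv (by rw [map_sub, hφ])))
    (fun s => hG'.hasDerivAt_smul_maurerCartan (φ a) (φ u) s) (by simp)
  simpa using congrFun h 1

theorem map_mul_of_map_groupBracket (hG : IsExponentialCoordinates G)
    (hG' : IsExponentialCoordinates G') (φ : G →L[ℝ] G')
    (hφ : ∀ x y, φ (groupBracket x y) = groupBracket (φ x) (φ y)) (x v : G) :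
    φ (x * v) = φ x * φ v := by
  have map_leftDeriv (a : G) : φ (leftDeriv a v) = leftDeriv (φ a) (φ v) := by
    rw [← leftDeriv_maurerCartan (φ a) (φ (leftDeriv a v)),
      ← map_maurerCartan_of_map_groupBracket hG hG' φ hφ, maurerCartan_leftDeriv]
  have h_field : ContDiff ℝ 1 fun y : G' => leftDeriv y (φ v) :=
    (contDiff_leftDeriv.clm_apply contDiff_const).of_le (by simp)
  -- Both curves are integral curves, starting at `φ x`, of the left-invariant field of `φ v`.
  have h := eq_of_hasDerivAt_of_contDiff h_field
    (γ := fun t : ℝ => φ (x * t • v)) (γ' := fun t : ℝ => φ x * t • φ v) (t₀ := 0)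
    (fun t => (φ.hasFDerivAt.comp_hasDerivAt t (hG.hasDerivAt_mul_smul x v t)).congr_deriv
      (map_leftDeriv _))
    (fun t => hG'.hasDerivAt_mul_smul (φ x) (φ v) t)
    (by simp only [zero_smul, ← hG.one_eq_zero, ← hG'.one_eq_zero, mul_one])
  simpa using congrFun h 1

end Morphism

section Dilation

variable {G : Type u} [NormedAddCommGroup G] [NormedSpace ℝ G]
  (𝒱 : ℕ → Submodule ℝ G) [DirectSum.Decomposition 𝒱]

theorem dilation_of_mem (r : ℝ) {ℓ : ℕ} {x : G} (hx : x ∈ 𝒱 ℓ) :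
    dilation 𝒱 r x = r ^ ℓ • x := by
  simp only [dilation, LinearMap.comp_apply]
  erw [DirectSum.decomposeLinearEquiv_apply]
  rw [DirectSum.decompose_of_mem 𝒱 hx]
  erw [DirectSum.toModule_lof]
  simp

theorem dilation_one (x : G) : dilation 𝒱 1 x = x := by
  induction x using DirectSum.Decomposition.inductionOn 𝒱 with
  | zero => simp
  | add a b ha hb => simp [ha, hb]
  | @homogeneous i a => simp [dilation_of_mem 𝒱 1 a.2]

theorem dilation_dilation (r s : ℝ) (x : G) :
    dilation 𝒱 r (dilation 𝒱 s x) = dilation 𝒱 (r * s) x := by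
  induction x using DirectSum.Decomposition.inductionOn 𝒱 with
  | zero => simp
  | add a b ha hb => simp [ha, hb]
  | @homogeneous i a => simp [dilation_of_mem 𝒱 _ a.2, smul_smul, mul_pow, mul_comm]

theorem dilation_groupBracket [CompleteSpace G] [Group G] [LieGroup 𝓘(ℝ, G) ∞ G]
    (h𝒱 : IsLieGradation 𝒱) (r : ℝ) (x y : G) :
    dilation 𝒱 r (groupBracket x y) = groupBracket (dilation 𝒱 r x) (dilation 𝒱 r y) := by
  have homogeneous_bracket {i j : ℕ} (a : 𝒱 i) (b : 𝒱 j) :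
      dilation 𝒱 r (bracketCLM G a b) = r ^ (i + j) • bracketCLM G a b := by
    rw [← groupBracket_eq_bracketCLM]
    exact dilation_of_mem 𝒱 r (h𝒱.bracket_mem i j a b a.2 b.2)
  simp only [groupBracket_eq_bracketCLM]
  induction x using DirectSum.Decomposition.inductionOn 𝒱 with
  | zero => simp
  | add a b ha hb => simp [ha, hb]
  | @homogeneous i a =>
    induction y using DirectSum.Decomposition.inductionOn 𝒱 with
    | zero => simp
    | add a b ha hb => simp [ha, hb]
    | @homogeneous j b =>
      simp [homogeneous_bracket, dilation_of_mem 𝒱 r a.2, dilation_of_mem 𝒱 r b.2, smul_smul,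
        pow_add, mul_comm]

end Dilation

section Weights

variable {G : Type u} [NormedAddCommGroup G] [NormedSpace ℝ G] [FiniteDimensional ℝ G]
  (𝒱 : ℕ → Submodule ℝ G) [DirectSum.Decomposition 𝒱]

theorem dilation_mul [Group G] [LieGroup 𝓘(ℝ, G) ∞ G]
    (hG : IsExponentialCoordinates G) (h𝒱 : IsLieGradation 𝒱) (r : ℝ) (x y : G) :
    dilation 𝒱 r (x * y) = dilation 𝒱 r x * dilation 𝒱 r y := by
  have : CompleteSpace G := FiniteDimensional.complete ℝ G
  exact map_mul_of_map_groupBracket hG hG (LinearMap.toContinuousLinearMap (dilation 𝒱 r))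
    (dilation_groupBracket 𝒱 h𝒱 r) x y

/-- The finite set of weights `ℓ`, those with `𝒱 ℓ ≠ 0`. -/
def weights : Finset ℕ :=
  (WellFoundedGT.finite_ne_bot_of_iSupIndep
    (DirectSum.Decomposition.isInternal 𝒱).submodule_iSupIndep).toFinset

theorem mem_weights {ℓ : ℕ} : ℓ ∈ weights 𝒱 ↔ 𝒱 ℓ ≠ ⊥ := by
  simp [weights]

/-- The projection onto `𝒱 ℓ` along the other weight spaces. -/
def weightProj (ℓ : ℕ) : G →L[ℝ] G :=
  LinearMap.toContinuousLinearMap ((𝒱 ℓ).subtype ∘ₗ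
    DirectSum.component ℝ ℕ (fun i => 𝒱 i) ℓ ∘ₗ (DirectSum.decomposeLinearEquiv 𝒱).toLinearMap)

theorem weightProj_of_mem {ℓ : ℕ} {x : G} (hx : x ∈ 𝒱 ℓ) : weightProj 𝒱 ℓ x = x :=
  DirectSum.decompose_of_mem_same 𝒱 hx

theorem weightProj_of_mem_ne {i j : ℕ} {x : G} (hx : x ∈ 𝒱 i) (h : i ≠ j) :
    weightProj 𝒱 j x = 0 :=
  DirectSum.decompose_of_mem_ne 𝒱 hx h

theorem dilation_eq_sum (r : ℝ) (x : G) :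
    dilation 𝒱 r x = ∑ ℓ ∈ weights 𝒱, r ^ ℓ • weightProj 𝒱 ℓ x := by
  induction x using DirectSum.Decomposition.inductionOn 𝒱 with
  | zero => simp
  | add a b ha hb => simp [ha, hb, Finset.sum_add_distrib]
  | @homogeneous i a =>
    rw [dilation_of_mem 𝒱 r a.2, Finset.sum_eq_single i, weightProj_of_mem 𝒱 a.2]
    · intro j _ hj
      rw [weightProj_of_mem_ne 𝒱 a.2 hj.symm, smul_zero]
    · intro hi
      rw [mem_weights, not_not] at hi
      have : (a : G) = 0 := by simpa [hi] using a.2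
      simp [this]

theorem dilation_zero (h0 : 𝒱 0 = ⊥) (x : G) : dilation 𝒱 0 x = 0 := by
  rw [dilation_eq_sum]
  refine Finset.sum_eq_zero fun ℓ hℓ => ?_
  have : ℓ ≠ 0 := by rintro rfl; exact (mem_weights 𝒱).1 hℓ h0
  simp [this]

theorem continuous_dilation_left (x : G) : Continuous fun r : ℝ => dilation 𝒱 r x := by
  simp only [dilation_eq_sum]
  exact continuous_finsetSum _ fun ℓ _ => (continuous_id.pow ℓ).smul continuous_const

/-- The dilation by a nonzero factor as a continuous linear equivalence. -/
def dilationEquiv {r : ℝ} (hr : r ≠ 0) : G ≃L[ℝ] G :=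
  (LinearEquiv.ofLinearMap (dilation 𝒱 r) (dilation 𝒱 r⁻¹)
    (by ext x; simp [dilation_dilation, hr, dilation_one])
    (by ext x; simp [dilation_dilation, hr, dilation_one])).toContinuousLinearEquiv

theorem exists_norm_dilation_le_of_pow_le : ∃ C : ℝ, 1 ≤ C ∧
    ∀ r b : ℝ, 0 ≤ b → (∀ ℓ ∈ weights 𝒱, |r ^ ℓ| ≤ b) → ∀ x : G,
      ‖dilation 𝒱 r x‖ ≤ C * b * ‖x‖ := by
  have h_sum : 0 ≤ ∑ ℓ ∈ weights 𝒱, ‖weightProj 𝒱 ℓ‖ :=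
    Finset.sum_nonneg fun _ _ => norm_nonneg _
  refine ⟨1 + ∑ ℓ ∈ weights 𝒱, ‖weightProj 𝒱 ℓ‖, by linarith, fun r b hb hr x => ?_⟩
  calc ‖dilation 𝒱 r x‖
      ≤ ∑ ℓ ∈ weights 𝒱, b * (‖weightProj 𝒱 ℓ‖ * ‖x‖) := by
        rw [dilation_eq_sum]
        refine norm_sum_le_of_le _ fun ℓ hℓ => ?_
        rw [norm_smul, Real.norm_eq_abs]
        exact mul_le_mul (hr ℓ hℓ) ((weightProj 𝒱 ℓ).le_opNorm x) (norm_nonneg _) hb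
    _ = (∑ ℓ ∈ weights 𝒱, ‖weightProj 𝒱 ℓ‖) * b * ‖x‖ := by
        rw [← Finset.mul_sum, ← Finset.sum_mul]; ring
    _ ≤ (1 + ∑ ℓ ∈ weights 𝒱, ‖weightProj 𝒱 ℓ‖) * b * ‖x‖ := by gcongr; linarith

theorem exists_norm_dilation_le (h0 : 𝒱 0 = ⊥) : ∃ C : ℝ, 1 ≤ C ∧ ∃ s : ℕ, ∀ r : ℝ, 1 ≤ r →
    ∀ x : G, ‖dilation 𝒱 r x‖ ≤ C * r ^ s * ‖x‖ ∧ ‖dilation 𝒱 r⁻¹ x‖ ≤ C * r⁻¹ * ‖x‖ := by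
  obtain ⟨C, hC1, hC⟩ := exists_norm_dilation_le_of_pow_le 𝒱
  refine ⟨C, hC1, (weights 𝒱).sup id, fun r hr x => ⟨?_, ?_⟩⟩
  · refine hC r _ (by positivity) (fun ℓ hℓ => ?_) x
    rw [abs_of_nonneg (by positivity)]
    exact pow_le_pow_right₀ hr (Finset.le_sup (f := id) hℓ)
  · refine hC r⁻¹ _ (by positivity) (fun ℓ hℓ => ?_) x
    rw [abs_of_nonneg (by positivity)]
    refine pow_le_of_le_one (by positivity) (inv_le_one_of_one_le₀ hr) ?_
    rintro rfl
    exact (mem_weights 𝒱).1 hℓ h0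

theorem exists_norm_le_dilation_inv (h0 : 𝒱 0 = ⊥) : ∃ C : ℝ, 1 ≤ C ∧
    ∀ ε ∈ Set.Ioc (0 : ℝ) 1, ∀ x : G, ‖x‖ ≤ C * ε * ‖dilation 𝒱 ε⁻¹ x‖ := by
  obtain ⟨C, hC1, _, hC⟩ := exists_norm_dilation_le 𝒱 h0
  refine ⟨C, hC1, fun ε ⟨hε0, hε1⟩ x => ?_⟩
  simpa only [inv_inv, dilation_dilation, mul_inv_cancel₀ hε0.ne', dilation_one]
    using (hC ε⁻¹ ((one_le_inv₀ hε0).2 hε1) (dilation 𝒱 ε⁻¹ x)).2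

theorem homogeneousDim_eq_sum_weights :
    homogeneousDim 𝒱 = ∑ ℓ ∈ weights 𝒱, ℓ * Module.finrank ℝ (𝒱 ℓ) := by
  refine finsum_eq_sum_of_support_subset _ fun ℓ hℓ => ?_
  rw [Finset.mem_coe, mem_weights]
  intro h
  simp [h] at hℓ

theorem homogeneousDim_eq_sum_sigma [Fintype (Σ ℓ, Fin (Module.finrank ℝ (𝒱 ℓ)))] :
    homogeneousDim 𝒱 = ∑ i : Σ ℓ, Fin (Module.finrank ℝ (𝒱 ℓ)), i.1 := by
  have h_univ : (Finset.univ : Finset (Σ ℓ, Fin (Module.finrank ℝ (𝒱 ℓ)))) =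
      (weights 𝒱).sigma fun _ => Finset.univ := by
    ext ⟨ℓ, i⟩
    simp only [Finset.mem_univ, Finset.mem_sigma, and_true, true_iff, mem_weights]
    intro h
    exact (Fin.pos i).ne' (by rw [h, finrank_bot])
  rw [homogeneousDim_eq_sum_weights, h_univ, Finset.sum_sigma]
  simp [mul_comm]

theorem det_dilation (r : ℝ) : LinearMap.det (dilation 𝒱 r) = r ^ homogeneousDim 𝒱 := by
  classical
  let b := (DirectSum.Decomposition.isInternal 𝒱).collectedBasis
    (fun ℓ => Module.finBasis ℝ (𝒱 ℓ))
  have : Finite (Σ ℓ, Fin (Module.finrank ℝ (𝒱 ℓ))) := Module.Finite.finite_basis b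
  let : Fintype (Σ ℓ, Fin (Module.finrank ℝ (𝒱 ℓ))) := Fintype.ofFinite _
  have hb (i) : b i ∈ 𝒱 i.1 := DirectSum.IsInternal.collectedBasis_mem _ _ i
  have h_diag : LinearMap.toMatrix b b (dilation 𝒱 r) = Matrix.diagonal fun i => r ^ i.1 := by
    ext i j
    rw [LinearMap.toMatrix_apply, dilation_of_mem 𝒱 r (hb j), map_smul, b.repr_self,
      Matrix.diagonal_apply]
    rcases eq_or_ne i j with rfl | h
    · simp
    · simp [h]
  rw [← LinearMap.det_toMatrix b, h_diag, Matrix.det_diagonal, Finset.prod_pow_eq_pow_sum,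
    homogeneousDim_eq_sum_sigma]

end Weights

section Translation

variable {G : Type u} [NormedAddCommGroup G] [NormedSpace ℝ G] [Group G] [LieGroup 𝓘(ℝ, G) ∞ G]

theorem continuous_det_fderiv_groupMul_left :
    Continuous fun p : G × G => (fderiv ℝ (fun a => p.1 * a) p.2).det := by
  have h_mul : ContDiff ℝ ∞ fun q : (G × G) × G => q.1.1 * q.2 :=
    contDiff_groupMul.comp (contDiff_fst.fst.prodMk contDiff_snd)
  have h_fderiv : ContDiff ℝ ∞ fun p : G × G => fderiv ℝ (fun a => p.1 * a) p.2 :=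
    ContDiff.fderiv (f := fun (p : G × G) a => p.1 * a) (n := ∞) (m := ∞) h_mul contDiff_snd
      (by simp)
  exact ContinuousLinearMap.continuous_det.comp h_fderiv.continuous

theorem norm_iteratedFDeriv_inv_mul_le (hG : IsExponentialCoordinates G) (n : ℕ) (g y : G) :
    ‖iteratedFDeriv ℝ n (fun y : G => y⁻¹ * g) y‖ ≤
      ‖iteratedFDeriv ℝ n (fun p : G × G => p.1 * p.2) (-y, g)‖ := by
  let L : G →L[ℝ] G × G := (-ContinuousLinearMap.id ℝ G).prod 0
  have norm_L : ‖L‖ ≤ 1 := L.opNorm_le_bound zero_le_one fun x => by simp [L, Prod.norm_def]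
  have L_add (y : G) : L y + (0, g) = (-y, g) := by simp [L]
  have inv_mul_eq : (fun y : G => y⁻¹ * g) =
      (fun p : G × G => (p + (0, g)).1 * (p + (0, g)).2) ∘ L := by
    ext y
    simp [L, hG.inv_eq_neg]
  have contDiff_shift : ContDiff ℝ n fun p : G × G => (p + (0, g)).1 * (p + (0, g)).2 :=
    (contDiff_groupMul.of_le (by exact_mod_cast le_top)).comp (contDiff_id.add contDiff_const)
  rw [inv_mul_eq, L.iteratedFDeriv_comp_right contDiff_shift y le_rfl,
    iteratedFDeriv_comp_add_right (f := fun p : G × G => p.1 * p.2), L_add]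
  refine (ContinuousMultilinearMap.norm_compContinuousLinearMap_le _ _).trans ?_
  rw [Finset.prod_const]
  exact mul_le_of_le_one_right (norm_nonneg _) (pow_le_one₀ (norm_nonneg _) norm_L)

end Translation

section Haar

variable {G : Type u} [NormedAddCommGroup G] [NormedSpace ℝ G] [FiniteDimensional ℝ G]
  (𝒱 : ℕ → Submodule ℝ G) [DirectSum.Decomposition 𝒱]

theorem map_dilation_addHaar [MeasurableSpace G] [BorelSpace G] (μ : Measure G)
    [μ.IsAddHaarMeasure] {r : ℝ} (hr : 0 < r) :
    μ.map (dilation 𝒱 r) = ENNReal.ofReal (r ^ homogeneousDim 𝒱)⁻¹ • μ := by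
  have hdet : LinearMap.det (dilation 𝒱 r) ≠ 0 := by rw [det_dilation]; positivity
  rw [Measure.map_linearMap_addHaar_eq_smul_addHaar μ hdet, det_dilation,
    abs_of_pos (by positivity)]

theorem integral_comp_dilation {E : Type*} [NormedAddCommGroup E] [NormedSpace ℝ E]
    [MeasurableSpace G] [BorelSpace G] (μ : Measure G) [μ.IsAddHaarMeasure] {r : ℝ} (hr : 0 < r)
    (f : G → E) :
    ∫ x, f (dilation 𝒱 r x) ∂μ = (r ^ homogeneousDim 𝒱)⁻¹ • ∫ x, f x ∂μ := by
  have h_emb : MeasurableEmbedding (dilation 𝒱 r) :=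
    (dilationEquiv 𝒱 hr.ne').toHomeomorph.measurableEmbedding
  rw [← h_emb.integral_map, map_dilation_addHaar 𝒱 μ hr, integral_smul_measure,
    ENNReal.toReal_ofReal (by positivity)]

variable [Group G] [LieGroup 𝓘(ℝ, G) ∞ G]

theorem det_fderiv_groupMul_left_dilation (hG : IsExponentialCoordinates G)
    (h𝒱 : IsLieGradation 𝒱) {r : ℝ} (hr : 0 < r) (x y : G) :
    (fderiv ℝ (fun a => dilation 𝒱 r x * a) (dilation 𝒱 r y)).det =
      (fderiv ℝ (fun a => x * a) y).det := by
  let D := LinearMap.toContinuousLinearMap (dilation 𝒱 r)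
  have hasFDerivAt_mul (x y : G) : HasFDerivAt (fun a => x * a) (fderiv ℝ (fun a => x * a) y) y :=
    ((contDiff_groupMul_left x).differentiable (by simp)).differentiableAt.hasFDerivAt
  have intertwine : (D ∘ fun a => x * a) = (fun a => dilation 𝒱 r x * a) ∘ D :=
    funext fun a => dilation_mul 𝒱 hG h𝒱 r x a
  have deriv_left := D.hasFDerivAt.comp y (hasFDerivAt_mul x y)
  have deriv_right :=
    (hasFDerivAt_mul (dilation 𝒱 r x) (dilation 𝒱 r y)).comp y (f := D) D.hasFDerivAt
  rw [intertwine] at deriv_left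
  have det_eq := congrArg ContinuousLinearMap.det (deriv_left.unique deriv_right)
  have hD : D.det ≠ 0 := by
    change LinearMap.det (dilation 𝒱 r) ≠ 0
    rw [det_dilation]; positivity
  simp only [ContinuousLinearMap.det, ContinuousLinearMap.toLinearMap_comp,
    LinearMap.det_comp] at det_eq hD ⊢
  rw [mul_comm] at det_eq
  exact (mul_right_cancel₀ hD det_eq).symm

/- The determinant is invariant under simultaneous dilation of `x` and `y`, so it equals its limit
at the origin, where the translation is the identity. -/
theorem det_fderiv_groupMul_left (hG : IsExponentialCoordinates G) (h𝒱 : IsLieGradation 𝒱)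
    (x y : G) : (fderiv ℝ (fun a => x * a) y).det = 1 := by
  have tendsto_dilation (x : G) : Tendsto (fun r : ℝ => dilation 𝒱 r x) (𝓝[>] 0) (𝓝 0) := by
    have h := (continuous_dilation_left 𝒱 x).tendsto 0
    rw [dilation_zero 𝒱 h𝒱.zero_eq_bot] at h
    exact h.mono_left nhdsWithin_le_nhds
  have tendsto_det : Tendsto (fun _ : ℝ => (fderiv ℝ (fun a => x * a) y).det) (𝓝[>] 0)
      (𝓝 (fderiv ℝ (fun a => (0 : G) * a) 0).det) :=
    ((continuous_det_fderiv_groupMul_left.tendsto (0, 0)).comp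
      ((tendsto_dilation x).prodMk_nhds (tendsto_dilation y))).congr'
      (eventually_nhdsWithin_of_forall fun r hr =>
        det_fderiv_groupMul_left_dilation 𝒱 hG h𝒱 hr x y)
  have zero_mul_eq_id : (fun a : G => (0 : G) * a) = id := by ext; simp [← hG.one_eq_zero]
  rw [tendsto_nhds_unique tendsto_const_nhds tendsto_det, zero_mul_eq_id, fderiv_id]
  simp [ContinuousLinearMap.det]

variable [MeasurableSpace G] [BorelSpace G]

include 𝒱 in
theorem isMulLeftInvariant_of_isAddHaarMeasure (hG : IsExponentialCoordinates G)
    (h𝒱 : IsLieGradation 𝒱) (μ : Measure G) [μ.IsAddHaarMeasure] : μ.IsMulLeftInvariant := by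
  refine ⟨fun g => ?_⟩
  have change_of_variables :=
    map_withDensity_abs_det_fderiv_eq_addHaar μ (s := Set.univ)
      (f := fun a : G => g * a) (f' := fun y => fderiv ℝ (fun a => g * a) y)
      MeasurableSet.univ.nullMeasurableSet
      (fun y _ => ((contDiff_groupMul_left g).differentiable
        (by simp)).differentiableAt.hasFDerivAt.hasFDerivWithinAt)
      (mul_right_injective g).injOn
  simpa [det_fderiv_groupMul_left 𝒱 hG h𝒱, Set.image_univ, (Group.mulLeft_bijective g).2.range_eq]
    using change_of_variables

include 𝒱 in
theorem isAddHaarMeasure_of_isHaarMeasure (hG : IsExponentialCoordinates G)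
    (h𝒱 : IsLieGradation 𝒱) (μ : Measure G) [μ.IsHaarMeasure] : μ.IsAddHaarMeasure := by
  have : IsTopologicalGroup G := topologicalGroup_of_lieGroup 𝓘(ℝ, G) ∞
  have : ProperSpace G := FiniteDimensional.proper ℝ G
  let lam : Measure G := Measure.addHaar
  have : lam.IsMulLeftInvariant := isMulLeftInvariant_of_isAddHaarMeasure 𝒱 hG h𝒱 lam
  have : lam.IsHaarMeasure := { }
  rw [Measure.isMulLeftInvariant_eq_smul μ lam]
  exact Measure.IsAddHaarMeasure.nnreal_smul lam
    (Measure.haarScalarFactor_pos_of_isHaarMeasure μ lam).ne'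

end Haar

section Growth

theorem integrable_inv_one_add_norm_pow {E : Type*} [NormedAddCommGroup E] [NormedSpace ℝ E]
    [FiniteDimensional ℝ E] [MeasurableSpace E] [BorelSpace E] (μ : Measure E)
    [μ.IsAddHaarMeasure] {n : ℕ} (hn : Module.finrank ℝ E < n) :
    Integrable (fun x => ((1 + ‖x‖) ^ n)⁻¹) μ := by
  refine (integrable_one_add_norm (μ := μ) (r := n) (by exact_mod_cast hn)).congr
    (Eventually.of_forall fun x => ?_)
  simp only
  rw [Real.rpow_neg (by positivity), Real.rpow_natCast]

theorem one_add_norm_prodMk_le {E F : Type*} [SeminormedAddCommGroup E] [SeminormedAddCommGroup F]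
    (x : E) (y : F) : 1 + ‖(x, y)‖ ≤ (1 + ‖x‖) * (1 + ‖y‖) := by
  have h_mul := mul_nonneg (norm_nonneg x) (norm_nonneg y)
  rw [Prod.norm_mk, ← le_sub_iff_add_le']
  exact max_le (by nlinarith [norm_nonneg y]) (by nlinarith [norm_nonneg x])

variable {G : Type u} [NormedAddCommGroup G] [NormedSpace ℝ G] [FiniteDimensional ℝ G]
  (𝒱 : ℕ → Submodule ℝ G) [DirectSum.Decomposition 𝒱] [Group G] [LieGroup 𝓘(ℝ, G) ∞ G]

theorem norm_iteratedFDeriv_groupMul_le_dilation (hG : IsExponentialCoordinates G)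
    (h𝒱 : IsLieGradation 𝒱) (n : ℕ) {r : ℝ} (hr : r ≠ 0) {a b : ℝ}
    (ha : ∀ x, ‖dilation 𝒱 r x‖ ≤ a * ‖x‖) (hb : ∀ x, ‖dilation 𝒱 r⁻¹ x‖ ≤ b * ‖x‖)
    (ha0 : 0 ≤ a) (hb0 : 0 ≤ b) (x y : G) :
    ‖iteratedFDeriv ℝ n (fun p : G × G => p.1 * p.2) (x, y)‖ ≤ a * b ^ n *
      ‖iteratedFDeriv ℝ n (fun p : G × G => p.1 * p.2) (dilation 𝒱 r⁻¹ x, dilation 𝒱 r⁻¹ y)‖ := by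
  have contDiff_mul : ContDiff ℝ n fun p : G × G => p.1 * p.2 :=
    contDiff_groupMul.of_le (by exact_mod_cast le_top)
  let D := LinearMap.toContinuousLinearMap (dilation 𝒱 r)
  let D₁ := LinearMap.toContinuousLinearMap (dilation 𝒱 r⁻¹)
  let D' : G × G →L[ℝ] G × G := D₁.prodMap D₁
  have norm_D : ‖D‖ ≤ a := D.opNorm_le_bound ha0 ha
  have norm_D' : ‖D'‖ ≤ b := D'.opNorm_le_bound hb0 fun q =>
    max_le ((hb q.1).trans (by gcongr; exact norm_fst_le q))
      ((hb q.2).trans (by gcongr; exact norm_snd_le q))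
  have mul_eq : (fun p : G × G => p.1 * p.2) = D ∘ ((fun p : G × G => p.1 * p.2) ∘ D') := by
    ext q
    change _ = dilation 𝒱 r (dilation 𝒱 r⁻¹ q.1 * dilation 𝒱 r⁻¹ q.2)
    rw [dilation_mul 𝒱 hG h𝒱, dilation_dilation, dilation_dilation, mul_inv_cancel₀ hr,
      dilation_one, dilation_one]
  conv_lhs => rw [mul_eq]
  rw [D.iteratedFDeriv_comp_left (contDiff_mul.comp D'.contDiff).contDiffAt le_rfl,
    D'.iteratedFDeriv_comp_right contDiff_mul (x, y) le_rfl]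
  calc _ ≤ ‖D‖ * (‖iteratedFDeriv ℝ n (fun p : G × G => p.1 * p.2) (D' (x, y))‖ *
        ∏ _ : Fin n, ‖D'‖) :=
        (ContinuousLinearMap.norm_compContinuousMultilinearMap_le _ _).trans
          (by gcongr; exact ContinuousMultilinearMap.norm_compContinuousLinearMap_le _ _)
    _ = ‖D‖ * ‖D'‖ ^ n * ‖iteratedFDeriv ℝ n (fun p : G × G => p.1 * p.2) (D' (x, y))‖ := by
        rw [Finset.prod_const, Finset.card_univ, Fintype.card_fin]; ring
    _ ≤ a * b ^ n * ‖iteratedFDeriv ℝ n (fun p : G × G => p.1 * p.2) (D' (x, y))‖ := by gcongr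

/- The dilation by `(1 + ‖p‖)⁻¹` brings `p` into a fixed compact set, on which the derivatives of
the group law are bounded. -/
include 𝒱 in
theorem exists_norm_iteratedFDeriv_groupMul_le (hG : IsExponentialCoordinates G)
    (h𝒱 : IsLieGradation 𝒱) (n : ℕ) : ∃ C : ℝ, 1 ≤ C ∧ ∃ k : ℕ, ∀ p : G × G,
      ‖iteratedFDeriv ℝ n (fun p : G × G => p.1 * p.2) p‖ ≤ C * (1 + ‖p‖) ^ k := by
  obtain ⟨C, hC1, s, hC⟩ := exists_norm_dilation_le 𝒱 h𝒱.zero_eq_bot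
  have : ProperSpace G := FiniteDimensional.proper ℝ G
  have continuous_deriv : Continuous (iteratedFDeriv ℝ n fun p : G × G => p.1 * p.2) :=
    (contDiff_groupMul.of_le (by exact_mod_cast le_top)).continuous_iteratedFDeriv'
  obtain ⟨K, hK⟩ := (isCompact_closedBall (0 : G × G) C).exists_bound_of_continuousOn
    continuous_deriv.continuousOn
  have hK0 : 0 ≤ K := (norm_nonneg _).trans (hK 0 (by simp; linarith))
  refine ⟨1 + C * C ^ n * K, le_add_of_nonneg_right (by positivity), s, fun p => ?_⟩
  set r := 1 + ‖p‖ with hr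
  have hr1 : 1 ≤ r := by simp [hr]
  have norm_dilation_inv (x : G) : ‖dilation 𝒱 r⁻¹ x‖ ≤ C * ‖x‖ := by
    refine (hC r hr1 x).2.trans ?_
    gcongr
    exact mul_le_of_le_one_right (by linarith) (inv_le_one_of_one_le₀ hr1)
  have norm_rescaled {x : G} (hx : ‖x‖ ≤ ‖p‖) : ‖dilation 𝒱 r⁻¹ x‖ ≤ C := by
    refine (hC r hr1 x).2.trans ?_
    rw [mul_assoc]
    refine mul_le_of_le_one_right (by linarith) ?_
    rw [inv_mul_le_iff₀ (by linarith)]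
    linarith
  have rescaled_mem :
      (dilation 𝒱 r⁻¹ p.1, dilation 𝒱 r⁻¹ p.2) ∈ Metric.closedBall (0 : G × G) C := by
    rw [mem_closedBall_zero_iff]
    exact max_le (norm_rescaled (norm_fst_le p)) (norm_rescaled (norm_snd_le p))
  calc _ ≤ C * r ^ s * C ^ n * ‖iteratedFDeriv ℝ n (fun p : G × G => p.1 * p.2)
        (dilation 𝒱 r⁻¹ p.1, dilation 𝒱 r⁻¹ p.2)‖ :=
        norm_iteratedFDeriv_groupMul_le_dilation 𝒱 hG h𝒱 n (by linarith)
          (fun x => (hC r hr1 x).1) norm_dilation_inv (by positivity) (by positivity) p.1 p.2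
    _ ≤ C * r ^ s * C ^ n * K := by gcongr; exact hK _ rescaled_mem
    _ = C * C ^ n * K * r ^ s := by ring
    _ ≤ (1 + C * C ^ n * K) * r ^ s := by gcongr; linarith

include 𝒱 in
theorem exists_one_add_norm_mul_le (hG : IsExponentialCoordinates G) (h𝒱 : IsLieGradation 𝒱) :
    ∃ C : ℝ, 1 ≤ C ∧ ∃ k : ℕ, ∀ x y : G,
      1 + ‖x * y‖ ≤ C * (1 + ‖x‖) ^ k * (1 + ‖y‖) ^ k := by
  obtain ⟨C, hC1, k, hC⟩ := exists_norm_iteratedFDeriv_groupMul_le 𝒱 hG h𝒱 0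
  refine ⟨1 + C, by linarith, k, fun x y => ?_⟩
  have norm_mul_le : ‖x * y‖ ≤ C * (1 + ‖(x, y)‖) ^ k := by
    simpa only [norm_iteratedFDeriv_zero] using hC (x, y)
  calc 1 + ‖x * y‖ ≤ (1 + ‖(x, y)‖) ^ k + C * (1 + ‖(x, y)‖) ^ k :=
        add_le_add (one_le_pow₀ (le_add_of_nonneg_right (norm_nonneg _))) norm_mul_le
    _ = (1 + C) * (1 + ‖(x, y)‖) ^ k := by ring
    _ ≤ (1 + C) * ((1 + ‖x‖) * (1 + ‖y‖)) ^ k := by gcongr; exact one_add_norm_prodMk_le x y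
    _ = _ := by rw [mul_pow, mul_assoc]

include 𝒱 in
theorem exists_norm_iteratedFDeriv_inv_mul_le (hG : IsExponentialCoordinates G)
    (h𝒱 : IsLieGradation 𝒱) (n : ℕ) : ∃ C : ℝ, 1 ≤ C ∧ ∃ k : ℕ, ∀ i ≤ n, ∀ g y : G,
      ‖iteratedFDeriv ℝ i (fun y : G => y⁻¹ * g) y‖ ≤ C * ((1 + ‖y‖) * (1 + ‖g‖)) ^ k := by
  choose C hC1 k hC using exists_norm_iteratedFDeriv_groupMul_le 𝒱 hG h𝒱
  have hC0 (i : ℕ) : 0 ≤ C i := by linarith [hC1 i]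
  have C_le {i : ℕ} (hi : i ≤ n) : C i ≤ ∑ j ∈ Finset.range (n + 1), C j :=
    Finset.single_le_sum (fun j _ => hC0 j) (Finset.mem_range.2 (by omega))
  have k_le {i : ℕ} (hi : i ≤ n) : k i ≤ ∑ j ∈ Finset.range (n + 1), k j :=
    Finset.single_le_sum (fun j _ => Nat.zero_le _) (Finset.mem_range.2 (by omega))
  refine ⟨∑ i ∈ Finset.range (n + 1), C i, (hC1 0).trans (C_le n.zero_le),
    ∑ i ∈ Finset.range (n + 1), k i, fun i hi g y => ?_⟩
  have one_add_norm_le : 1 + ‖(-y, g)‖ ≤ (1 + ‖y‖) * (1 + ‖g‖) := by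
    simpa only [norm_neg] using one_add_norm_prodMk_le (-y) g
  calc ‖iteratedFDeriv ℝ i (fun y : G => y⁻¹ * g) y‖
      ≤ C i * (1 + ‖(-y, g)‖) ^ k i := (norm_iteratedFDeriv_inv_mul_le hG i g y).trans (hC i _)
    _ ≤ C i * ((1 + ‖y‖) * (1 + ‖g‖)) ^ k i := by gcongr; exact hC0 i
    _ ≤ _ := by
        gcongr
        · exact (hC0 i).trans (C_le hi)
        · exact C_le hi
        · exact le_trans (le_add_of_nonneg_right (norm_nonneg _)) one_add_norm_le
        · exact k_le hi

/- Faà di Bruno costs the power `k * n` of `1 + ‖g‖`, and `1 + ‖g‖` is dominated by a power of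
`1 + ‖y⁻¹ * g‖` because `y` is bounded; hence the choice of `q`. -/
include 𝒱 in
theorem exists_norm_iteratedFDeriv_comp_inv_mul_le (hG : IsExponentialCoordinates G)
    (h𝒱 : IsLieGradation 𝒱) (n m : ℕ) {R : ℝ} (hR : 0 ≤ R) :
    ∃ q : ℕ, ∃ C : ℝ, 0 ≤ C ∧ ∀ (f : G → ℂ) (A : ℝ), ContDiff ℝ ∞ f →
      (∀ i ≤ n, ∀ z, (1 + ‖z‖) ^ q * ‖iteratedFDeriv ℝ i f z‖ ≤ A) → ∀ g y : G, ‖y‖ ≤ R →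
      ∀ i ≤ n, (1 + ‖g‖) ^ m * ‖iteratedFDeriv ℝ i (fun y : G => f (y⁻¹ * g)) y‖ ≤ C * A := by
  obtain ⟨C, hC1, k, hC⟩ := exists_norm_iteratedFDeriv_inv_mul_le 𝒱 hG h𝒱 n
  obtain ⟨K, hK1, l, hK⟩ := exists_one_add_norm_mul_le 𝒱 hG h𝒱
  refine ⟨l * (m + k * n), n.factorial * (C * (1 + R) ^ k) ^ n * (K * (1 + R) ^ l) ^ (m + k * n),
    by positivity, fun f A hf hA g y hy i hi => ?_⟩
  set z := y⁻¹ * g with hz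
  have hA0 : 0 ≤ A := le_trans (by positivity) (hA 0 (Nat.zero_le _) 0)
  have inner_bound_ge_one : 1 ≤ C * ((1 + R) * (1 + ‖g‖)) ^ k :=
    one_le_mul_of_one_le_of_one_le hC1
      (one_le_pow₀ (one_le_mul_of_one_le_of_one_le (by linarith) (by simp)))
  have chain_rule_bound := norm_iteratedFDeriv_comp_le (n := i) (N := ∞) (g := f)
    (f := fun y : G => y⁻¹ * g) hf
    (contDiff_groupMul.comp (contDiff_groupInv.prodMk contDiff_const))
    (by exact_mod_cast le_top) y (C := A / (1 + ‖z‖) ^ (l * (m + k * n)))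
    (D := C * ((1 + R) * (1 + ‖g‖)) ^ k)
    (fun j hj => (le_div_iff₀' (by positivity)).2 (hA j (hj.trans hi) _))
    (fun j hj1 hj => ((hC j (hj.trans hi) g y).trans (by gcongr)).trans
      (le_self_pow₀ inner_bound_ge_one (by omega)))
  have one_add_norm_le : 1 + ‖g‖ ≤ (K * (1 + R) ^ l) * (1 + ‖z‖) ^ l := by
    have h := hK y z
    rw [hz, mul_inv_cancel_left, ← hz] at h
    exact h.trans (by gcongr)
  have factorial_le : (i.factorial : ℝ) ≤ n.factorial := by exact_mod_cast Nat.factorial_le hi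
  calc (1 + ‖g‖) ^ m * ‖iteratedFDeriv ℝ i (f ∘ fun y : G => y⁻¹ * g) y‖
      ≤ (1 + ‖g‖) ^ m * (n.factorial * (A / (1 + ‖z‖) ^ (l * (m + k * n))) *
        (C * ((1 + R) * (1 + ‖g‖)) ^ k) ^ n) := by
        gcongr
        exact chain_rule_bound.trans (by gcongr)
    _ = n.factorial * (C * (1 + R) ^ k) ^ n * (A / (1 + ‖z‖) ^ (l * (m + k * n))) *
        (1 + ‖g‖) ^ (m + k * n) := by
        rw [pow_add, pow_mul, mul_pow (1 + R), ← mul_assoc, mul_pow _ _ n]; ring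
    _ ≤ n.factorial * (C * (1 + R) ^ k) ^ n * (A / (1 + ‖z‖) ^ (l * (m + k * n))) *
        ((K * (1 + R) ^ l) * (1 + ‖z‖) ^ l) ^ (m + k * n) := by gcongr
    _ = n.factorial * (C * (1 + R) ^ k) ^ n * (K * (1 + R) ^ l) ^ (m + k * n) * A := by
        rw [mul_pow _ _ (m + k * n), ← pow_mul]
        field_simp

end Growth

section DiscreteSubgroup

variable {G : Type u} [TopologicalSpace G] [Group G] (Γ : Subgroup G) [DiscreteTopology Γ]

theorem exists_isOpen_forall_mem_eq_one :
    ∃ U : Set G, IsOpen U ∧ (1 : G) ∈ U ∧ ∀ γ : Γ, (γ : G) ∈ U → γ = 1 := by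
  obtain ⟨U, hU, hUΓ⟩ : ∃ U : Set G, IsOpen U ∧ (Subtype.val ⁻¹' U : Set Γ) = {1} :=
    isOpen_induced_iff.1 (isOpen_discrete ({1} : Set Γ))
  have mem_iff (γ : Γ) : (γ : G) ∈ U ↔ γ = 1 := Set.ext_iff.1 hUΓ γ
  exact ⟨U, hU, (mem_iff 1).2 rfl, fun γ => (mem_iff γ).1⟩

theorem exists_isOpen_forall_mul_mem_eq_one [IsTopologicalGroup G] :
    ∃ V : Set G, IsOpen V ∧ (1 : G) ∈ V ∧ ∀ v ∈ V, ∀ γ : Γ, (γ : G) * v ∈ V → γ = 1 := by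
  obtain ⟨U, hU, h1U, hUΓ⟩ := exists_isOpen_forall_mem_eq_one Γ
  obtain ⟨V, hV, hVU⟩ := exists_nhds_split_inv (hU.mem_nhds h1U)
  refine ⟨interior V, isOpen_interior, mem_interior_iff_mem_nhds.2 hV, fun v hv γ hγv => ?_⟩
  have div_mem : (γ : G) * v / v ∈ U := hVU _ (interior_subset hγv) v (interior_subset hv)
  rw [mul_div_cancel_right] at div_mem
  exact hUΓ γ div_mem

theorem pairwise_disjoint_mul_left_image {G : Type u} [Group G] {Γ : Subgroup G} {V : Set G}
    (hV : ∀ v ∈ V, ∀ γ : Γ, (γ : G) * v ∈ V → γ = 1) :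
    Pairwise (Function.onFun Disjoint fun γ : Γ => (fun v => (γ : G) * v) '' V) := by
  intro γ γ' hne
  rw [Function.onFun, Set.disjoint_left]
  rintro _ ⟨v, hv, rfl⟩ ⟨w, hw, hvw⟩
  have mul_eq : ((γ'⁻¹ * γ : Γ) : G) * v = w := by
    simp only [Subgroup.coe_mul, Subgroup.coe_inv, mul_assoc]
    rw [← show (γ' : G) * w = γ * v from hvw, inv_mul_cancel_left]
  exact hne (inv_mul_eq_one.1 (hV v hv (γ'⁻¹ * γ) (by rwa [mul_eq]))).symm

theorem countable_of_discreteTopology_subgroup [SecondCountableTopology G] : Countable Γ := by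
  have : SecondCountableTopology Γ := TopologicalSpace.Subtype.secondCountableTopology _
  exact TopologicalSpace.separableSpace_iff_countable.1 inferInstance

end DiscreteSubgroup

section Lattice

theorem exists_le_norm_conj {G : Type u} [NormedAddCommGroup G] [NormedSpace ℝ G] [Group G]
    [IsTopologicalGroup G] (Γ : Subgroup G) [DiscreteTopology Γ]
    (hG : IsExponentialCoordinates G) {B : Set G} (hB : IsCompact B) :
    ∃ δ : ℝ, 0 < δ ∧ ∀ x ∈ B, ∀ γ : Γ, γ ≠ 1 → δ ≤ ‖x⁻¹ * (γ : G) * x‖ := by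
  obtain ⟨U, hU, h1U, hUΓ⟩ := exists_isOpen_forall_mem_eq_one Γ
  have isOpen_conj_preimage : IsOpen ((fun p : G × G => p.1 * p.2 * p.1⁻¹) ⁻¹' U) :=
    hU.preimage (by fun_prop)
  obtain ⟨u, v, -, hv, hBu, h0v, huv⟩ := generalized_tube_lemma hB
    (isCompact_singleton (x := (0 : G))) isOpen_conj_preimage (by
      rintro ⟨x, y⟩ ⟨-, rfl : y = 0⟩
      simp [← hG.one_eq_zero, h1U])
  obtain ⟨δ, hδ, hball⟩ := Metric.isOpen_iff.1 hv 0 (h0v rfl)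
  refine ⟨δ, hδ, fun x hx γ hγ => ?_⟩
  by_contra! hlt
  have conj_mem : x⁻¹ * (γ : G) * x ∈ v := hball (by simpa using hlt)
  have mem_U : (γ : G) ∈ U := by simpa [mul_assoc] using huv (Set.mk_mem_prod (hBu hx) conj_mem)
  exact hγ (hUΓ γ mem_U)

variable {G : Type u} [NormedAddCommGroup G] [NormedSpace ℝ G] [FiniteDimensional ℝ G]
  (𝒱 : ℕ → Submodule ℝ G) [DirectSum.Decomposition 𝒱] [Group G] [LieGroup 𝓘(ℝ, G) ∞ G]

include 𝒱 in
theorem exists_le_setIntegral_mul_left_image [MeasurableSpace G] [BorelSpace G]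
    (hG : IsExponentialCoordinates G) (h𝒱 : IsLieGradation 𝒱) (μ : Measure G)
    [μ.IsAddHaarMeasure] {V : Set G} (hVo : IsOpen V) (hVne : V.Nonempty) {R : ℝ}
    (hVR : V ⊆ Metric.ball 0 R) {d : ℕ} (hd : Module.finrank ℝ G < d) :
    ∃ c : ℝ, 0 < c ∧ ∃ m : ℕ, ∀ g : G, c * ((1 + ‖g‖) ^ m)⁻¹ ≤
      ∫ y in (fun v => g * v) '' V, ((1 + ‖y‖) ^ d)⁻¹ ∂μ := by
  have : IsTopologicalGroup G := topologicalGroup_of_lieGroup 𝓘(ℝ, G) ∞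
  have : ProperSpace G := FiniteDimensional.proper ℝ G
  have : μ.IsMulLeftInvariant := isMulLeftInvariant_of_isAddHaarMeasure 𝒱 hG h𝒱 μ
  have hR : 0 < R := Metric.nonempty_ball.1 (hVne.mono hVR)
  have measure_V_ne_top : μ V ≠ ⊤ := ((measure_mono hVR).trans_lt measure_ball_lt_top).ne
  have measure_V_pos : 0 < μ.real V :=
    ENNReal.toReal_pos (hVo.measure_pos μ hVne).ne' measure_V_ne_top
  have measure_translate (g : G) : μ ((fun v => g * v) '' V) = μ V := by
    rw [Set.image_mul_left, measure_preimage_mul]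
  obtain ⟨C, hC1, k, hC⟩ := exists_one_add_norm_mul_le 𝒱 hG h𝒱
  set K := C * (1 + R) ^ k with hK
  have norm_translate_le (g : G) {v : G} (hv : v ∈ V) : 1 + ‖g * v‖ ≤ K * (1 + ‖g‖) ^ k := by
    have hvR : ‖v‖ ≤ R := by simpa using (Metric.mem_ball.1 (hVR hv)).le
    calc 1 + ‖g * v‖ ≤ C * (1 + ‖g‖) ^ k * (1 + R) ^ k := (hC g v).trans (by gcongr)
      _ = K * (1 + ‖g‖) ^ k := by rw [hK]; ring
  refine ⟨μ.real V * (K ^ d)⁻¹, by positivity, k * d, fun g => ?_⟩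
  calc μ.real V * (K ^ d)⁻¹ * ((1 + ‖g‖) ^ (k * d))⁻¹
      = ∫ _ in (fun v => g * v) '' V, (K ^ d)⁻¹ * ((1 + ‖g‖) ^ (k * d))⁻¹ ∂μ := by
        rw [setIntegral_const, measureReal_def, measureReal_def, measure_translate, smul_eq_mul,
          mul_assoc]
    _ ≤ _ := by
        refine setIntegral_mono_on
          (integrableOn_const (by rwa [measure_translate]))
          (integrable_inv_one_add_norm_pow μ hd).integrableOn
          ((isOpenMap_mul_left g) V hVo).measurableSet ?_
        rintro _ ⟨v, hv, rfl⟩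
        simp only
        rw [← mul_inv, pow_mul, ← mul_pow]
        gcongr
        exact norm_translate_le g hv

include 𝒱 in
/- Comparison with the integral of an integrable power of `1 + ‖y‖` over disjoint translates of a
small neighbourhood of `1`. -/
theorem exists_summable_lattice (Γ : Subgroup G) [DiscreteTopology Γ]
    (hG : IsExponentialCoordinates G) (h𝒱 : IsLieGradation 𝒱) :
    ∃ m : ℕ, Summable fun γ : Γ => ((1 + ‖(γ : G)‖) ^ m)⁻¹ := by
  borelize G
  have : IsTopologicalGroup G := topologicalGroup_of_lieGroup 𝓘(ℝ, G) ∞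
  have : ProperSpace G := FiniteDimensional.proper ℝ G
  have : SecondCountableTopology G := secondCountable_of_proper
  have : Countable Γ := countable_of_discreteTopology_subgroup Γ
  obtain ⟨V₀, hV₀, h1V₀, hV₀Γ⟩ := exists_isOpen_forall_mul_mem_eq_one Γ
  let V := V₀ ∩ Metric.ball 0 1
  have hVo : IsOpen V := hV₀.inter Metric.isOpen_ball
  have hVΓ : ∀ v ∈ V, ∀ γ : Γ, (γ : G) * v ∈ V → γ = 1 := fun v hv γ h => hV₀Γ v hv.1 γ h.1
  obtain ⟨c, hc, m, hcm⟩ := exists_le_setIntegral_mul_left_image 𝒱 hG h𝒱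
    (Measure.addHaar : Measure G) hVo ⟨1, h1V₀, by simp [hG.one_eq_zero]⟩
    Set.inter_subset_right (Nat.lt_succ_self (Module.finrank ℝ G))
  have summable_setIntegral := (hasSum_integral_iUnion
    (fun γ : Γ => ((isOpenMap_mul_left (γ : G)) V hVo).measurableSet)
    (pairwise_disjoint_mul_left_image hVΓ)
    (integrable_inv_one_add_norm_pow Measure.addHaar (Nat.lt_succ_self _)).integrableOn).summable
  exact ⟨m, (summable_mul_left_iff hc.ne').1
    (.of_nonneg_of_le (fun γ => by positivity) (fun γ => hcm γ) summable_setIntegral)⟩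

include 𝒱 in
theorem exists_one_add_norm_le_inv_mul_mul (hG : IsExponentialCoordinates G)
    (h𝒱 : IsLieGradation 𝒱) {R : ℝ} (hR : 0 ≤ R) :
    ∃ C : ℝ, 1 ≤ C ∧ ∃ k : ℕ, ∀ x y g : G, ‖x‖ ≤ R → ‖y‖ ≤ R →
      1 + ‖g‖ ≤ C * (1 + ‖y⁻¹ * (g * x)‖) ^ k := by
  obtain ⟨C, hC1, k, hC⟩ := exists_one_add_norm_mul_le 𝒱 hG h𝒱
  have hRk : 1 ≤ (1 + R) ^ k := one_le_pow₀ (by linarith)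
  refine ⟨C * (C * (1 + R) ^ k) ^ k * (1 + R) ^ k, ?_, k * k, fun x y g hx hy => ?_⟩
  · exact one_le_mul_of_one_le_of_one_le (one_le_mul_of_one_le_of_one_le hC1
      (one_le_pow₀ (one_le_mul_of_one_le_of_one_le hC1 hRk))) hRk
  set z := y⁻¹ * (g * x) with hz
  have g_eq : g = y * z * x⁻¹ := by rw [hz]; group
  have norm_mul_le : 1 + ‖y * z‖ ≤ C * (1 + R) ^ k * (1 + ‖z‖) ^ k :=
    (hC y z).trans (by gcongr)
  calc 1 + ‖g‖ ≤ C * (1 + ‖y * z‖) ^ k * (1 + ‖x⁻¹‖) ^ k := by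
        conv_lhs => rw [g_eq]
        exact hC (y * z) x⁻¹
    _ ≤ C * (C * (1 + R) ^ k * (1 + ‖z‖) ^ k) ^ k * (1 + R) ^ k := by
        rw [hG.inv_eq_neg, norm_neg]
        gcongr
    _ = _ := by rw [mul_pow _ ((1 + ‖z‖) ^ k), ← pow_mul]; ring

variable (Γ : Subgroup G) [DiscreteTopology Γ]

theorem exists_one_add_norm_conj_le_dilation (hG : IsExponentialCoordinates G)
    (h𝒱 : IsLieGradation 𝒱) (R : ℝ) : ∃ C : ℝ, 0 ≤ C ∧ ∀ ε ∈ Set.Ioc (0 : ℝ) 1,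
      ∀ x : G, ‖x‖ ≤ R → ∀ γ : Γ, γ ≠ 1 →
        1 + ‖x⁻¹ * (γ * x)‖ ≤ C * ε * (1 + ‖dilation 𝒱 ε⁻¹ (x⁻¹ * (γ * x))‖) := by
  have : ProperSpace G := FiniteDimensional.proper ℝ G
  have : IsTopologicalGroup G := topologicalGroup_of_lieGroup 𝓘(ℝ, G) ∞
  obtain ⟨δ, hδ, hδΓ⟩ := exists_le_norm_conj Γ hG (isCompact_closedBall (0 : G) R)
  obtain ⟨K, hK1, hK⟩ := exists_norm_le_dilation_inv 𝒱 h𝒱.zero_eq_bot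
  refine ⟨(1 + δ⁻¹) * K, by positivity, fun ε hε x hx γ hγ => ?_⟩
  have hε0 : 0 < ε := hε.1
  set v := x⁻¹ * (γ * x)
  set w := dilation 𝒱 ε⁻¹ v
  have le_norm_v : 1 ≤ δ⁻¹ * ‖v‖ := by
    rw [inv_mul_eq_div, one_le_div hδ]
    simpa only [mul_assoc] using hδΓ x (by simpa using hx) γ hγ
  calc 1 + ‖v‖ ≤ (1 + δ⁻¹) * ‖v‖ := by linarith
    _ ≤ (1 + δ⁻¹) * (K * ε * (1 + ‖w‖)) := by
        gcongr
        exact (hK ε hε v).trans (by gcongr; linarith)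
    _ = _ := by ring

theorem exists_pow_norm_lattice_le (hG : IsExponentialCoordinates G) (h𝒱 : IsLieGradation 𝒱)
    {R : ℝ} (hR : 0 ≤ R) (N m : ℕ) : ∃ C : ℝ, 0 ≤ C ∧ ∃ q : ℕ, ∀ ε ∈ Set.Ioc (0 : ℝ) 1,
      ∀ x : G, ‖x‖ ≤ R → ∀ γ : Γ, γ ≠ 1 →
        (1 + ‖(γ : G)‖) ^ m ≤ C * ε ^ N * (1 + ‖dilation 𝒱 ε⁻¹ (x⁻¹ * (γ * x))‖) ^ q := by
  obtain ⟨C, hC1, k, hC⟩ := exists_one_add_norm_le_inv_mul_mul 𝒱 hG h𝒱 hR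
  obtain ⟨K, hK0, hK⟩ := exists_one_add_norm_conj_le_dilation 𝒱 Γ hG h𝒱 R
  refine ⟨C ^ m * K ^ (k * m + N), by positivity, k * m + N, fun ε hε x hx γ hγ => ?_⟩
  have hε0 : 0 < ε := hε.1
  set v := x⁻¹ * (γ * x)
  set w := dilation 𝒱 ε⁻¹ v
  calc (1 + ‖(γ : G)‖) ^ m ≤ (C * (1 + ‖v‖) ^ k) ^ m := by
        gcongr
        exact hC x x γ hx hx
    _ = C ^ m * (1 + ‖v‖) ^ (k * m) := by rw [mul_pow, pow_mul]
    _ ≤ C ^ m * (1 + ‖v‖) ^ (k * m + N) := by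
        gcongr
        · linarith [norm_nonneg v]
        · omega
    _ ≤ C ^ m * (K * ε * (1 + ‖w‖)) ^ (k * m + N) := by
        gcongr
        exact hK ε hε x hx γ hγ
    _ = C ^ m * K ^ (k * m + N) * ε ^ (k * m + N) * (1 + ‖w‖) ^ (k * m + N) := by
        rw [mul_pow _ (1 + ‖w‖), mul_pow _ ε]; ring
    _ ≤ _ := by
        gcongr ?_ * ?_ * ?_
        exact pow_le_pow_of_le_one hε0.le hε.2 (by omega)

end Lattice

section Quotient

variable {G : Type u} [Group G] (Γ : Subgroup G)

theorem NilManifold.mk_out (p : NilManifold Γ) : NilManifold.mk Γ (Quotient.out p) = p :=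
  Quotient.out_eq p

theorem NilManifold.mk_eq_mk_iff {x y : G} :
    NilManifold.mk Γ x = NilManifold.mk Γ y ↔ ∃ γ : Γ, y = (γ : G) * x :=
  ⟨fun h => NilManifold.rel_exists (Quotient.exact h), by
    rintro ⟨γ, rfl⟩; exact (NilManifold.mk_mul Γ γ x).symm⟩

theorem periodization_section (F : G → ℝ≥0∞) {s : NilManifold Γ → G}
    (hsec : ∀ p, NilManifold.mk Γ (s p) = p) (p : NilManifold Γ) :
    periodization Γ F p = ∑' γ : Γ, F (γ * s p) := by
  conv_lhs => rw [← hsec p]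
  rfl

variable [TopologicalSpace G] [IsTopologicalGroup G]

theorem NilManifold.isOpenQuotientMap_mk : IsOpenQuotientMap (NilManifold.mk Γ) :=
  MulAction.isOpenQuotientMap_quotientMk (Γ := Γ) (T := G)

theorem NilManifold.continuous_mk : Continuous (NilManifold.mk Γ) :=
  (NilManifold.isOpenQuotientMap_mk Γ).continuous

theorem NilManifold.secondCountableTopology [SecondCountableTopology G] :
    SecondCountableTopology (NilManifold Γ) :=
  (NilManifold.isOpenQuotientMap_mk Γ).isQuotientMap.secondCountableTopology
    (NilManifold.isOpenQuotientMap_mk Γ).isOpenMap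

theorem NilManifold.t2Space [T2Space G] [LocallyCompactSpace G] [DiscreteTopology Γ] :
    T2Space (NilManifold Γ) := by
  have tendsto_subtype : Tendsto Γ.subtype cofinite (cocompact G) :=
    Subgroup.tendsto_coe_cofinite_of_discrete Γ ⟨inferInstance⟩
  have : ProperlyDiscontinuousSMul Γ G :=
    Γ.properlyDiscontinuousSMul_of_tendsto_cofinite tendsto_subtype
  exact t2Space_of_properlyDiscontinuousSMul_of_t2Space (Γ := Γ) (T := G)

theorem NilManifold.borelSpace [PolishSpace G] [LocallyCompactSpace G] [MeasurableSpace G]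
    [BorelSpace G] [DiscreteTopology Γ] : BorelSpace (NilManifold Γ) := by
  have := NilManifold.t2Space Γ
  have := NilManifold.secondCountableTopology Γ
  exact Quotient.borelSpace

end Quotient

section MeasurableSection

variable {G : Type u} [Group G] [TopologicalSpace G] [MeasurableSpace G] {Γ : Subgroup G}

/-- Over `S ⊆ Γ \ G`, the projection `G → Γ \ G` has a measurable section with values in a compact
set. The section is a total function, of which only the restriction to `S` matters. -/
def HasCompactMeasurableSection (Γ : Subgroup G) (S : Set (NilManifold Γ)) : Prop :=
  ∃ s : NilManifold Γ → G, Measurable s ∧ (∀ p ∈ S, NilManifold.mk Γ (s p) = p) ∧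
    ∃ K : Set G, IsCompact K ∧ ∀ p ∈ S, s p ∈ K

theorem HasCompactMeasurableSection.union {S S' : Set (NilManifold Γ)} (hS : MeasurableSet S)
    (h : HasCompactMeasurableSection Γ S) (h' : HasCompactMeasurableSection Γ S') :
    HasCompactMeasurableSection Γ (S ∪ S') := by
  classical
  obtain ⟨s, hs, hsec, K, hK, hsK⟩ := h
  obtain ⟨s', hs', hsec', K', hK', hsK'⟩ := h'
  refine ⟨S.piecewise s s', hs.piecewise hS hs', fun p hp => ?_, K ∪ K', hK.union hK',
    fun p hp => ?_⟩
  all_goals by_cases hpS : p ∈ S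
  · simp [hpS, hsec p hpS]
  · simp [hpS, hsec' p (hp.resolve_left hpS)]
  · simp [hpS, hsK p hpS]
  · simp [hpS, hsK' p (hp.resolve_left hpS)]

variable [IsTopologicalGroup G] [PolishSpace G] [LocallyCompactSpace G] [BorelSpace G]
  (Γ) [DiscreteTopology Γ]

theorem exists_nhds_hasCompactMeasurableSection (p : NilManifold Γ) :
    ∃ S ∈ 𝓝 p, MeasurableSet S ∧ HasCompactMeasurableSection Γ S := by
  have := NilManifold.t2Space Γ
  have := NilManifold.secondCountableTopology Γ
  have : BorelSpace (NilManifold Γ) := NilManifold.borelSpace Γ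
  have hmk := NilManifold.isOpenQuotientMap_mk Γ
  obtain ⟨x, rfl⟩ := hmk.surjective p
  obtain ⟨V, hV, h1V, hVΓ⟩ := exists_isOpen_forall_mul_mem_eq_one Γ
  obtain ⟨K, hK, hxK⟩ := exists_compact_mem_nhds x
  set U : Set G := ((fun y => y * x⁻¹) ⁻¹' V) ∩ interior K
  have hUo : IsOpen U := (hV.preimage (continuous_mul_const _)).inter isOpen_interior
  have hxU : x ∈ U := ⟨by simpa using h1V, mem_interior_iff_mem_nhds.2 hxK⟩
  have injOn_mk : Set.InjOn (NilManifold.mk Γ) U := by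
    intro y hy z hz h
    obtain ⟨γ, rfl⟩ := (NilManifold.mk_eq_mk_iff Γ).1 h
    have hγ : γ = 1 := hVΓ _ hy.1 γ (by simpa only [Set.mem_preimage, mul_assoc] using hz.1)
    simp [hγ]
  have measurableEmbedding_mk := (NilManifold.continuous_mk Γ).continuousOn.measurableEmbedding
    hUo.measurableSet injOn_mk
  obtain ⟨s, hs, hsU⟩ :=
    measurableEmbedding_mk.exists_measurable_extend measurable_subtype_coe (fun _ => ⟨1⟩)
  have s_mk {y : G} (hy : y ∈ U) : s (NilManifold.mk Γ y) = y := congrFun hsU ⟨y, hy⟩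
  refine ⟨NilManifold.mk Γ '' U, hmk.isOpenMap.image_mem_nhds (hUo.mem_nhds hxU),
    (hmk.isOpenMap U hUo).measurableSet, s, hs, ?_, K, hK, ?_⟩
  · rintro _ ⟨y, hy, rfl⟩
    rw [s_mk hy]
  · rintro _ ⟨y, hy, rfl⟩
    rw [s_mk hy]
    exact interior_subset hy.2

theorem hasCompactMeasurableSection_univ [CompactSpace (NilManifold Γ)] :
    HasCompactMeasurableSection Γ Set.univ := by
  obtain ⟨S, hS, -, hsec⟩ : ∃ S, Set.univ ⊆ S ∧ MeasurableSet S ∧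
      HasCompactMeasurableSection Γ S := by
    refine isCompact_univ.induction_on (p := fun T : Set (NilManifold Γ) =>
      ∃ S, T ⊆ S ∧ MeasurableSet S ∧ HasCompactMeasurableSection Γ S) ?_ ?_ ?_ ?_
    · exact ⟨∅, subset_rfl, .empty, fun _ => 1, measurable_const, by simp, ∅, isCompact_empty,
        by simp⟩
    · rintro T T' hT ⟨S, hTS, h⟩
      exact ⟨S, hT.trans hTS, h⟩
    · rintro T T' ⟨S, hTS, hS, h⟩ ⟨S', hTS', hS', h'⟩
      exact ⟨S ∪ S', Set.union_subset_union hTS hTS', hS.union hS', h.union hS h'⟩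
    · intro p _
      obtain ⟨S, hpS, hS, h⟩ := exists_nhds_hasCompactMeasurableSection Γ p
      exact ⟨S, nhdsWithin_le_nhds hpS, S, subset_rfl, hS, h⟩
  rwa [Set.univ_subset_iff.1 hS] at hsec

theorem polishSpace_of_finiteDimensional (E : Type*) [NormedAddCommGroup E] [NormedSpace ℝ E]
    [FiniteDimensional ℝ E] : PolishSpace E := by
  have : ProperSpace E := FiniteDimensional.proper ℝ E
  have : CompleteSpace E := FiniteDimensional.complete ℝ E
  have : SecondCountableTopology E := secondCountable_of_proper
  infer_instance

theorem NilManifold.exists_measurable_section {G : Type u} [NormedAddCommGroup G]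
    [NormedSpace ℝ G] [FiniteDimensional ℝ G] [MeasurableSpace G] [BorelSpace G] [Group G]
    [IsTopologicalGroup G] (Γ : Subgroup G) [DiscreteTopology Γ] [CompactSpace (NilManifold Γ)] :
    ∃ s : NilManifold Γ → G, Measurable s ∧ (∀ p, NilManifold.mk Γ (s p) = p) ∧
      ∃ R : ℝ, 0 ≤ R ∧ ∀ p, ‖s p‖ ≤ R := by
  have : ProperSpace G := FiniteDimensional.proper ℝ G
  have : PolishSpace G := polishSpace_of_finiteDimensional G
  obtain ⟨s, hs, hsec, K, hK, hsK⟩ := hasCompactMeasurableSection_univ Γ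
  obtain ⟨R, hR, hKR⟩ := hK.isBounded.exists_pos_norm_le
  exact ⟨s, hs, fun p => hsec p trivial, R, hR.le, fun p => hKR _ (hsK p trivial)⟩

end MeasurableSection

section Measure

variable {G : Type u} [Group G] [MeasurableSpace G] {Γ : Subgroup G} {μ : Measure G}
  {ν : Measure (NilManifold Γ)} {s : NilManifold Γ → G}

theorem IsQuotientMeasure.isFiniteMeasure [TopologicalSpace G] [IsTopologicalGroup G]
    [PolishSpace G] [LocallyCompactSpace G] [BorelSpace G] [DiscreteTopology Γ]
    [CompactSpace (NilManifold Γ)] [IsFiniteMeasureOnCompacts μ] (hν : IsQuotientMeasure Γ μ ν) :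
    IsFiniteMeasure ν := by
  obtain ⟨s, -, hsec, K, hK, hsK⟩ := hasCompactMeasurableSection_univ Γ
  have one_le_periodization (p : NilManifold Γ) : 1 ≤ periodization Γ (K.indicator 1) p := by
    rw [periodization_section Γ _ (fun p => hsec p trivial)]
    refine le_trans ?_ (ENNReal.le_tsum (1 : Γ))
    simp [hsK p trivial]
  refine ⟨?_⟩
  calc ν Set.univ = ∫⁻ _, 1 ∂ν := by simp
    _ ≤ ∫⁻ p, periodization Γ (K.indicator 1) p ∂ν := lintegral_mono one_le_periodization
    _ = μ K := by
        rw [← hν _ (measurable_one.indicator hK.measurableSet),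
          lintegral_indicator_one hK.measurableSet]
    _ < ⊤ := hK.measure_lt_top

variable [MeasurableMul G] [Countable Γ]

theorem IsQuotientMeasure.eq_sum_map (hν : IsQuotientMeasure Γ μ ν) (hs : Measurable s)
    (hsec : ∀ p, NilManifold.mk Γ (s p) = p) :
    μ = Measure.sum fun γ : Γ => ν.map fun p => (γ : G) * s p := by
  ext A hA
  have measurable_mul (γ : Γ) : Measurable fun p => (γ : G) * s p := hs.const_mul _
  rw [Measure.sum_apply _ hA, ← lintegral_indicator_one hA, hν _ (measurable_one.indicator hA)]
  simp only [periodization_section _ _ hsec]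
  rw [lintegral_tsum (f := fun (γ : Γ) p => A.indicator 1 ((γ : G) * s p))
    fun γ => ((measurable_one.indicator hA).comp (measurable_mul γ)).aemeasurable]
  refine tsum_congr fun γ => ?_
  rw [Measure.map_apply (measurable_mul γ) hA, ← lintegral_indicator_one (measurable_mul γ hA)]
  rfl

variable {E : Type*} [NormedAddCommGroup E] {F : G → E}

theorem IsQuotientMeasure.integrable_iff (hν : IsQuotientMeasure Γ μ ν) (hs : Measurable s)
    (hsec : ∀ p, NilManifold.mk Γ (s p) = p)
    (hF : ∀ γ : Γ, AEStronglyMeasurable F (ν.map fun p => (γ : G) * s p)) :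
    Integrable F μ ↔ (∀ γ : Γ, Integrable (fun p => F (γ * s p)) ν) ∧
      Summable fun γ : Γ => ∫ p, ‖F (γ * s p)‖ ∂ν := by
  have measurable_mul (γ : Γ) : Measurable fun p => (γ : G) * s p := hs.const_mul _
  conv_lhs => rw [hν.eq_sum_map hs hsec]
  rw [integrable_sum_measure_iff]
  refine and_congr
    (forall_congr' fun γ => integrable_map_measure (hF γ) (measurable_mul γ).aemeasurable) ?_
  refine iff_of_eq (congrArg Summable (funext fun γ => ?_))
  exact integral_map (measurable_mul γ).aemeasurable (hF γ).norm

theorem IsQuotientMeasure.integral_eq [NormedSpace ℝ E] (hν : IsQuotientMeasure Γ μ ν)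
    (hs : Measurable s) (hsec : ∀ p, NilManifold.mk Γ (s p) = p) (hF : Integrable F μ) :
    ∫ x, F x ∂μ = ∫ p, ∑' γ : Γ, F (γ * s p) ∂ν := by
  have measurable_mul (γ : Γ) : Measurable fun p => (γ : G) * s p := hs.const_mul _
  have integrable_sum := hF
  rw [hν.eq_sum_map hs hsec] at integrable_sum
  have aestronglyMeasurable_map (γ : Γ) :
      AEStronglyMeasurable F (ν.map fun p => (γ : G) * s p) :=
    integrable_sum.aestronglyMeasurable.mono_measure (Measure.le_sum _ γ)
  obtain ⟨integrable_translate, summable_norm⟩ :=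
    (hν.integrable_iff hs hsec aestronglyMeasurable_map).1 hF
  rw [← integral_tsum_of_summable_integral_norm integrable_translate summable_norm]
  conv_lhs => rw [hν.eq_sum_map hs hsec]
  rw [integral_sum_measure integrable_sum]
  exact tsum_congr fun γ =>
    integral_map (measurable_mul γ).aemeasurable (aestronglyMeasurable_map γ)

end Measure

section OperatorTheory

theorem exists_regularization {A : Type*} [CStarAlgebra A] [PartialOrder A] [StarOrderedRing A]
    {P : A} (hP : 0 ≤ P) {δ : ℝ} (hδ : 0 < δ) :
    ∃ R : A, IsSelfAdjoint R ∧ ‖R * (P * P) * R‖ ≤ 1 ∧ ‖P - R * (P * P)‖ ≤ δ := by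
  have isSelfAdjoint_P : IsSelfAdjoint P := .of_nonneg hP
  have spectrum_nonneg : ∀ t ∈ spectrum ℝ P, 0 ≤ t := fun t ht => spectrum_nonneg_of_nonneg hP ht
  have add_ne_zero : ∀ t ∈ spectrum ℝ P, t + δ ≠ 0 := fun t ht => by
    linarith [spectrum_nonneg t ht]
  have continuousOn_inv : ContinuousOn (fun t : ℝ => (t + δ)⁻¹) (spectrum ℝ P) :=
    (continuousOn_id.add continuousOn_const).inv₀ add_ne_zero
  have continuousOn_sq : ContinuousOn (fun t : ℝ => t * t) (spectrum ℝ P) := by fun_prop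
  have continuousOn_inv_mul_sq :
      ContinuousOn (fun t : ℝ => (t + δ)⁻¹ * (t * t)) (spectrum ℝ P) :=
    continuousOn_inv.mul continuousOn_sq
  have cfc_inv_mul_sq : cfc (fun t : ℝ => (t + δ)⁻¹) P * (P * P) =
      cfc (fun t : ℝ => (t + δ)⁻¹ * (t * t)) P := by
    rw [cfc_mul _ _ P continuousOn_inv continuousOn_sq, cfc_mul (fun t : ℝ => t) _ P, cfc_id' ℝ P]
  refine ⟨cfc (fun t : ℝ => (t + δ)⁻¹) P, cfc_predicate _ _, ?_, ?_⟩
  · rw [cfc_inv_mul_sq, ← cfc_mul _ _ P continuousOn_inv_mul_sq continuousOn_inv]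
    refine norm_cfc_le zero_le_one fun t ht => ?_
    have ht0 := spectrum_nonneg t ht
    rw [Real.norm_of_nonneg (by positivity), ← div_eq_mul_inv, inv_mul_eq_div, div_div,
      div_le_one (by positivity)]
    gcongr <;> linarith
  · nth_rewrite 1 [cfc_inv_mul_sq, ← cfc_id' ℝ P]
    rw [← cfc_sub (fun t : ℝ => t) _ P continuousOn_id continuousOn_inv_mul_sq]
    refine norm_cfc_le hδ.le fun t ht => ?_
    have ht0 := spectrum_nonneg t ht
    have sub_eq : t - (t + δ)⁻¹ * (t * t) = t / (t + δ) * δ := by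
      field_simp [add_ne_zero t ht]
      ring
    rw [sub_eq, Real.norm_of_nonneg (by positivity)]
    exact mul_le_of_le_one_left hδ.le (by rw [div_le_one (by positivity)]; linarith)

theorem countable_hilbertBasis_index {𝕜 : Type*} [RCLike 𝕜] {H : Type*} [NormedAddCommGroup H]
    [InnerProductSpace 𝕜 H] [TopologicalSpace.SeparableSpace H] {ι : Type*}
    (e : HilbertBasis ι 𝕜 H) : Countable ι := by
  have one_le_dist {i j : ι} (hij : i ≠ j) : 1 ≤ dist (e i) (e j) := by
    have norm_sub_sq : ‖e i - e j‖ * ‖e i - e j‖ = 2 := by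
      rw [norm_sub_mul_self (𝕜 := 𝕜), e.orthonormal.2 hij, e.orthonormal.1 i, e.orthonormal.1 j]
      norm_num
    rw [dist_eq_norm]
    nlinarith [norm_nonneg (e i - e j)]
  refine Pairwise.countable_of_isOpen_disjoint (s := fun i => Metric.ball (e i) (1 / 2)) ?_
    (fun i => Metric.isOpen_ball) (fun i => ⟨e i, Metric.mem_ball_self (by norm_num)⟩)
  intro i j hij
  exact Metric.ball_disjoint_ball (by linarith [one_le_dist hij])

theorem sum_norm_inner_mul_inner_le {H : Type*} [NormedAddCommGroup H] [InnerProductSpace ℂ H]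
    [CompleteSpace H] {ι : Type*} {e : ι → H} (he : Orthonormal ℂ e) {V : H →L[ℂ] H}
    (hV : ‖V‖ ≤ 1) (s : Finset ι) (a b : H) :
    ∑ i ∈ s, ‖inner ℂ (V (e i)) a * inner ℂ b (e i)‖ ≤ ‖a‖ * ‖b‖ := by
  have bessel_a : ∑ i ∈ s, ‖inner ℂ (V (e i)) a‖ ^ 2 ≤ ‖a‖ ^ 2 := by
    have bessel : ∑ i ∈ s, ‖inner ℂ (e i) (ContinuousLinearMap.adjoint V a)‖ ^ 2 ≤ _ :=
      he.sum_inner_products_le _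
    simp only [ContinuousLinearMap.adjoint_inner_right] at bessel
    refine bessel.trans ?_
    gcongr
    refine ((ContinuousLinearMap.adjoint V).le_opNorm a).trans ?_
    rw [LinearIsometryEquiv.norm_map]
    exact mul_le_of_le_one_left (norm_nonneg _) hV
  have bessel_b : ∑ i ∈ s, ‖inner ℂ b (e i)‖ ^ 2 ≤ ‖b‖ ^ 2 := by
    simp only [norm_inner_symm b]
    exact he.sum_inner_products_le _
  simp only [norm_mul]
  calc _ ≤ √(∑ i ∈ s, ‖inner ℂ (V (e i)) a‖ ^ 2) * √(∑ i ∈ s, ‖inner ℂ b (e i)‖ ^ 2) :=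
        Real.sum_mul_le_sqrt_mul_sqrt _ _ _
    _ ≤ √(‖a‖ ^ 2) * √(‖b‖ ^ 2) := by gcongr
    _ = _ := by rw [Real.sqrt_sq (norm_nonneg _), Real.sqrt_sq (norm_nonneg _)]

variable {H : Type u} [NormedAddCommGroup H] [InnerProductSpace ℂ H] [CompleteSpace H]

/- An approximate polar decomposition: `V = T (|T| + δ)⁻¹`. -/
theorem exists_contraction_re_inner_abs_le (T : H →L[ℂ] H) {δ : ℝ} (hδ : 0 < δ) :
    ∃ V : H →L[ℂ] H, ‖V‖ ≤ 1 ∧ ∀ x : H,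
      (inner ℂ x (CFC.abs T x)).re ≤ ‖inner ℂ (V x) (T x)‖ + δ * ‖x‖ ^ 2 := by
  obtain ⟨R, hR, norm_conj_le, norm_sub_le⟩ := exists_regularization (CFC.abs_nonneg T) hδ
  rw [CFC.abs_mul_abs] at norm_conj_le norm_sub_le
  have star_mul_eq (S : H →L[ℂ] H) : star (T * R) * S = R * (star T * S) := by
    rw [star_mul, hR.star_eq, mul_assoc]
  refine ⟨T * R, ?_, fun x => ?_⟩
  · have norm_sq_le : ‖T * R‖ * ‖T * R‖ ≤ 1 := by
      rwa [← CStarRing.norm_star_mul_self, star_mul_eq, ← mul_assoc (star T), ← mul_assoc R]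
    nlinarith [norm_nonneg (T * R)]
  · set P := CFC.abs T
    have inner_eq : inner ℂ ((T * R) x) (T x) = inner ℂ x ((R * (star T * T)) x) := by
      rw [← star_mul_eq, ← ContinuousLinearMap.adjoint_inner_right]
      rfl
    have decompose : inner ℂ x (P x) = inner ℂ x ((R * (star T * T)) x) +
        inner ℂ x ((P - R * (star T * T)) x) := by
      rw [← inner_add_right, sub_apply, add_sub_cancel]
    rw [decompose, Complex.add_re, inner_eq]
    refine add_le_add (Complex.re_le_norm _) ((Complex.re_le_norm _).trans ?_)
    calc _ ≤ ‖x‖ * ‖(P - R * (star T * T)) x‖ := norm_inner_le_norm _ _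
      _ ≤ ‖x‖ * (δ * ‖x‖) := by
          gcongr
          exact ContinuousLinearMap.le_of_opNorm_le _ norm_sub_le x
      _ = δ * ‖x‖ ^ 2 := by ring

theorem isTraceClass_of_sum_le (T : H →L[ℂ] H) (B : ℝ)
    (hB : ∀ (ι : Type u) (e : HilbertBasis ι ℂ H) (V : H →L[ℂ] H), ‖V‖ ≤ 1 → ∀ s : Finset ι,
      ∑ i ∈ s, ‖inner ℂ (V (e i)) (T (e i))‖ ≤ B) : IsTraceClass T := by
  intro ι e
  have isPositive_abs : (CFC.abs T).IsPositive :=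
    (ContinuousLinearMap.nonneg_iff_isPositive _).1 (CFC.abs_nonneg T)
  refine summable_of_sum_le (c := B) (fun i => isPositive_abs.re_inner_nonneg_right (e i))
    fun s => ?_
  have sum_le (δ : ℝ) (hδ : 0 < δ) :
      ∑ i ∈ s, (inner ℂ (e i) (CFC.abs T (e i))).re ≤ B + s.card * δ := by
    obtain ⟨V, hV, abs_le⟩ := exists_contraction_re_inner_abs_le T hδ
    calc _ ≤ ∑ i ∈ s, (‖inner ℂ (V (e i)) (T (e i))‖ + δ) :=
          Finset.sum_le_sum fun i _ => by simpa [e.orthonormal.1 i] using abs_le (e i)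
      _ = ∑ i ∈ s, ‖inner ℂ (V (e i)) (T (e i))‖ + s.card * δ := by
          rw [Finset.sum_add_distrib, Finset.sum_const, nsmul_eq_mul]
      _ ≤ _ := by gcongr; exact hB ι e V hV s
  have tendsto_bound : Tendsto (fun δ : ℝ => B + s.card * δ) (𝓝[>] 0) (𝓝 B) := by
    have : Continuous fun δ : ℝ => B + s.card * δ := by fun_prop
    simpa using (this.tendsto 0).mono_left nhdsWithin_le_nhds
  exact ge_of_tendsto tendsto_bound (eventually_nhdsWithin_of_forall sum_le)

variable {Ξ : Type*} [MeasurableSpace Ξ] {ρ : Measure Ξ} {a b : Ξ → H} {β : Ξ → ℝ}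

theorem integrable_inner_mul_inner {H : Type*} [NormedAddCommGroup H] [InnerProductSpace ℂ H]
    {a b : Ξ → H} (hβ : Integrable β ρ)
    (ha : ∀ g, AEStronglyMeasurable (fun ξ => inner ℂ g (a ξ)) ρ)
    (hb : ∀ g, AEStronglyMeasurable (fun ξ => inner ℂ (b ξ) g) ρ)
    (hab : ∀ ξ, ‖a ξ‖ * ‖b ξ‖ ≤ β ξ) (g f : H) :
    Integrable (fun ξ => inner ℂ g (a ξ) * inner ℂ (b ξ) f) ρ := by
  refine (hβ.const_mul (‖g‖ * ‖f‖)).mono' ((ha g).mul (hb f)) (Eventually.of_forall fun ξ => ?_)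
  rw [norm_mul]
  calc _ ≤ (‖g‖ * ‖a ξ‖) * (‖b ξ‖ * ‖f‖) := by gcongr <;> exact norm_inner_le_norm _ _
    _ = ‖g‖ * ‖f‖ * (‖a ξ‖ * ‖b ξ‖) := by ring
    _ ≤ _ := by gcongr; exact hab ξ

theorem isTraceClass_and_hasTrace_of_integral_rankOne [TopologicalSpace.SeparableSpace H]
    (T : H →L[ℂ] H) (hβ : Integrable β ρ)
    (ha : ∀ g, AEStronglyMeasurable (fun ξ => inner ℂ g (a ξ)) ρ)
    (hb : ∀ g, AEStronglyMeasurable (fun ξ => inner ℂ (b ξ) g) ρ)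
    (hab : ∀ ξ, ‖a ξ‖ * ‖b ξ‖ ≤ β ξ)
    (hT : ∀ g f, inner ℂ g (T f) = ∫ ξ, inner ℂ g (a ξ) * inner ℂ (b ξ) f ∂ρ) :
    IsTraceClass T ∧ HasTrace T (∫ ξ, inner ℂ (b ξ) (a ξ) ∂ρ) := by
  have integrable_rankOne := integrable_inner_mul_inner hβ ha hb hab
  have sum_le {ι : Type u} (e : HilbertBasis ι ℂ H) {V : H →L[ℂ] H} (hV : ‖V‖ ≤ 1)
      (s : Finset ι) :
      ∑ i ∈ s, ∫ ξ, ‖inner ℂ (V (e i)) (a ξ) * inner ℂ (b ξ) (e i)‖ ∂ρ ≤ ∫ ξ, β ξ ∂ρ := by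
    rw [← integral_finsetSum _ fun i _ => (integrable_rankOne _ _).norm]
    exact integral_mono (integrable_finsetSum _ fun i _ => (integrable_rankOne _ _).norm) hβ
      fun ξ => (sum_norm_inner_mul_inner_le e.orthonormal hV s _ _).trans (hab ξ)
  constructor
  · refine isTraceClass_of_sum_le T (∫ ξ, β ξ ∂ρ) fun ι e V hV s =>
      le_trans (Finset.sum_le_sum fun i _ => ?_) (sum_le e hV s)
    rw [hT]
    exact norm_integral_le_integral_norm _
  · intro ι e
    have : Countable ι := countable_hilbertBasis_index e
    have hasSum_integral := hasSum_integral_of_summable_integral_norm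
      (F := fun i ξ => inner ℂ (e i) (a ξ) * inner ℂ (b ξ) (e i))
      (fun i => integrable_rankOne _ _)
      (summable_of_sum_le (fun i => integral_nonneg fun ξ => norm_nonneg _) fun s =>
        sum_le e (V := .id ℂ H) ContinuousLinearMap.norm_id_le s)
    have parseval (ξ : Ξ) :
        ∑' i, inner ℂ (e i) (a ξ) * inner ℂ (b ξ) (e i) = inner ℂ (b ξ) (a ξ) := by
      rw [← e.tsum_inner_mul_inner]
      exact tsum_congr fun i => mul_comm _ _
    simpa only [parseval, hT] using hasSum_integral

end OperatorTheory

section L2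

theorem norm_sq_eq_integral_norm_sq {X : Type*} [MeasurableSpace X] {ν : Measure X}
    (f : Lp ℂ 2 ν) : ‖f‖ ^ 2 = ∫ x, ‖f x‖ ^ 2 ∂ν := by
  rw [← @inner_self_eq_norm_sq ℂ, L2.inner_def]
  simp only [inner_self_eq_norm_sq_to_K, RCLike.ofReal_eq_complex_ofReal]
  norm_cast

theorem hasSum_norm_inner_sq {𝕜 : Type*} [RCLike 𝕜] {H : Type*} [NormedAddCommGroup H]
    [InnerProductSpace 𝕜 H] {ι : Type*} (e : HilbertBasis ι 𝕜 H) (x : H) :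
    HasSum (fun i => ‖inner 𝕜 x (e i)‖ ^ 2) (‖x‖ ^ 2) := by
  rw [← @inner_self_eq_norm_sq 𝕜]
  convert RCLike.hasSum_re 𝕜 (e.hasSum_inner_mul_inner x x) using 2 with i
  rw [← inner_conj_symm (e i), RCLike.mul_conj]
  norm_cast

theorem integral_mul_integral_swap {X Ξ : Type*} [MeasurableSpace X] [MeasurableSpace Ξ]
    {ν : Measure X} [SFinite ν] {ρ : Measure Ξ} [SFinite ρ] {u : X → ℂ} (hu : Integrable u ν)
    {b : X → Ξ → ℂ} (hb : Measurable (Function.uncurry b)) {α : Ξ → ℝ} (hα : Integrable α ρ)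
    (hbα : ∀ p ξ, ‖b p ξ‖ ≤ α ξ) :
    ∫ p, u p * ∫ ξ, b p ξ ∂ρ ∂ν = ∫ ξ, ∫ p, u p * b p ξ ∂ν ∂ρ := by
  simp only [← integral_const_mul]
  refine integral_integral_swap ((hu.norm.mul_prod hα).mono'
    (hu.aestronglyMeasurable.comp_fst.mul hb.aestronglyMeasurable)
    (Eventually.of_forall fun x => ?_))
  rw [Function.uncurry, norm_mul]
  gcongr
  exact hbα x.1 x.2

variable {X : Type u} [MeasurableSpace X] (ν : Measure X) [IsFiniteMeasure ν]

/-- The class in `L²` of a bounded measurable function. -/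
def toL2 {f : X → ℂ} (hf : Measurable f) {C : ℝ} (hC : ∀ x, ‖f x‖ ≤ C) : Lp ℂ 2 ν :=
  (MemLp.of_bound hf.aestronglyMeasurable C (Eventually.of_forall hC)).toLp f

variable {f : X → ℂ} (hf : Measurable f) {C : ℝ} (hC : ∀ x, ‖f x‖ ≤ C)

theorem coeFn_toL2 : toL2 ν hf hC =ᵐ[ν] f :=
  MemLp.coeFn_toLp _

theorem norm_toL2_le : ‖toL2 ν hf hC‖ ≤ (measureUnivNNReal ν : ℝ) ^ (2 : ℝ)⁻¹ * C := by
  have norm_le : ∀ᵐ x ∂ν, ‖toL2 ν hf hC x‖ ≤ C := by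
    filter_upwards [coeFn_toL2 ν hf hC] with x hx
    rw [hx]
    exact hC x
  obtain hX | ⟨⟨x⟩⟩ := isEmpty_or_nonempty X
  · simp [Lp.norm_def, Measure.eq_zero_of_isEmpty ν, measureUnivNNReal]
  · exact (Lp.norm_le_of_ae_bound ((norm_nonneg _).trans (hC x)) norm_le).trans_eq (by simp)

theorem inner_toL2_left (g : Lp ℂ 2 ν) :
    inner ℂ (toL2 ν hf hC) g = ∫ x, starRingEnd ℂ (f x) * g x ∂ν := by
  rw [L2.inner_def]
  refine integral_congr_ae ?_
  filter_upwards [coeFn_toL2 ν hf hC] with x hx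
  rw [hx, RCLike.inner_apply, mul_comm]

theorem inner_toL2_right (g : Lp ℂ 2 ν) :
    inner ℂ g (toL2 ν hf hC) = ∫ x, starRingEnd ℂ (g x) * f x ∂ν := by
  rw [L2.inner_def]
  refine integral_congr_ae ?_
  filter_upwards [coeFn_toL2 ν hf hC] with x hx
  rw [hx, RCLike.inner_apply, mul_comm]

theorem integrable_L2 (g : Lp ℂ 2 ν) : Integrable g ν :=
  (Lp.memLp g).integrable (by norm_num)

end L2

section KernelRow

variable {X : Type u} [MeasurableSpace X] (ν : Measure X) {Y : Type*} [MeasurableSpace Y]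
  {K : Y → X → ℂ} (hK : Measurable (Function.uncurry K)) {C : ℝ} (hC : ∀ p q, ‖K p q‖ ≤ C)

include hK

theorem measurable_conj_kernel (p : Y) : Measurable fun q => starRingEnd ℂ (K p q) :=
  Complex.continuous_conj.measurable.comp (hK.comp measurable_prodMk_left)

theorem measurable_integral_kernel_mul [SFinite ν] {f : X → ℂ} (hf : StronglyMeasurable f) :
    Measurable fun p => ∫ q, K p q * f q ∂ν :=
  (StronglyMeasurable.integral_prod_right
    (hK.stronglyMeasurable.mul (hf.comp_measurable measurable_snd))).measurable

variable [IsFiniteMeasure ν]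

/-- The row `q ↦ conj (K p q)` of a kernel, conjugated so that the inner product with it is the
value at `p` of the integral operator. -/
def kernelRow (p : Y) : Lp ℂ 2 ν :=
  toL2 ν (measurable_conj_kernel hK p) fun q => (RCLike.norm_conj _).trans_le (hC p q)

theorem inner_kernelRow (p : Y) (f : Lp ℂ 2 ν) :
    inner ℂ (kernelRow ν hK hC p) f = ∫ q, K p q * f q ∂ν := by
  simp only [kernelRow, inner_toL2_left, Complex.conj_conj]

theorem norm_sq_kernelRow (p : Y) : ‖kernelRow ν hK hC p‖ ^ 2 = ∫ q, ‖K p q‖ ^ 2 ∂ν := by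
  rw [norm_sq_eq_integral_norm_sq]
  refine integral_congr_ae ?_
  filter_upwards [coeFn_toL2 ν (measurable_conj_kernel hK p) fun q =>
    (RCLike.norm_conj _).trans_le (hC p q)] with q hq
  rw [kernelRow, hq, RCLike.norm_conj]

include hC in
theorem norm_integral_kernel_mul_le (f : Lp ℂ 2 ν) (p : Y) :
    ‖∫ q, K p q * f q ∂ν‖ ≤ (measureUnivNNReal ν : ℝ) ^ (2 : ℝ)⁻¹ * C * ‖f‖ := by
  rw [← inner_kernelRow ν hK hC]
  refine (norm_inner_le_norm _ _).trans ?_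
  gcongr
  exact norm_toL2_le ν _ _

end KernelRow

section IntegralOperator

variable {X : Type u} [MeasurableSpace X] (ν : Measure X) [IsFiniteMeasure ν] {K : X → X → ℂ}
  (hK : Measurable (Function.uncurry K)) {C : ℝ} (hC : ∀ p q, ‖K p q‖ ≤ C)

/-- The integral operator on `L²` with a bounded measurable kernel. -/
def integralOperator : Lp ℂ 2 ν →L[ℂ] Lp ℂ 2 ν :=
  LinearMap.mkContinuous
    { toFun f := toL2 ν (measurable_integral_kernel_mul ν hK (Lp.stronglyMeasurable f))
        (norm_integral_kernel_mul_le ν hK hC f)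
      map_add' f g := by
        refine (MemLp.toLp_congr _ _ (Eventually.of_forall fun p => ?_)).trans (MemLp.toLp_add _ _)
        simp only [Pi.add_apply, ← inner_kernelRow ν hK hC, inner_add_right]
      map_smul' c f := by
        refine (MemLp.toLp_congr _ _ (Eventually.of_forall fun p => ?_)).trans
          (MemLp.toLp_const_smul c _)
        simp only [Pi.smul_apply, ← inner_kernelRow ν hK hC, inner_smul_right, smul_eq_mul] }
    ((measureUnivNNReal ν : ℝ) ^ (2 : ℝ)⁻¹ * ((measureUnivNNReal ν : ℝ) ^ (2 : ℝ)⁻¹ * C))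
    (fun f => (norm_toL2_le ν (measurable_integral_kernel_mul ν hK (Lp.stronglyMeasurable f))
      (norm_integral_kernel_mul_le ν hK hC f)).trans_eq (by ring))

theorem coeFn_integralOperator (f : Lp ℂ 2 ν) :
    integralOperator ν hK hC f =ᵐ[ν] fun p => ∫ q, K p q * f q ∂ν :=
  coeFn_toL2 ν (measurable_integral_kernel_mul ν hK (Lp.stronglyMeasurable f))
    (norm_integral_kernel_mul_le ν hK hC f)

theorem norm_sq_integralOperator (f : Lp ℂ 2 ν) :
    ‖integralOperator ν hK hC f‖ ^ 2 = ∫ p, ‖inner ℂ (kernelRow ν hK hC p) f‖ ^ 2 ∂ν := by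
  rw [norm_sq_eq_integral_norm_sq]
  refine integral_congr_ae ?_
  filter_upwards [coeFn_integralOperator ν hK hC f] with p hp
  rw [hp, inner_kernelRow]

include hK hC in
theorem integrable_integral_norm_sq_kernel : Integrable (fun p => ∫ q, ‖K p q‖ ^ 2 ∂ν) ν := by
  have integrable_prod : Integrable (fun x : X × X => ‖K x.1 x.2‖ ^ 2) (ν.prod ν) :=
    Integrable.of_bound (hK.norm.pow_const 2).aestronglyMeasurable (C ^ 2)
      (Eventually.of_forall fun x => by
        rw [Real.norm_of_nonneg (by positivity)]
        exact pow_le_pow_left₀ (norm_nonneg _) (hC x.1 x.2) 2)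
  exact integrable_prod.integral_prod_left

theorem hasHilbertSchmidtNorm_integralOperator [TopologicalSpace.SeparableSpace (Lp ℂ 2 ν)] :
    HasHilbertSchmidtNorm (integralOperator ν hK hC) (√(∫ p, ∫ q, ‖K p q‖ ^ 2 ∂ν ∂ν)) := by
  refine ⟨Real.sqrt_nonneg _, fun ι e => ?_⟩
  have : Countable ι := countable_hilbertBasis_index e
  have parseval (p : X) : HasSum (fun i => ‖inner ℂ (kernelRow ν hK hC p) (e i)‖ ^ 2)
      (∫ q, ‖K p q‖ ^ 2 ∂ν) := by
    rw [← norm_sq_kernelRow ν hK hC]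
    exact hasSum_norm_inner_sq e _
  rw [Real.sq_sqrt (by positivity)]
  simp only [norm_sq_integralOperator]
  refine hasSum_integral_of_dominated_convergence
    (fun i p => ‖inner ℂ (kernelRow ν hK hC p) (e i)‖ ^ 2) (fun i => ?_)
    (fun i => Eventually.of_forall fun p => ?_)
    (Eventually.of_forall fun p => (parseval p).summable) ?_ (Eventually.of_forall parseval)
  · simp only [inner_kernelRow]
    exact ((measurable_integral_kernel_mul ν hK (Lp.stronglyMeasurable (e i))).norm.pow_const
      2).aestronglyMeasurable
  · rw [Real.norm_of_nonneg (by positivity)]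
  · simp only [fun p => (parseval p).tsum_eq]
    exact integrable_integral_norm_sq_kernel ν hK hC

variable {Ξ : Type*} [MeasurableSpace Ξ] {ρ : Measure Ξ} [SFinite ρ] {a : X → Ξ → ℂ}
  {c : Ξ → X → ℂ} {α : Ξ → ℝ} (hα : Integrable α ρ) (ha : Measurable (Function.uncurry a))
  (hc : Measurable (Function.uncurry c)) (haα : ∀ p ξ, ‖a p ξ‖ ≤ α ξ) (hc1 : ∀ ξ q, ‖c ξ q‖ ≤ 1)
  (hKac : ∀ p q, K p q = ∫ ξ, a p ξ * c ξ q ∂ρ)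

include hα ha hc haα hc1 hKac

theorem integral_kernel_mul_eq_integral {f : X → ℂ} (hf : Integrable f ν) (p : X) :
    ∫ q, K p q * f q ∂ν = ∫ ξ, a p ξ * ∫ q, c ξ q * f q ∂ν ∂ρ := by
  have measurable_prod : Measurable (Function.uncurry fun q ξ => a p ξ * c ξ q) :=
    (ha.comp (measurable_const.prodMk measurable_snd)).mul (hc.comp measurable_swap)
  have norm_prod_le (q : X) (ξ : Ξ) : ‖a p ξ * c ξ q‖ ≤ α ξ := by
    rw [norm_mul]
    exact (mul_le_of_le_one_right (norm_nonneg _) (hc1 ξ q)).trans (haα p ξ)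
  simp only [hKac, mul_comm _ (f _)]
  rw [integral_mul_integral_swap hf measurable_prod hα norm_prod_le]
  simp only [mul_left_comm (f _), integral_const_mul]

theorem inner_integralOperator_eq_integral (g f : Lp ℂ 2 ν) :
    inner ℂ g (integralOperator ν hK hC f) =
      ∫ ξ, (∫ p, starRingEnd ℂ (g p) * a p ξ ∂ν) * ∫ q, c ξ q * f q ∂ν ∂ρ := by
  have integrable_f := integrable_L2 ν f
  have integrable_conj_g : Integrable (fun p => starRingEnd ℂ (g p)) ν :=
    Complex.conjCLE.toContinuousLinearMap.integrable_comp (integrable_L2 ν g)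
  have measurable_integral_c : Measurable fun ξ => ∫ q, c ξ q * f q ∂ν :=
    measurable_integral_kernel_mul ν hc (Lp.stronglyMeasurable f)
  have norm_integral_c_le (ξ : Ξ) : ‖∫ q, c ξ q * f q ∂ν‖ ≤ ∫ q, ‖f q‖ ∂ν :=
    norm_integral_le_of_norm_le integrable_f.norm (Eventually.of_forall fun q => by
      rw [norm_mul]
      exact mul_le_of_le_one_left (norm_nonneg _) (hc1 ξ q))
  calc inner ℂ g (integralOperator ν hK hC f)
      = ∫ p, starRingEnd ℂ (g p) * ∫ ξ, a p ξ * ∫ q, c ξ q * f q ∂ν ∂ρ ∂ν := by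
        rw [L2.inner_def]
        refine integral_congr_ae ?_
        filter_upwards [coeFn_integralOperator ν hK hC f] with p hp
        rw [hp, RCLike.inner_apply, mul_comm,
          integral_kernel_mul_eq_integral ν hα ha hc haα hc1 hKac integrable_f]
    _ = ∫ ξ, ∫ p, starRingEnd ℂ (g p) * (a p ξ * ∫ q, c ξ q * f q ∂ν) ∂ν ∂ρ := by
        refine integral_mul_integral_swap integrable_conj_g
          (ha.mul (measurable_integral_c.comp measurable_snd))
          (hα.mul_const (∫ q, ‖f q‖ ∂ν)) fun p ξ => ?_
        rw [norm_mul]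
        gcongr
        · exact (norm_nonneg _).trans (haα p ξ)
        · exact haα p ξ
        · exact norm_integral_c_le ξ
    _ = _ := by simp only [← mul_assoc, integral_mul_const]

theorem integral_kernel_diagonal : ∫ p, K p p ∂ν = ∫ ξ, ∫ p, a p ξ * c ξ p ∂ν ∂ρ := by
  simpa only [hKac, one_mul] using integral_mul_integral_swap (ν := ν) (integrable_const (1 : ℂ))
    (ha.mul (hc.comp measurable_swap)) hα fun p ξ => by
      rw [norm_mul]
      exact (mul_le_of_le_one_right (norm_nonneg _) (hc1 ξ p)).trans (haα p ξ)

/- The operator is the integral over `ξ` of the operators of rank one with kernels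
`a p ξ * c ξ q`. -/
theorem isTraceClass_and_hasTrace_integralOperator
    [TopologicalSpace.SeparableSpace (Lp ℂ 2 ν)] :
    IsTraceClass (integralOperator ν hK hC) ∧
      HasTrace (integralOperator ν hK hC) (∫ p, K p p ∂ν) := by
  set W := (measureUnivNNReal ν : ℝ) ^ (2 : ℝ)⁻¹
  have measurable_a (ξ : Ξ) : Measurable fun p => a p ξ := ha.comp measurable_prodMk_right
  let A (ξ : Ξ) : Lp ℂ 2 ν := toL2 ν (measurable_a ξ) fun p => haα p ξ
  let B (ξ : Ξ) : Lp ℂ 2 ν := kernelRow ν hc hc1 ξ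
  have inner_A (g : Lp ℂ 2 ν) (ξ : Ξ) :
      inner ℂ g (A ξ) = ∫ p, starRingEnd ℂ (g p) * a p ξ ∂ν := inner_toL2_right ν _ _ g
  have inner_B (f : Lp ℂ 2 ν) (ξ : Ξ) : inner ℂ (B ξ) f = ∫ q, c ξ q * f q ∂ν :=
    inner_kernelRow ν hc hc1 ξ f
  have inner_B_A (ξ : Ξ) : inner ℂ (B ξ) (A ξ) = ∫ p, a p ξ * c ξ p ∂ν := by
    rw [inner_B]
    refine integral_congr_ae ?_
    filter_upwards [coeFn_toL2 ν (measurable_a ξ) fun p => haα p ξ] with p hp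
    rw [hp, mul_comm]
  rw [integral_kernel_diagonal ν hα ha hc haα hc1 hKac, ← funext inner_B_A]
  have norm_A_le (ξ : Ξ) : ‖A ξ‖ ≤ W * α ξ := norm_toL2_le ν _ _
  refine isTraceClass_and_hasTrace_of_integral_rankOne (β := fun ξ => W * α ξ * (W * 1)) _
    ((hα.const_mul W).mul_const _) (fun g => ?_) (fun f => ?_) (fun ξ => ?_) (fun g f => ?_)
  · simp only [inner_A]
    exact (StronglyMeasurable.integral_prod_right (f := fun ξ p => starRingEnd ℂ (g p) * a p ξ)
      ((Complex.continuous_conj.comp_stronglyMeasurable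
        ((Lp.stronglyMeasurable g).comp_measurable measurable_snd)).mul
          (ha.comp measurable_swap).stronglyMeasurable)).aestronglyMeasurable
  · simp only [inner_B]
    exact (measurable_integral_kernel_mul ν hc (Lp.stronglyMeasurable f)).aestronglyMeasurable
  · exact mul_le_mul (norm_A_le ξ) (norm_toL2_le ν _ _) (norm_nonneg _)
      ((norm_nonneg _).trans (norm_A_le ξ))
  · simp only [inner_A, inner_B]
    exact inner_integralOperator_eq_integral ν hK hC hα ha hc haα hc1 hKac g f

end IntegralOperator

section LatticeKernel

variable {G : Type u} [Group G] {Γ : Subgroup G}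

/-- The sum `∑ γ, k_ẋ (y⁻¹ γ x)`. -/
def latticeKernel (k : NilManifold Γ → G → ℂ) (x y : G) : ℂ :=
  ∑' γ : Γ, k (NilManifold.mk Γ x) (y⁻¹ * (γ * x))

/-- The function induced by `latticeKernel` on `M × M`: the kernel of the operator `f ↦ f_G * k_ẋ`
on `M`. -/
def nilKernel (k : NilManifold Γ → G → ℂ) (p q : NilManifold Γ) : ℂ :=
  latticeKernel k (Quotient.out p) (Quotient.out q)

theorem latticeKernel_mul (k : NilManifold Γ → G → ℂ) (x y : G) (δ η : Γ) :
    latticeKernel k (δ * x) (η * y) = latticeKernel k x y := by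
  unfold latticeKernel
  rw [← ((Equiv.mulRight δ⁻¹).trans (Equiv.mulLeft η)).tsum_eq]
  simp [NilManifold.mk_mul, mul_assoc]

theorem nilKernel_mk_mk (k : NilManifold Γ → G → ℂ) (x y : G) :
    nilKernel k (NilManifold.mk Γ x) (NilManifold.mk Γ y) = latticeKernel k x y := by
  obtain ⟨δ, hδ⟩ := (NilManifold.mk_eq_mk_iff Γ).1 (NilManifold.mk_out Γ (NilManifold.mk Γ x))
  obtain ⟨η, hη⟩ := (NilManifold.mk_eq_mk_iff Γ).1 (NilManifold.mk_out Γ (NilManifold.mk Γ y))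
  conv_rhs => rw [hδ, hη]
  rw [latticeKernel_mul]
  rfl

variable [NormedAddCommGroup G]

/-- A continuous kernel whose lattice sums converge absolutely, uniformly on bounded sets. -/
structure IsSummableKernel (k : NilManifold Γ → G → ℂ) : Prop where
  continuous_uncurry : Continuous (Function.uncurry k)
  exists_summable : ∀ R : ℝ, ∃ u : Γ → ℝ, Summable u ∧ ∀ x y : G, ‖x‖ ≤ R → ‖y‖ ≤ R → ∀ γ : Γ,
    ‖k (NilManifold.mk Γ x) (y⁻¹ * (γ * x))‖ ≤ u γ

namespace IsSummableKernel

variable {k : NilManifold Γ → G → ℂ} (hk : IsSummableKernel k) [IsTopologicalGroup G]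
include hk

theorem continuous_latticeKernel : Continuous fun z : G × G => latticeKernel k z.1 z.2 := by
  refine continuous_iff_continuousAt.2 fun z => ?_
  obtain ⟨u, hu, norm_le⟩ := hk.exists_summable (‖z‖ + 1)
  have continuousOn_ball := continuousOn_tsum (s := Metric.ball z 1)
    (f := fun (γ : Γ) (w : G × G) => k (NilManifold.mk Γ w.1) (w.2⁻¹ * (γ * w.1)))
    (fun γ => (hk.continuous_uncurry.comp (((NilManifold.continuous_mk Γ).comp
      continuous_fst).prodMk (by fun_prop))).continuousOn) hu fun γ w hw => by
        have norm_w_le : ‖w‖ ≤ ‖z‖ + 1 :=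
          (norm_le_norm_add_norm_sub' w z).trans (by grw [mem_ball_iff_norm.1 hw])
        exact norm_le _ _ ((norm_fst_le w).trans norm_w_le) ((norm_snd_le w).trans norm_w_le) γ
  exact continuousOn_ball.continuousAt (Metric.ball_mem_nhds z one_pos)

theorem continuous_nilKernel : Continuous (Function.uncurry (nilKernel k)) := by
  have isOpenQuotientMap_prod :=
    (NilManifold.isOpenQuotientMap_mk Γ).prodMap (NilManifold.isOpenQuotientMap_mk Γ)
  rw [isOpenQuotientMap_prod.isQuotientMap.continuous_iff]
  convert hk.continuous_latticeKernel using 1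
  ext z
  exact nilKernel_mk_mk k z.1 z.2

theorem exists_norm_nilKernel_le [CompactSpace (NilManifold Γ)] :
    ∃ C : ℝ, ∀ p q, ‖nilKernel k p q‖ ≤ C := by
  obtain ⟨C, hC⟩ := isCompact_univ.exists_bound_of_continuousOn
    hk.continuous_nilKernel.continuousOn
  exact ⟨C, fun p q => hC (p, q) trivial⟩

variable [NormedSpace ℝ G] [FiniteDimensional ℝ G] [MeasurableSpace G] [BorelSpace G]
  [DiscreteTopology Γ]

theorem measurable_nilKernel : Measurable (Function.uncurry (nilKernel k)) := by
  have : ProperSpace G := FiniteDimensional.proper ℝ G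
  have : PolishSpace G := polishSpace_of_finiteDimensional G
  have := NilManifold.secondCountableTopology Γ
  have : BorelSpace (NilManifold Γ) := NilManifold.borelSpace Γ
  exact hk.continuous_nilKernel.measurable

variable [CompactSpace (NilManifold Γ)] {μ : Measure G} {ν : Measure (NilManifold Γ)}
  (hν : IsQuotientMeasure Γ μ ν) {f : NilManifold Γ → ℂ} (hfm : StronglyMeasurable f)
  (hf : Integrable f ν)

include hν hfm hf

theorem integrable_mul (x : G) :
    Integrable (fun y => f (NilManifold.mk Γ y) * k (NilManifold.mk Γ x) (y⁻¹ * x)) μ := by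
  have : ProperSpace G := FiniteDimensional.proper ℝ G
  have : SecondCountableTopology G := secondCountable_of_proper
  have : Countable Γ := countable_of_discreteTopology_subgroup Γ
  obtain ⟨s, hs, hsec, R, -, hR⟩ := NilManifold.exists_measurable_section Γ
  have stronglyMeasurable_integrand : StronglyMeasurable fun y =>
      f (NilManifold.mk Γ y) * k (NilManifold.mk Γ x) (y⁻¹ * x) :=
    (hfm.comp_measurable measurable_quotient_mk'').mul
      (hk.continuous_uncurry.comp (continuous_const.prodMk
        (continuous_inv.mul continuous_const))).stronglyMeasurable
  obtain ⟨u, hu, norm_le⟩ := hk.exists_summable (max ‖x‖ R)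
  have norm_term_le (γ : Γ) (q : NilManifold Γ) :
      ‖f (NilManifold.mk Γ (γ * s q)) * k (NilManifold.mk Γ x) ((γ * s q)⁻¹ * x)‖ ≤
        u γ⁻¹ * ‖f q‖ := by
    rw [NilManifold.mk_mul, hsec, norm_mul, mul_comm]
    gcongr
    simpa [mul_assoc] using norm_le x (s q) (le_max_left _ _) ((hR q).trans (le_max_right _ _)) γ⁻¹
  have integrable_term (γ : Γ) : Integrable (fun q =>
      f (NilManifold.mk Γ (γ * s q)) * k (NilManifold.mk Γ x) ((γ * s q)⁻¹ * x)) ν :=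
    (hf.norm.const_mul (u γ⁻¹)).mono'
      (stronglyMeasurable_integrand.comp_measurable (hs.const_mul _)).aestronglyMeasurable
      (Eventually.of_forall (norm_term_le γ))
  refine (hν.integrable_iff hs hsec fun γ =>
    stronglyMeasurable_integrand.aestronglyMeasurable).2 ⟨integrable_term, ?_⟩
  refine Summable.of_nonneg_of_le (fun γ => integral_nonneg fun q => norm_nonneg _) (fun γ => ?_)
    (((Equiv.inv Γ).summable_iff.2 hu).mul_right (∫ q, ‖f q‖ ∂ν))
  simp only [Function.comp_apply, Equiv.inv_apply]
  rw [← integral_const_mul]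
  exact integral_mono (integrable_term γ).norm (hf.norm.const_mul _) (norm_term_le γ)

theorem integral_mul_eq (x : G) :
    ∫ y, f (NilManifold.mk Γ y) * k (NilManifold.mk Γ x) (y⁻¹ * x) ∂μ =
      ∫ q, nilKernel k (NilManifold.mk Γ x) q * f q ∂ν := by
  have : ProperSpace G := FiniteDimensional.proper ℝ G
  have : SecondCountableTopology G := secondCountable_of_proper
  have : Countable Γ := countable_of_discreteTopology_subgroup Γ
  obtain ⟨s, hs, hsec, -⟩ := NilManifold.exists_measurable_section Γ
  rw [hν.integral_eq hs hsec (hk.integrable_mul hν hfm hf x)]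
  refine integral_congr_ae (Eventually.of_forall fun q => ?_)
  simp only [NilManifold.mk_mul, hsec, tsum_mul_left]
  rw [mul_comm]
  congr 1
  conv_rhs => rw [← hsec q]
  rw [nilKernel_mk_mk, latticeKernel, ← (Equiv.inv Γ).tsum_eq]
  simp [mul_assoc]

end IsSummableKernel

variable [NormedSpace ℝ G] [FiniteDimensional ℝ G] [MeasurableSpace G] [BorelSpace G]
  [DiscreteTopology Γ] {μ : Measure G} {ν : Measure (NilManifold Γ)} [IsFiniteMeasure ν]

theorem separableSpace_L2 [IsTopologicalGroup G] :
    TopologicalSpace.SeparableSpace (Lp ℂ 2 ν) := by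
  have : ProperSpace G := FiniteDimensional.proper ℝ G
  have : PolishSpace G := polishSpace_of_finiteDimensional G
  have := NilManifold.secondCountableTopology Γ
  have : BorelSpace (NilManifold Γ) := NilManifold.borelSpace Γ
  have : Fact ((2 : ℝ≥0∞) ≠ ⊤) := ⟨by simp⟩
  have : SecondCountableTopology (Lp ℂ 2 ν) := inferInstance
  infer_instance

theorem IsSummableKernel.isOp_integralOperator [LieGroup 𝓘(ℝ, G) ∞ G]
    [CompactSpace (NilManifold Γ)] [μ.IsMulLeftInvariant] {k : NilManifold Γ → G → ℂ}
    (hk : IsSummableKernel k) (hν : IsQuotientMeasure Γ μ ν)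
    (hm : Measurable (Function.uncurry (nilKernel k))) {C : ℝ}
    (hC : ∀ p q, ‖nilKernel k p q‖ ≤ C) :
    IsOp μ Γ ν k (integralOperator ν hm hC) := by
  have : IsTopologicalGroup G := topologicalGroup_of_lieGroup 𝓘(ℝ, G) ∞
  refine fun f =>
    ⟨fun x => hk.integrable_mul hν (Lp.stronglyMeasurable f) (integrable_L2 ν f) x, ?_⟩
  filter_upwards [coeFn_integralOperator ν hm hC f] with p hp
  rw [hp]
  obtain ⟨x, rfl⟩ : ∃ x, NilManifold.mk Γ x = p := ⟨_, NilManifold.mk_out Γ p⟩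
  exact (hk.integral_mul_eq hν (Lp.stronglyMeasurable f) (integrable_L2 ν f) x).symm

end LatticeKernel

section SchwartzKernel

section Schwartz

variable {E F X : Type*} [NormedAddCommGroup E] [NormedSpace ℝ E] [NormedAddCommGroup F]
  [NormedSpace ℝ F] [TopologicalSpace X] {κ : X → 𝓢(E, F)} (hκ : Continuous κ)

include hκ

theorem exists_schwartz_decay_bound [CompactSpace X] (q n : ℕ) : ∃ A : ℝ, ∀ p, ∀ i ≤ n, ∀ z,
    (1 + ‖z‖) ^ q * ‖iteratedFDeriv ℝ i (κ p) z‖ ≤ A := by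
  set S := (Finset.Iic (q, n)).sup (schwartzSeminormFamily ℝ E F)
  have continuous_seminorm : Continuous fun p => S (κ p) :=
    ((schwartz_withSeminorms ℝ E F).finset_sups.continuous_seminorm _).comp hκ
  obtain ⟨A, hA⟩ := isCompact_univ.exists_bound_of_continuousOn continuous_seminorm.continuousOn
  refine ⟨2 ^ q * A, fun p i hi z => ?_⟩
  refine (SchwartzMap.one_add_le_sup_seminorm_apply (𝕜 := ℝ) (m := (q, n)) le_rfl hi
    (κ p) z).trans ?_
  gcongr
  exact (le_abs_self _).trans (hA p trivial)

theorem continuous_uncurry_schwartz : Continuous (Function.uncurry fun p => ⇑(κ p)) :=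
  (((SchwartzMap.toBoundedContinuousFunctionCLM ℝ E F).continuous.comp hκ).comp
    continuous_fst).eval continuous_snd

end Schwartz

theorem le_mul_inv_pow_of_le_mul_pow {a b t A C : ℝ} {k m : ℕ} (ha : 0 < a) (ht : 0 ≤ t)
    (hC : 0 ≤ C) (hab : a ≤ C * b ^ k) (hbt : b ^ (k * m) * t ≤ A) :
    t ≤ C ^ m * A * (a ^ m)⁻¹ := by
  rw [← div_eq_mul_inv, le_div_iff₀' (by positivity)]
  calc a ^ m * t ≤ (C * b ^ k) ^ m * t := by gcongr
    _ = C ^ m * (b ^ (k * m) * t) := by rw [mul_pow, pow_mul]; ring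
    _ ≤ C ^ m * A := by gcongr

variable {G : Type u} [NormedAddCommGroup G] [NormedSpace ℝ G] [FiniteDimensional ℝ G]
  (𝒱 : ℕ → Submodule ℝ G) [DirectSum.Decomposition 𝒱] [Group G] [LieGroup 𝓘(ℝ, G) ∞ G]
  {Γ : Subgroup G} [DiscreteTopology Γ] (hG : IsExponentialCoordinates G)
  (h𝒱 : IsLieGradation 𝒱)

include 𝒱 hG h𝒱

theorem exists_summable_iteratedFDeriv_le {X : Type*} [TopologicalSpace X] [CompactSpace X]
    {κ : X → 𝓢(G, ℂ)} (hκ : Continuous κ) (N : ℕ) {R₁ R₂ : ℝ} (hR₁ : 0 ≤ R₁) (hR₂ : 0 ≤ R₂) :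
    ∃ u : Γ → ℝ, Summable u ∧ ∀ x y : G, ‖x‖ ≤ R₁ → ‖y‖ ≤ R₂ → ∀ p, ∀ γ : Γ, ∀ i ≤ N,
      ‖iteratedFDeriv ℝ i (fun y => κ p (y⁻¹ * (γ * x))) y‖ ≤ u γ := by
  obtain ⟨m, hm⟩ := exists_summable_lattice 𝒱 Γ hG h𝒱
  obtain ⟨C, hC1, k, hC⟩ := exists_one_add_norm_le_inv_mul_mul 𝒱 hG h𝒱 hR₁
  obtain ⟨q, D, -, hD⟩ := exists_norm_iteratedFDeriv_comp_inv_mul_le 𝒱 hG h𝒱 N (k * m) hR₂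
  obtain ⟨A, hA⟩ := exists_schwartz_decay_bound hκ q N
  refine ⟨fun γ => C ^ m * (D * A) * ((1 + ‖(γ : G)‖) ^ m)⁻¹, hm.mul_left _,
    fun x y hx hy p γ i hi => le_mul_inv_pow_of_le_mul_pow (b := 1 + ‖(γ : G) * x‖) (by positivity)
      (norm_nonneg _) (by positivity) ?_ (hD (κ p) A (κ p).smooth' (hA p) (γ * x) y hy i hi)⟩
  simpa only [inv_one, one_mul] using hC x 1 γ hx (by rwa [hG.one_eq_zero, norm_zero])

theorem isSummableKernel_schwartz [CompactSpace (NilManifold Γ)] {κ : NilManifold Γ → 𝓢(G, ℂ)}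
    (hκ : Continuous κ) : IsSummableKernel fun p => ⇑(κ p) := by
  refine ⟨continuous_uncurry_schwartz hκ, fun R => ?_⟩
  obtain ⟨u, hu, hbound⟩ := exists_summable_iteratedFDeriv_le (Γ := Γ) 𝒱 hG h𝒱 hκ 0
    (le_max_right R 0) (le_max_right R 0)
  refine ⟨u, hu, fun x y hx hy γ => ?_⟩
  simpa only [norm_iteratedFDeriv_zero] using hbound x y (hx.trans (le_max_left _ _))
    (hy.trans (le_max_left _ _)) (NilManifold.mk Γ x) γ 0 le_rfl

end SchwartzKernel

section FourierDecay

open FourierTransform Module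

variable {V : Type*} [NormedAddCommGroup V] [InnerProductSpace ℝ V] [FiniteDimensional ℝ V]
  [MeasurableSpace V] [BorelSpace V] {E : Type*} [NormedAddCommGroup E] [NormedSpace ℂ E]

theorem integral_norm_iteratedFDeriv_le {f : V → E} {S : Set V} {n : ℕ} {A : ℝ}
    (hS : IsCompact S) (hfS : tsupport f ⊆ S) (hA : ∀ t, ‖iteratedFDeriv ℝ n f t‖ ≤ A) :
    ∫ t, ‖iteratedFDeriv ℝ n f t‖ ≤ A * volume.real S := by
  rw [← setIntegral_eq_integral_of_forall_compl_eq_zero (s := S) fun t ht => by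
    rw [image_eq_zero_of_notMem_tsupport fun h => ht (hfS (tsupport_iteratedFDeriv_subset n h)),
      norm_zero]]
  refine (le_abs_self _).trans ?_
  simpa using norm_setIntegral_le_of_norm_le_const (μ := volume) (s := S)
    (f := fun t => ‖iteratedFDeriv ℝ n f t‖) (C := A) hS.measure_lt_top
    fun t _ => by simpa using hA t

theorem norm_pow_mul_norm_fourier_le {f : V → E} {S : Set V} {n : ℕ} {A : ℝ} (hS : IsCompact S)
    (hf : ContDiff ℝ n f) (hfS : tsupport f ⊆ S)
    (hA : ∀ i ≤ n, ∀ t, ‖iteratedFDeriv ℝ i f t‖ ≤ A) (ξ : V) :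
    ‖ξ‖ ^ n * ‖𝓕 f ξ‖ ≤ 2 ^ n * ((n + 1) * (A * volume.real S)) := by
  have hasCompactSupport_f : HasCompactSupport f :=
    hS.of_isClosed_subset (isClosed_tsupport f) hfS
  have integrable_iteratedFDeriv (k i : ℕ) (hi : (i : ℕ∞) ≤ n) :
      Integrable fun t => ‖t‖ ^ k * ‖iteratedFDeriv ℝ i f t‖ :=
    ((continuous_norm.pow k).mul (hf.continuous_iteratedFDeriv (mod_cast hi)).norm
      ).integrable_of_hasCompactSupport (hasCompactSupport_f.iteratedFDeriv i).norm.mul_left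
  have sum_le : ∑ i ∈ Finset.range (0 + 1) ×ˢ Finset.range (n + 1),
      ∫ t, ‖t‖ ^ i.1 * ‖iteratedFDeriv ℝ i.2 f t‖ ≤ (n + 1) * (A * volume.real S) := by
    refine (Finset.sum_le_card_nsmul _ _ (A * volume.real S) fun i hi => ?_).trans (by simp)
    simp only [Finset.mem_product, Finset.mem_range, zero_add, Nat.lt_one_iff,
      Order.lt_add_one_iff] at hi
    simpa [hi.1] using integral_norm_iteratedFDeriv_le hS hfS (hA i.2 hi.2)
  have fourier_le := Real.pow_mul_norm_iteratedFDeriv_fourier_le (K := (0 : ℕ)) (N := (n : ℕ))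
    (mod_cast hf) (fun k i _ hi => integrable_iteratedFDeriv k i hi) (k := 0) (n := n) le_rfl
    le_rfl ξ
  simp only [norm_iteratedFDeriv_zero, pow_zero, one_mul, CharP.cast_eq_zero, mul_zero,
    zero_add] at fourier_le
  exact fourier_le.trans (by gcongr)

theorem exists_norm_fourier_le {S : Set V} (hS : IsCompact S) (N : ℕ) (A : ℝ) : ∃ C : ℝ,
    ∀ f : V → E, ContDiff ℝ N f → tsupport f ⊆ S →
      (∀ i ≤ N, ∀ t, ‖iteratedFDeriv ℝ i f t‖ ≤ A) → ∀ ξ, (1 + ‖ξ‖) ^ N * ‖𝓕 f ξ‖ ≤ C := by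
  refine ⟨2 ^ (N - 1) * (A * volume.real S + 2 ^ N * ((N + 1) * (A * volume.real S))),
    fun f hf hfS hA ξ => ?_⟩
  have norm_fourier_le : ‖𝓕 f ξ‖ ≤ A * volume.real S := by
    simpa using norm_pow_mul_norm_fourier_le (n := 0) hS (hf.of_le (mod_cast N.zero_le)) hfS
      (fun i hi => hA i (hi.trans N.zero_le)) ξ
  calc (1 + ‖ξ‖) ^ N * ‖𝓕 f ξ‖ ≤ 2 ^ (N - 1) * (1 ^ N + ‖ξ‖ ^ N) * ‖𝓕 f ξ‖ := by
        gcongr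
        exact add_pow_le zero_le_one (norm_nonneg ξ) N
    _ = 2 ^ (N - 1) * (‖𝓕 f ξ‖ + ‖ξ‖ ^ N * ‖𝓕 f ξ‖) := by ring
    _ ≤ _ := mul_le_mul_of_nonneg_left
        (add_le_add norm_fourier_le (norm_pow_mul_norm_fourier_le hS hf hfS hA ξ)) (by positivity)

theorem exists_integrable_norm_fourier_le {S : Set V} (hS : IsCompact S) (A : ℝ) :
    ∃ α : V → ℝ, Integrable α ∧ ∀ f : V → E, ContDiff ℝ (finrank ℝ V + 1 : ℕ) f →
      tsupport f ⊆ S → (∀ i ≤ finrank ℝ V + 1, ∀ t, ‖iteratedFDeriv ℝ i f t‖ ≤ A) →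
      ∀ ξ, ‖𝓕 f ξ‖ ≤ α ξ := by
  obtain ⟨C, hC⟩ := exists_norm_fourier_le (E := E) hS (finrank ℝ V + 1) A
  refine ⟨fun ξ => C * ((1 + ‖ξ‖) ^ (finrank ℝ V + 1))⁻¹,
    (integrable_inv_one_add_norm_pow volume (Nat.lt_succ_self _)).const_mul C,
    fun f hf hfS hA ξ => ?_⟩
  beta_reduce
  rw [← div_eq_mul_inv, le_div_iff₀' (by positivity)]
  exact hC f hf hfS hA ξ

theorem measurable_fourierChar : Measurable fun r : ℝ => ((Real.fourierChar r : Circle) : ℂ) :=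
  (continuous_subtype_val.comp Real.continuous_fourierChar).measurable

theorem measurable_uncurry_fourier {X : Type*} [MeasurableSpace X] {f : X → V → ℂ}
    (hf : Measurable (Function.uncurry f)) :
    Measurable (Function.uncurry fun p ξ => 𝓕 (f p) ξ) := by
  have measurable_integrand : Measurable fun w : (X × V) × V =>
      ((Real.fourierChar (-inner ℝ w.2 w.1.2) : Circle) : ℂ) * f w.1.1 w.2 :=
    (measurable_fourierChar.comp
      (measurable_snd.inner (measurable_snd.comp measurable_fst)).neg).mul
      (hf.comp ((measurable_fst.comp measurable_fst).prodMk measurable_snd))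
  exact measurable_integrand.stronglyMeasurable.integral_prod_right.measurable

end FourierDecay

section Derivatives

variable {V G F : Type*} [NormedAddCommGroup V] [NormedSpace ℝ V] [NormedAddCommGroup G]
  [NormedSpace ℝ G] [NormedAddCommGroup F] [NormedSpace ℝ F] {N : ℕ}

theorem norm_iteratedFDeriv_comp_continuousLinearMap_le (e : V →L[ℝ] G) {g : G → F}
    (hg : ContDiff ℝ N g) {i : ℕ} (hi : i ≤ N) (t : V) :
    ‖iteratedFDeriv ℝ i (fun t => g (e t)) t‖ ≤ ‖iteratedFDeriv ℝ i g (e t)‖ * ‖e‖ ^ i := by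
  rw [show (fun t => g (e t)) = g ∘ e from rfl, e.iteratedFDeriv_comp_right hg t (mod_cast hi)]
  refine (ContinuousMultilinearMap.norm_compContinuousLinearMap_le _ _).trans_eq ?_
  rw [Finset.prod_const, Finset.card_univ, Fintype.card_fin]

theorem exists_norm_iteratedFDeriv_smul_le {χ : V → ℝ} (hχ : ContDiff ℝ N χ)
    (hχc : HasCompactSupport χ) :
    ∃ C : ℝ, ∀ h : V → F, ContDiff ℝ N h → ∀ B : ℝ, 0 ≤ B →
      (∀ i ≤ N, ∀ t ∈ tsupport χ, ‖iteratedFDeriv ℝ i h t‖ ≤ B) →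
      ∀ i ≤ N, ∀ t, ‖iteratedFDeriv ℝ i (fun t => χ t • h t) t‖ ≤ C * B := by
  have exists_bound (j : Fin (N + 1)) : ∃ X : ℝ, ∀ t, ‖iteratedFDeriv ℝ j χ t‖ ≤ X :=
    (hχc.iteratedFDeriv j).exists_bound_of_continuous
      (hχ.continuous_iteratedFDeriv (mod_cast Nat.lt_succ_iff.1 j.2))
  choose X hX using exists_bound
  have X_nonneg (j : Fin (N + 1)) : 0 ≤ X j := (norm_nonneg _).trans (hX j 0)
  have norm_χ_le (j : ℕ) (hj : j ≤ N) (t : V) : ‖iteratedFDeriv ℝ j χ t‖ ≤ ∑ j, X j :=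
    (hX ⟨j, Nat.lt_succ_iff.2 hj⟩ t).trans
      (Finset.single_le_sum (fun j _ => X_nonneg j) (Finset.mem_univ _))
  have sum_nonneg : 0 ≤ ∑ j, X j := Finset.sum_nonneg fun j _ => X_nonneg j
  refine ⟨2 ^ N * ∑ j, X j, fun h hh B hB hhB i hi t => ?_⟩
  refine (norm_iteratedFDeriv_smul_le hχ hh t (n := i) (mod_cast hi)).trans ?_
  have term_le (j : ℕ) (hj : j ∈ Finset.range (i + 1)) :
      (i.choose j : ℝ) * ‖iteratedFDeriv ℝ j χ t‖ * ‖iteratedFDeriv ℝ (i - j) h t‖ ≤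
        i.choose j * ((∑ j, X j) * B) := by
    rw [Finset.mem_range] at hj
    rw [mul_assoc]
    by_cases ht : t ∈ tsupport χ
    · gcongr
      · exact norm_χ_le j (by omega) t
      · exact hhB _ (by omega) t ht
    · rw [image_eq_zero_of_notMem_tsupport fun h => ht (tsupport_iteratedFDeriv_subset j h)]
      simp only [norm_zero, zero_mul, mul_zero]
      positivity
  calc _ ≤ ∑ j ∈ Finset.range (i + 1), (i.choose j : ℝ) * ((∑ j, X j) * B) :=
        Finset.sum_le_sum term_le
    _ = 2 ^ i * ((∑ j, X j) * B) := by
        rw [← Finset.sum_mul]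
        exact_mod_cast congrArg (· * _) (congrArg Nat.cast (Nat.sum_range_choose i))
    _ ≤ 2 ^ N * ((∑ j, X j) * B) := by gcongr; exact one_le_two
    _ = _ := (mul_assoc _ _ _).symm

theorem contDiff_tsum_and_norm_iteratedFDeriv_le [CompleteSpace F] {ι : Type*} {f : ι → V → F}
    {u : ι → ℝ} (hu : Summable u) (hf : ∀ γ, ContDiff ℝ N (f γ))
    (hfu : ∀ γ, ∀ i ≤ N, ∀ t, ‖iteratedFDeriv ℝ i (f γ) t‖ ≤ u γ) :
    ContDiff ℝ N (fun t => ∑' γ, f γ t) ∧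
      ∀ i ≤ N, ∀ t, ‖iteratedFDeriv ℝ i (fun t => ∑' γ, f γ t) t‖ ≤ ∑' γ, u γ := by
  have norm_le (i : ℕ) (γ : ι) (t : V) (hi : (i : ℕ∞) ≤ N) :
      ‖iteratedFDeriv ℝ i (f γ) t‖ ≤ u γ := hfu γ i (mod_cast hi) t
  refine ⟨contDiff_tsum (N := (N : ℕ∞)) hf (fun _ _ => hu) norm_le, fun i hi t => ?_⟩
  rw [iteratedFDeriv_tsum_apply (N := (N : ℕ∞)) hf (fun _ _ => hu) norm_le (mod_cast hi)]
  exact tsum_of_norm_bounded hu.hasSum fun γ => hfu γ i hi t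

end Derivatives

section FourierDecomposition

open FourierTransform Module

variable {G : Type u} [NormedAddCommGroup G] [NormedSpace ℝ G] [FiniteDimensional ℝ G]
  (𝒱 : ℕ → Submodule ℝ G) [DirectSum.Decomposition 𝒱] [Group G]
  [LieGroup 𝓘(ℝ, G) ∞ G] [MeasurableSpace G] [BorelSpace G] {Γ : Subgroup G} [DiscreteTopology Γ]
  [CompactSpace (NilManifold Γ)] (hG : IsExponentialCoordinates G) (h𝒱 : IsLieGradation 𝒱)
  {κ : NilManifold Γ → 𝓢(G, ℂ)} (hκ : Continuous κ)

include 𝒱 hG h𝒱 hκ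

theorem exists_norm_iteratedFDeriv_smul_nilKernel_le {V : Type*} [NormedAddCommGroup V]
    [NormedSpace ℝ V] {χ : V → ℝ} {N : ℕ} (hχ : ContDiff ℝ N χ) (hχc : HasCompactSupport χ)
    (e : V →L[ℝ] G) : ∃ A : ℝ, ∀ p,
      let f := fun t => χ t • nilKernel (fun p => ⇑(κ p)) p (NilManifold.mk Γ (e t))
      ContDiff ℝ N f ∧ ∀ i ≤ N, ∀ t, ‖iteratedFDeriv ℝ i f t‖ ≤ A := by
  have : IsTopologicalGroup G := topologicalGroup_of_lieGroup 𝓘(ℝ, G) ∞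
  obtain ⟨s, -, hsec, R, hR0, hR⟩ := NilManifold.exists_measurable_section Γ
  obtain ⟨R', hR'⟩ := (hχc.image e.continuous).isBounded.exists_norm_le
  obtain ⟨D, hD⟩ := exists_norm_iteratedFDeriv_smul_le (F := ℂ) hχ hχc
  obtain ⟨u, hu, norm_le⟩ := exists_summable_iteratedFDeriv_le (Γ := Γ) 𝒱 hG h𝒱 hκ N hR0
    (le_max_right R' 0)
  have contDiff_translate (p : NilManifold Γ) (γ : Γ) :
      ContDiff ℝ N fun y : G => κ p (y⁻¹ * (γ * s p)) :=
    ((κ p).smooth'.comp (contDiff_groupMul.comp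
      (contDiff_groupInv.prodMk contDiff_const))).of_le (mod_cast le_top)
  have norm_comp_le (p : NilManifold Γ) (γ : Γ) (i : ℕ) (hi : i ≤ N) (t : V)
      (ht : t ∈ tsupport χ) : ‖iteratedFDeriv ℝ i (fun t => κ p ((e t)⁻¹ * (γ * s p))) t‖ ≤
        u γ * (1 + ‖e‖) ^ N := by
    have norm_e_le : ‖e t‖ ≤ max R' 0 := (hR' _ (Set.mem_image_of_mem e ht)).trans (le_max_left _ _)
    have norm_translate_le := norm_le (s p) (e t) (hR p) norm_e_le p γ i hi
    calc _ ≤ ‖iteratedFDeriv ℝ i (fun y => κ p (y⁻¹ * (γ * s p))) (e t)‖ * ‖e‖ ^ i :=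
          norm_iteratedFDeriv_comp_continuousLinearMap_le e (contDiff_translate p γ) hi t
      _ ≤ u γ * (1 + ‖e‖) ^ i := by
          gcongr
          · exact (norm_nonneg _).trans norm_translate_le
          · linarith
      _ ≤ u γ * (1 + ‖e‖) ^ N := by
          gcongr
          · exact (norm_nonneg _).trans norm_translate_le
          · linarith [norm_nonneg e]
  have u_nonneg (p : NilManifold Γ) (γ : Γ) : 0 ≤ u γ :=
    (norm_nonneg _).trans (norm_le (s p) 0 (hR p) (by simp) p γ 0 N.zero_le)
  refine ⟨∑' γ, D * (u γ * (1 + ‖e‖) ^ N), fun p => ?_⟩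
  have eq_tsum : (fun t => χ t • nilKernel (fun p => ⇑(κ p)) p (NilManifold.mk Γ (e t))) =
      fun t => ∑' γ : Γ, χ t • κ p ((e t)⁻¹ * (γ * s p)) := by
    ext t
    conv_lhs => rw [← hsec p]
    rw [nilKernel_mk_mk, latticeKernel, hsec, tsum_const_smul'']
  simp only [eq_tsum]
  have contDiff_comp (γ : Γ) : ContDiff ℝ N fun t => κ p ((e t)⁻¹ * (γ * s p)) :=
    (contDiff_translate p γ).comp e.contDiff
  exact contDiff_tsum_and_norm_iteratedFDeriv_le ((hu.mul_right _).mul_left D)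
    (fun γ => hχ.smul (contDiff_comp γ)) fun γ => hD _ (contDiff_comp γ) _
      (mul_nonneg (u_nonneg p γ) (by positivity)) (norm_comp_le p γ)

/- The kernel is cut off to a compactly supported smooth function of the second variable, in
coordinates, and this function is expanded by Fourier inversion. -/
theorem exists_fourier_decomposition :
    ∃ (a : NilManifold Γ → EuclideanSpace ℝ (Fin (finrank ℝ G)) → ℂ)
      (c : EuclideanSpace ℝ (Fin (finrank ℝ G)) → NilManifold Γ → ℂ)
      (α : EuclideanSpace ℝ (Fin (finrank ℝ G)) → ℝ), Integrable α ∧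
      Measurable (Function.uncurry a) ∧ Measurable (Function.uncurry c) ∧
      (∀ p ξ, ‖a p ξ‖ ≤ α ξ) ∧ (∀ ξ q, ‖c ξ q‖ ≤ 1) ∧
      ∀ p q, nilKernel (fun p => ⇑(κ p)) p q = ∫ ξ, a p ξ * c ξ q := by
  have : IsTopologicalGroup G := topologicalGroup_of_lieGroup 𝓘(ℝ, G) ∞
  obtain ⟨s, hs, hsec, R, hR0, hR⟩ := NilManifold.exists_measurable_section Γ
  let V := EuclideanSpace ℝ (Fin (finrank ℝ G))
  let e : V ≃L[ℝ] G := (toEuclidean (E := G)).symm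
  obtain ⟨χ, hχ, hχc, hχ1⟩ : ∃ χ : V → ℝ, ContDiff ℝ (finrank ℝ V + 1 : ℕ) χ ∧
      HasCompactSupport χ ∧ ∀ q, χ (e.symm (s q)) = 1 := by
    set R' := ‖(e.symm : G →L[ℝ] V)‖ * R
    have hR' : 0 ≤ R' := by positivity
    let χ : ContDiffBump (0 : V) := ⟨R' + 1, R' + 2, by linarith, by linarith⟩
    refine ⟨χ, χ.contDiff, χ.hasCompactSupport, fun q => χ.one_of_mem_closedBall ?_⟩
    rw [mem_closedBall_zero_iff]
    calc ‖e.symm (s q)‖ ≤ R' := (e.symm : G →L[ℝ] V).le_opNorm_of_le (hR q)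
      _ ≤ R' + 1 := by linarith
  let f (p : NilManifold Γ) (t : V) : ℂ :=
    χ t • nilKernel (fun p => ⇑(κ p)) p (NilManifold.mk Γ (e t))
  obtain ⟨A, hA⟩ := exists_norm_iteratedFDeriv_smul_nilKernel_le 𝒱 hG h𝒱 hκ hχ hχc (e : V →L[ℝ] G)
  obtain ⟨α, hα, norm_fourier_le⟩ := exists_integrable_norm_fourier_le (E := ℂ) hχc.isCompact A
  have tsupport_f (p : NilManifold Γ) : tsupport (f p) ⊆ tsupport χ :=
    closure_mono (Function.support_smul_subset_left χ _)
  have measurable_f : Measurable (Function.uncurry f) :=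
    (hχ.continuous.measurable.comp measurable_snd).smul
      ((isSummableKernel_schwartz 𝒱 hG h𝒱 hκ).measurable_nilKernel.comp (measurable_fst.prodMk
        (measurable_quotient_mk''.comp (e.continuous.measurable.comp measurable_snd))))
  have measurable_fourier_f := measurable_uncurry_fourier measurable_f
  have norm_fourier_f_le (p : NilManifold Γ) : ∀ ξ, ‖𝓕 (f p) ξ‖ ≤ α ξ :=
    norm_fourier_le (f p) (hA p).1 (tsupport_f p) (hA p).2
  refine ⟨fun p ξ => 𝓕 (f p) ξ, fun ξ q => (Real.fourierChar (inner ℝ ξ (e.symm (s q))) : Circle),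
    α, hα, measurable_fourier_f, measurable_fourierChar.comp (measurable_fst.inner
      (e.symm.continuous.measurable.comp (hs.comp measurable_snd))), norm_fourier_f_le,
    fun ξ q => (Circle.norm_coe _).le, fun p q => ?_⟩
  have inversion : 𝓕⁻ (𝓕 (f p)) = f p :=
    (hA p).1.continuous.fourierInv_fourier_eq ((hA p).1.continuous.integrable_of_hasCompactSupport
      (hχc.isCompact.of_isClosed_subset (isClosed_tsupport _) (tsupport_f p)))
      (hα.mono' (measurable_fourier_f.comp measurable_prodMk_left).aestronglyMeasurable
        (Eventually.of_forall (norm_fourier_f_le p)))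
  calc nilKernel (fun p => ⇑(κ p)) p q = f p (e.symm (s q)) := by
        simp only [f, hχ1, one_smul, e.apply_symm_apply, hsec]
    _ = ∫ ξ, 𝓕 (f p) ξ * (Real.fourierChar (inner ℝ ξ (e.symm (s q))) : Circle) := by
        rw [← inversion, Real.fourierInv_eq, inversion]
        simp only [Circle.smul_def, smul_eq_mul, mul_comm]

end FourierDecomposition

section DilatedKernel

variable {G : Type u} [NormedAddCommGroup G] [NormedSpace ℝ G] [Group G] {Γ : Subgroup G}

theorem IsSmoothKernel.continuous [IsTopologicalGroup G] {κ : NilManifold Γ → 𝓢(G, ℂ)}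
    (hκ : IsSmoothKernel Γ κ) : Continuous κ :=
  (NilManifold.isOpenQuotientMap_mk Γ).isQuotientMap.continuous_iff.2 (hκ 0)

variable (𝒱 : ℕ → Submodule ℝ G) [DirectSum.Decomposition 𝒱]

theorem pow_mul_norm_dilatedKernel (κ : NilManifold Γ → 𝓢(G, ℂ)) {ε : ℝ} (hε : 0 < ε)
    (p : NilManifold Γ) (z : G) :
    ε ^ homogeneousDim 𝒱 * ‖dilatedKernel 𝒱 κ ε p z‖ = ‖κ p (dilation 𝒱 ε⁻¹ z)‖ := by
  rw [dilatedKernel, norm_mul, Complex.norm_real, Real.norm_of_nonneg (by positivity),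
    mul_inv_cancel_left₀ (by positivity)]

variable [FiniteDimensional ℝ G]

theorem exists_schwartz_eq_dilatedKernel {κ : NilManifold Γ → 𝓢(G, ℂ)} (hκ : Continuous κ)
    {ε : ℝ} (hε : 0 < ε) :
    ∃ κ' : NilManifold Γ → 𝓢(G, ℂ), Continuous κ' ∧
      dilatedKernel 𝒱 κ ε = fun p => ⇑(κ' p) := by
  let T : 𝓢(G, ℂ) →L[ℂ] 𝓢(G, ℂ) := (((ε ^ homogeneousDim 𝒱)⁻¹ : ℝ) : ℂ) •
    SchwartzMap.compCLMOfContinuousLinearEquiv ℂ (dilationEquiv 𝒱 (inv_ne_zero hε.ne'))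
  refine ⟨fun p => T (κ p), T.continuous.comp hκ, ?_⟩
  ext p z
  rfl

theorem integral_norm_sq_dilatedKernel [MeasurableSpace G] [BorelSpace G] (μ : Measure G)
    [μ.IsAddHaarMeasure] (κ : NilManifold Γ → 𝓢(G, ℂ)) {ε : ℝ} (hε : 0 < ε)
    (p : NilManifold Γ) :
    ∫ z, ‖dilatedKernel 𝒱 κ ε p z‖ ^ 2 ∂μ =
      (ε ^ homogeneousDim 𝒱)⁻¹ * ∫ z, ‖κ p z‖ ^ 2 ∂μ := by
  have change_of_variables := integral_comp_dilation 𝒱 μ (inv_pos.2 hε) fun z => ‖κ p z‖ ^ 2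
  simp only [dilatedKernel, norm_mul, Complex.norm_real, mul_pow, integral_const_mul,
    change_of_variables]
  rw [Real.norm_of_nonneg (by positivity), smul_eq_mul]
  simp only [inv_pow, inv_inv]
  field_simp

variable [LieGroup 𝓘(ℝ, G) ∞ G] (hG : IsExponentialCoordinates G) (h𝒱 : IsLieGradation 𝒱)

include hG h𝒱 in
theorem isKernelOfDilatedSymbol_dilatedKernel [MeasurableSpace G] [BorelSpace G] (μ : Measure G)
    [μ.IsHaarMeasure] {σ : SymbolField Γ} {κ : NilManifold Γ → 𝓢(G, ℂ)}
    (hσ : ∀ (p : NilManifold Γ) (H : Type) [NormedAddCommGroup H] [InnerProductSpace ℂ H]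
      [CompleteSpace H] [TopologicalSpace.SeparableSpace H] (π : UnitaryIrrep G H),
      IsFourierTransformAt μ (κ p) π (σ p H π)) {ε : ℝ} (hε : 0 < ε) :
    IsKernelOfDilatedSymbol 𝒱 μ σ ε (dilatedKernel 𝒱 κ ε) := by
  intro p H _ _ _ _ π επ hπ v
  have := isAddHaarMeasure_of_isHaarMeasure 𝒱 hG h𝒱 μ
  have change_of_variables := integral_comp_dilation 𝒱 μ hε fun z =>
    dilatedKernel 𝒱 κ ε p z • (π.toHom z)⁻¹ v
  have pow_ne_zero : (ε ^ homogeneousDim 𝒱)⁻¹ ≠ 0 := by positivity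
  refine smul_right_injective H pow_ne_zero ?_
  change (ε ^ homogeneousDim 𝒱)⁻¹ • _ = (ε ^ homogeneousDim 𝒱)⁻¹ • _
  rw [hσ p H επ v, ← change_of_variables, ← integral_smul]
  refine integral_congr_ae (Eventually.of_forall fun z => ?_)
  simp only [dilatedKernel, dilation_dilation, inv_mul_cancel₀ hε.ne', dilation_one, hπ]
  rw [mul_smul, Complex.coe_smul]

include hG h𝒱 in
theorem isSummableKernel_dilatedKernel [DiscreteTopology Γ] [CompactSpace (NilManifold Γ)]
    {κ : NilManifold Γ → 𝓢(G, ℂ)} (hκ : Continuous κ) {ε : ℝ} (hε : 0 < ε) :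
    IsSummableKernel (dilatedKernel 𝒱 κ ε) := by
  obtain ⟨κ', hκ', dilated_eq⟩ := exists_schwartz_eq_dilatedKernel 𝒱 hκ hε
  rw [dilated_eq]
  exact isSummableKernel_schwartz 𝒱 hG h𝒱 hκ'

end DilatedKernel

section Inversion

variable {G : Type u} [NormedAddCommGroup G] [NormedSpace ℝ G] [FiniteDimensional ℝ G]
  [Group G] [MeasurableSpace G] [BorelSpace G] {μ : Measure G} [μ.IsAddHaarMeasure]
  (hG : IsExponentialCoordinates G)

include hG

theorem IsExponentialCoordinates.isInvInvariant : μ.IsInvInvariant := by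
  have : ProperSpace G := FiniteDimensional.proper ℝ G
  have : μ.IsNegInvariant := Measure.IsAddHaarMeasure.isNegInvariant_of_regular μ
  refine ⟨?_⟩
  rw [Measure.inv, show (Inv.inv : G → G) = Neg.neg from funext hG.inv_eq_neg]
  exact Measure.map_neg_eq_self μ

variable [IsTopologicalGroup G] [μ.IsMulLeftInvariant] {E : Type*} [NormedAddCommGroup E]

theorem IsExponentialCoordinates.integral_inv_mul [NormedSpace ℝ E] (g : G → E) (x : G) :
    ∫ y, g (y⁻¹ * x) ∂μ = ∫ y, g y ∂μ := by
  have : ProperSpace G := FiniteDimensional.proper ℝ G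
  have := hG.isInvInvariant (μ := μ)
  rw [← integral_inv_eq_self g μ, ← integral_mul_left_eq_self (fun y => g y⁻¹) x⁻¹]
  simp

theorem IsExponentialCoordinates.integrable_inv_mul {g : G → E} (hg : Integrable g μ) (x : G) :
    Integrable (fun y => g (y⁻¹ * x)) μ := by
  have : ProperSpace G := FiniteDimensional.proper ℝ G
  have := hG.isInvInvariant (μ := μ)
  simpa using hg.comp_inv.comp_mul_left x⁻¹

end Inversion

section LatticeDecay

theorem norm_tsum_sub_le {ι E : Type*} [NormedAddCommGroup E] [CompleteSpace E] {f : ι → E}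
    {u : ι → ℝ} (hu : Summable u) (i₀ : ι) (h0 : 0 ≤ u i₀) (hf : ∀ i ≠ i₀, ‖f i‖ ≤ u i) :
    ‖∑' i, f i - f i₀‖ ≤ ∑' i, u i := by
  classical
  have norm_update_le (i : ι) : ‖Function.update f i₀ 0 i‖ ≤ u i := by
    obtain rfl | hi := eq_or_ne i i₀
    · simpa using h0
    · simpa [hi] using hf i hi
  have hasSum_f := (Summable.of_norm_bounded hu norm_update_le).hasSum.update i₀ (f i₀)
  simp only [Function.update_idem, Function.update_eq_self, Function.update_self, sub_zero]
    at hasSum_f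
  rw [hasSum_f.tsum_eq, add_sub_cancel_left]
  exact tsum_of_norm_bounded hu.hasSum norm_update_le

variable {G : Type u} [NormedAddCommGroup G] [NormedSpace ℝ G]
  (𝒱 : ℕ → Submodule ℝ G) [DirectSum.Decomposition 𝒱]

section

variable [Group G] {Γ : Subgroup G} [CompactSpace (NilManifold Γ)] {κ : NilManifold Γ → 𝓢(G, ℂ)}

theorem exists_norm_dilatedKernel_le (hκ : Continuous κ) (q : ℕ) : ∃ A : ℝ, 0 ≤ A ∧
    ∀ ε > 0, ∀ p z, (1 + ‖dilation 𝒱 ε⁻¹ z‖) ^ q *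
      (ε ^ homogeneousDim 𝒱 * ‖dilatedKernel 𝒱 κ ε p z‖) ≤ A := by
  obtain ⟨A, hA⟩ := exists_schwartz_decay_bound hκ q 0
  refine ⟨A, le_trans (by positivity) (hA (NilManifold.mk Γ 1) 0 le_rfl 0),
    fun ε hε p z => ?_⟩
  rw [pow_mul_norm_dilatedKernel 𝒱 κ hε]
  simpa only [norm_iteratedFDeriv_zero] using hA p 0 le_rfl (dilation 𝒱 ε⁻¹ z)

end

variable [FiniteDimensional ℝ G]

theorem exists_one_add_norm_le_dilation_inv (h0 : 𝒱 0 = ⊥) : ∃ C : ℝ, 1 ≤ C ∧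
    ∀ ε ∈ Set.Ioc (0 : ℝ) 1, ∀ x : G, 1 + ‖x‖ ≤ C * (1 + ‖dilation 𝒱 ε⁻¹ x‖) := by
  obtain ⟨C, hC1, hC⟩ := exists_norm_le_dilation_inv 𝒱 h0
  refine ⟨C, hC1, fun ε hε x => ?_⟩
  calc 1 + ‖x‖ ≤ C + C * 1 * ‖dilation 𝒱 ε⁻¹ x‖ := by
        gcongr
        exact (hC ε hε x).trans (by gcongr; exact hε.2)
    _ = C * (1 + ‖dilation 𝒱 ε⁻¹ x‖) := by ring

variable [Group G] {Γ : Subgroup G} [CompactSpace (NilManifold Γ)]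
  {κ : NilManifold Γ → 𝓢(G, ℂ)}

variable [LieGroup 𝓘(ℝ, G) ∞ G] [DiscreteTopology Γ] (hG : IsExponentialCoordinates G)
  (h𝒱 : IsLieGradation 𝒱)

include hG h𝒱

theorem exists_norm_dilatedKernel_conj_le (hκ : Continuous κ) {R : ℝ} (hR : 0 ≤ R) (N m : ℕ) :
    ∃ C : ℝ, 0 ≤ C ∧ ∀ ε ∈ Set.Ioc (0 : ℝ) 1, ∀ p, ∀ x : G, ‖x‖ ≤ R → ∀ γ : Γ, γ ≠ 1 →
      ‖dilatedKernel 𝒱 κ ε p (x⁻¹ * (γ * x))‖ ≤ C * ε ^ N * ((1 + ‖(γ : G)‖) ^ m)⁻¹ := by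
  set Q := homogeneousDim 𝒱
  obtain ⟨D, hD0, q, hD⟩ := exists_pow_norm_lattice_le 𝒱 Γ hG h𝒱 hR (N + Q) m
  obtain ⟨A, hA0, hA⟩ := exists_norm_dilatedKernel_le 𝒱 hκ q
  refine ⟨D * A, by positivity, fun ε hε p x hx γ hγ => ?_⟩
  have hε0 : 0 < ε := hε.1
  set k := dilatedKernel 𝒱 κ ε p (x⁻¹ * (γ * x))
  set w := dilation 𝒱 ε⁻¹ (x⁻¹ * (γ * x))
  rw [← div_eq_mul_inv, le_div_iff₀' (by positivity)]
  calc (1 + ‖(γ : G)‖) ^ m * ‖k‖ ≤ D * ε ^ (N + Q) * (1 + ‖w‖) ^ q * ‖k‖ := by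
        gcongr
        exact hD ε hε x hx γ hγ
    _ = D * ε ^ N * ((1 + ‖w‖) ^ q * (ε ^ Q * ‖k‖)) := by ring
    _ ≤ D * ε ^ N * A := by
        gcongr
        exact hA ε hε0 p _
    _ = D * A * ε ^ N := by ring

/- With `z = D_{ε⁻¹}(y⁻¹ x)` and `w = D_{ε⁻¹}(x⁻¹ γ x)`, the two factors are governed by `z * w` and
`z`. Since `w = z⁻¹ (z * w)` is large, they cannot both be close to `0`. -/
theorem exists_norm_dilatedKernel_mul_le (hκ : Continuous κ) {R : ℝ} (hR : 0 ≤ R) (N l m : ℕ) :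
    ∃ C : ℝ, 0 ≤ C ∧ ∀ ε ∈ Set.Ioc (0 : ℝ) 1, ∀ p, ∀ x y : G, ‖x‖ ≤ R → ∀ γ : Γ, γ ≠ 1 →
      ‖dilatedKernel 𝒱 κ ε p (y⁻¹ * (γ * x))‖ * ‖dilatedKernel 𝒱 κ ε p (y⁻¹ * x)‖ ≤
        C * ε ^ N * ((1 + ‖y⁻¹ * x‖) ^ l)⁻¹ * ((1 + ‖(γ : G)‖) ^ m)⁻¹ := by
  set Q := homogeneousDim 𝒱
  obtain ⟨D, hD0, q, hD⟩ := exists_pow_norm_lattice_le 𝒱 Γ hG h𝒱 hR (N + 2 * Q) m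
  obtain ⟨K, hK1, j, hK⟩ := exists_one_add_norm_mul_le 𝒱 hG h𝒱
  obtain ⟨L, hL1, hL⟩ := exists_one_add_norm_le_dilation_inv 𝒱 h𝒱.zero_eq_bot
  obtain ⟨A, hA0, hA⟩ := exists_norm_dilatedKernel_le 𝒱 hκ (j * q + l)
  obtain ⟨B, hB0, hB⟩ := exists_norm_dilatedKernel_le 𝒱 hκ (j * q)
  refine ⟨D * K ^ q * L ^ l * (A * B), by positivity, fun ε hε p x y hx γ hγ => ?_⟩
  have hε0 : 0 < ε := hε.1
  set z := dilation 𝒱 ε⁻¹ (y⁻¹ * x) with hz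
  set w := dilation 𝒱 ε⁻¹ (x⁻¹ * (γ * x)) with hw
  have dilation_eq_mul : dilation 𝒱 ε⁻¹ (y⁻¹ * (γ * x)) = z * w := by
    rw [hz, hw, ← dilation_mul 𝒱 hG h𝒱]
    congr 1
    group
  have norm_w_le : 1 + ‖w‖ ≤ K * (1 + ‖z‖) ^ j * (1 + ‖z * w‖) ^ j := by
    have norm_le := hK z⁻¹ (z * w)
    rwa [inv_mul_cancel_left, hG.inv_eq_neg z, norm_neg] at norm_le
  have decay_z := hA ε hε0 p (y⁻¹ * x)
  have decay_zw := hB ε hε0 p (y⁻¹ * (γ * x))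
  rw [dilation_eq_mul] at decay_zw
  set k₁ := dilatedKernel 𝒱 κ ε p (y⁻¹ * (γ * x))
  set k₂ := dilatedKernel 𝒱 κ ε p (y⁻¹ * x)
  rw [← div_eq_mul_inv, le_div_iff₀' (by positivity), ← div_eq_mul_inv,
    le_div_iff₀' (by positivity)]
  calc (1 + ‖y⁻¹ * x‖) ^ l * ((1 + ‖(γ : G)‖) ^ m * (‖k₁‖ * ‖k₂‖))
      ≤ (L * (1 + ‖z‖)) ^ l * (D * ε ^ (N + 2 * Q) *
          (K * (1 + ‖z‖) ^ j * (1 + ‖z * w‖) ^ j) ^ q * (‖k₁‖ * ‖k₂‖)) := by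
        gcongr
        · exact hL ε hε _
        · exact (hD ε hε x hx γ hγ).trans (by gcongr)
    _ = D * K ^ q * L ^ l * ε ^ N * (((1 + ‖z‖) ^ (j * q + l) * (ε ^ Q * ‖k₂‖)) *
          ((1 + ‖z * w‖) ^ (j * q) * (ε ^ Q * ‖k₁‖))) := by
        rw [mul_pow L]
        ring
    _ ≤ D * K ^ q * L ^ l * ε ^ N * (A * B) := by gcongr
    _ = D * K ^ q * L ^ l * (A * B) * ε ^ N := by ring

end LatticeDecay

section SchwartzFamily

variable {E F X : Type*} [NormedAddCommGroup E] [NormedSpace ℝ E] [NormedAddCommGroup F]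
  [NormedSpace ℝ F] [TopologicalSpace X] [CompactSpace X] [MeasurableSpace X]
  [OpensMeasurableSpace X] {ν : Measure X} [IsFiniteMeasure ν] {κ : X → 𝓢(E, F)}
  (hκ : Continuous κ)

include hκ

theorem integrable_schwartz_apply (z : E) : Integrable (fun p => κ p z) ν :=
  ((continuous_uncurry_schwartz hκ).comp (.prodMk_left z)).integrable_of_hasCompactSupport
    (.of_compactSpace _)

theorem integrable_norm_sq_schwartz_uncurry [FiniteDimensional ℝ E] [MeasurableSpace E]
    [BorelSpace E] {μ : Measure E} [μ.IsAddHaarMeasure] :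
    Integrable (fun q : E × X => ‖κ q.2 q.1‖ ^ 2) (μ.prod ν) := by
  have : ProperSpace E := FiniteDimensional.proper ℝ E
  have : SecondCountableTopology E := secondCountable_of_proper
  set l := Module.finrank ℝ E + 1
  obtain ⟨A, hA⟩ := exists_schwartz_decay_bound hκ l 0
  have continuous_norm_sq : Continuous fun q : E × X => ‖κ q.2 q.1‖ ^ 2 :=
    ((continuous_uncurry_schwartz hκ).comp continuous_swap).norm.pow 2
  refine ((integrable_inv_one_add_norm_pow μ (Nat.lt_succ_self _)).mul_prod
    (integrable_const (A ^ 2))).mono' continuous_norm_sq.measurable.aestronglyMeasurable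
    (Eventually.of_forall fun q => ?_)
  have decay := hA q.2 0 le_rfl q.1
  rw [norm_iteratedFDeriv_zero] at decay
  rw [Real.norm_of_nonneg (by positivity), mul_comm, ← div_eq_mul_inv,
    le_div_iff₀' (by positivity)]
  calc (1 + ‖q.1‖) ^ l * ‖κ q.2 q.1‖ ^ 2
      ≤ (1 + ‖q.1‖) ^ l * (1 + ‖q.1‖) ^ l * ‖κ q.2 q.1‖ ^ 2 := by
        gcongr
        exact le_mul_of_one_le_left (by positivity) (one_le_pow₀ (by simp))
    _ = ((1 + ‖q.1‖) ^ l * ‖κ q.2 q.1‖) ^ 2 := by ring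
    _ ≤ A ^ 2 := by gcongr

end SchwartzFamily

section KernelNorm

theorem norm_conj_mul_sub_norm_sq (a b : ℂ) :
    ‖starRingEnd ℂ a * b - ((‖b‖ ^ 2 : ℝ) : ℂ)‖ = ‖a - b‖ * ‖b‖ := by
  rw [← Complex.normSq_eq_norm_sq, Complex.normSq_eq_conj_mul_self, ← sub_mul, ← map_sub, norm_mul,
    RCLike.norm_conj]

namespace IsSummableKernel

variable {G : Type u} [NormedAddCommGroup G] [NormedSpace ℝ G] [FiniteDimensional ℝ G] [Group G]
  [IsTopologicalGroup G] [MeasurableSpace G] [BorelSpace G] {Γ : Subgroup G} [DiscreteTopology Γ]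
  [CompactSpace (NilManifold Γ)] {ν : Measure (NilManifold Γ)} [IsFiniteMeasure ν]
  {k : NilManifold Γ → G → ℂ} (hk : IsSummableKernel k)

include hk

theorem integrable_nilKernel_diag : Integrable (fun p => nilKernel k p p) ν := by
  obtain ⟨B, norm_nilKernel_le⟩ := hk.exists_norm_nilKernel_le
  exact .of_bound (hk.measurable_nilKernel.comp
    (measurable_id.prodMk measurable_id)).aestronglyMeasurable B
    (Eventually.of_forall fun p => norm_nilKernel_le p p)

theorem integrable_conj_nilKernel (p : NilManifold Γ) :
    Integrable (fun q => starRingEnd ℂ (nilKernel k p q)) ν := by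
  obtain ⟨B, norm_nilKernel_le⟩ := hk.exists_norm_nilKernel_le
  exact .of_bound (measurable_conj_kernel hk.measurable_nilKernel p).aestronglyMeasurable B
    (Eventually.of_forall fun q => (RCLike.norm_conj _).trans_le (norm_nilKernel_le p q))

variable {μ : Measure G} (hν : IsQuotientMeasure Γ μ ν)

include hν

theorem integrable_conj_nilKernel_mul (x : G) :
    Integrable (fun y => starRingEnd ℂ (nilKernel k (NilManifold.mk Γ x) (NilManifold.mk Γ y)) *
      k (NilManifold.mk Γ x) (y⁻¹ * x)) μ :=
  hk.integrable_mul hν (measurable_conj_kernel hk.measurable_nilKernel _).stronglyMeasurable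
    (hk.integrable_conj_nilKernel _) x

theorem integral_conj_nilKernel_mul (x : G) :
    ∫ y, starRingEnd ℂ (nilKernel k (NilManifold.mk Γ x) (NilManifold.mk Γ y)) *
      k (NilManifold.mk Γ x) (y⁻¹ * x) ∂μ =
        ((∫ q, ‖nilKernel k (NilManifold.mk Γ x) q‖ ^ 2 ∂ν : ℝ) : ℂ) := by
  rw [hk.integral_mul_eq hν
    (measurable_conj_kernel hk.measurable_nilKernel _).stronglyMeasurable
    (hk.integrable_conj_nilKernel _) x, ← integral_complex_ofReal]
  simp only [Complex.mul_conj, Complex.normSq_eq_norm_sq]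

theorem abs_integral_norm_sq_nilKernel_sub_le [μ.IsAddHaarMeasure] [μ.IsMulLeftInvariant]
    (hG : IsExponentialCoordinates G) {x : G}
    (hkx : Integrable (fun z => ‖k (NilManifold.mk Γ x) z‖ ^ 2) μ) {w : G → ℝ}
    (hw : Integrable w μ)
    (hkw : ∀ y, ‖latticeKernel k x y - k (NilManifold.mk Γ x) (y⁻¹ * x)‖ *
      ‖k (NilManifold.mk Γ x) (y⁻¹ * x)‖ ≤ w (y⁻¹ * x)) :
    |∫ q, ‖nilKernel k (NilManifold.mk Γ x) q‖ ^ 2 ∂ν -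
      ∫ z, ‖k (NilManifold.mk Γ x) z‖ ^ 2 ∂μ| ≤ ∫ z, w z ∂μ := by
  have integral_norm_sq_eq := hG.integral_inv_mul (μ := μ)
    (fun z => ‖k (NilManifold.mk Γ x) z‖ ^ 2) x
  have integrable_norm_sq : Integrable
      (fun y => ((‖k (NilManifold.mk Γ x) (y⁻¹ * x)‖ ^ 2 : ℝ) : ℂ)) μ :=
    (hG.integrable_inv_mul hkx x).ofReal
  rw [← integral_norm_sq_eq, ← Real.norm_eq_abs, ← Complex.norm_real, Complex.ofReal_sub,
    ← hk.integral_conj_nilKernel_mul hν, ← integral_complex_ofReal,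
    ← integral_sub (hk.integrable_conj_nilKernel_mul hν x) integrable_norm_sq,
    ← hG.integral_inv_mul w x]
  refine norm_integral_le_of_norm_le (hG.integrable_inv_mul hw x) (Eventually.of_forall fun y => ?_)
  rw [norm_conj_mul_sub_norm_sq, nilKernel_mk_mk]
  exact hkw y

end IsSummableKernel

end KernelNorm

section Asymptotics

variable {G : Type u} [NormedAddCommGroup G] [NormedSpace ℝ G] [FiniteDimensional ℝ G]
  (𝒱 : ℕ → Submodule ℝ G) [DirectSum.Decomposition 𝒱] [Group G] [LieGroup 𝓘(ℝ, G) ∞ G]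
  {Γ : Subgroup G} [DiscreteTopology Γ] [CompactSpace (NilManifold Γ)]
  (hG : IsExponentialCoordinates G) (h𝒱 : IsLieGradation 𝒱) {κ : NilManifold Γ → 𝓢(G, ℂ)}
  (hκ : Continuous κ)

include hG h𝒱 hκ

theorem exists_norm_latticeKernel_sub_mul_le {R : ℝ} (hR : 0 ≤ R) (N l : ℕ) :
    ∃ C : ℝ, ∀ ε ∈ Set.Ioc (0 : ℝ) 1, ∀ x y : G, ‖x‖ ≤ R →
      ‖latticeKernel (dilatedKernel 𝒱 κ ε) x y -
          dilatedKernel 𝒱 κ ε (NilManifold.mk Γ x) (y⁻¹ * x)‖ *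
        ‖dilatedKernel 𝒱 κ ε (NilManifold.mk Γ x) (y⁻¹ * x)‖ ≤
          C * ε ^ N * ((1 + ‖y⁻¹ * x‖) ^ l)⁻¹ := by
  obtain ⟨m, hm⟩ := exists_summable_lattice 𝒱 Γ hG h𝒱
  obtain ⟨D, hD0, hD⟩ := exists_norm_dilatedKernel_mul_le 𝒱 hG h𝒱 hκ hR N l m
  refine ⟨D * ∑' γ : Γ, ((1 + ‖(γ : G)‖) ^ m)⁻¹, fun ε hε x y hx => ?_⟩
  have hε0 : 0 < ε := hε.1
  set k := dilatedKernel 𝒱 κ ε (NilManifold.mk Γ x)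
  have sub_identity_term := norm_tsum_sub_le
    (f := fun γ : Γ => k (y⁻¹ * (γ * x)) * k (y⁻¹ * x))
    (hm.mul_left (D * ε ^ N * ((1 + ‖y⁻¹ * x‖) ^ l)⁻¹)) 1 (by positivity)
    fun γ hγ => (norm_mul _ _).trans_le (hD ε hε _ x y hx γ hγ)
  rw [Subgroup.coe_one, one_mul, tsum_mul_right, ← sub_mul, norm_mul, tsum_mul_left]
    at sub_identity_term
  rw [latticeKernel]
  exact sub_identity_term.trans_eq (by ring)

variable [MeasurableSpace G] [BorelSpace G]

theorem exists_norm_nilKernel_diag_sub_le (N : ℕ) :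
    ∃ C : ℝ, ∀ ε ∈ Set.Ioc (0 : ℝ) 1, ∀ p, ‖nilKernel (dilatedKernel 𝒱 κ ε) p p -
      (((ε ^ homogeneousDim 𝒱)⁻¹ : ℝ) : ℂ) * κ p 0‖ ≤ C * ε ^ N := by
  have : IsTopologicalGroup G := topologicalGroup_of_lieGroup 𝓘(ℝ, G) ∞
  obtain ⟨s, -, hsec, R, hR0, hR⟩ := NilManifold.exists_measurable_section Γ
  obtain ⟨m, hm⟩ := exists_summable_lattice 𝒱 Γ hG h𝒱
  obtain ⟨D, hD0, hD⟩ := exists_norm_dilatedKernel_conj_le 𝒱 hG h𝒱 hκ hR0 N m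
  refine ⟨D * ∑' γ : Γ, ((1 + ‖(γ : G)‖) ^ m)⁻¹, fun ε hε p => ?_⟩
  obtain ⟨x, rfl, hx⟩ : ∃ x, NilManifold.mk Γ x = p ∧ ‖x‖ ≤ R := ⟨s p, hsec p, hR p⟩
  have hε0 : 0 < ε := hε.1
  set k := dilatedKernel 𝒱 κ ε (NilManifold.mk Γ x) with hk
  have sub_identity_term := norm_tsum_sub_le (f := fun γ : Γ => k (x⁻¹ * (γ * x)))
    (hm.mul_left (D * ε ^ N)) 1 (by positivity) fun γ hγ => hD ε hε _ x hx γ hγ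
  have k_one : k 1 = (((ε ^ homogeneousDim 𝒱)⁻¹ : ℝ) : ℂ) * κ (NilManifold.mk Γ x) 0 := by
    rw [hk, dilatedKernel, hG.one_eq_zero, map_zero]
  rw [Subgroup.coe_one, one_mul, inv_mul_cancel, k_one, tsum_mul_left] at sub_identity_term
  rw [nilKernel_mk_mk, latticeKernel]
  exact sub_identity_term.trans_eq (by ring)

variable {μ : Measure G} [μ.IsHaarMeasure] {ν : Measure (NilManifold Γ)}
  (hν : IsQuotientMeasure Γ μ ν)

include hν

theorem exists_abs_integral_norm_sq_nilKernel_sub_le (N : ℕ) :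
    ∃ C : ℝ, ∀ ε ∈ Set.Ioc (0 : ℝ) 1, ∀ p,
      |∫ q, ‖nilKernel (dilatedKernel 𝒱 κ ε) p q‖ ^ 2 ∂ν -
        (ε ^ homogeneousDim 𝒱)⁻¹ * ∫ z, ‖κ p z‖ ^ 2 ∂μ| ≤ C * ε ^ N := by
  have : IsTopologicalGroup G := topologicalGroup_of_lieGroup 𝓘(ℝ, G) ∞
  have : ProperSpace G := FiniteDimensional.proper ℝ G
  have : PolishSpace G := polishSpace_of_finiteDimensional G
  have : μ.IsAddHaarMeasure := isAddHaarMeasure_of_isHaarMeasure 𝒱 hG h𝒱 μ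
  have : IsFiniteMeasure ν := hν.isFiniteMeasure
  obtain ⟨s, -, hsec, R, hR0, hR⟩ := NilManifold.exists_measurable_section Γ
  set w : G → ℝ := fun z => ((1 + ‖z‖) ^ (Module.finrank ℝ G + 1))⁻¹
  have integrable_w : Integrable w μ := integrable_inv_one_add_norm_pow μ (Nat.lt_succ_self _)
  obtain ⟨D, hD⟩ := exists_norm_latticeKernel_sub_mul_le 𝒱 hG h𝒱 hκ hR0 N
    (Module.finrank ℝ G + 1)
  refine ⟨D * ∫ z, w z ∂μ, fun ε hε p => ?_⟩
  obtain ⟨x, rfl, hx⟩ : ∃ x, NilManifold.mk Γ x = p ∧ ‖x‖ ≤ R := ⟨s p, hsec p, hR p⟩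
  have integrable_norm_sq :
      Integrable (fun z => ‖dilatedKernel 𝒱 κ ε (NilManifold.mk Γ x) z‖ ^ 2) μ := by
    obtain ⟨κ', -, dilated_eq⟩ := exists_schwartz_eq_dilatedKernel 𝒱 hκ hε.1
    rw [dilated_eq]
    exact ((κ' _).memLp 2 μ).integrable_norm_pow two_ne_zero
  rw [← integral_norm_sq_dilatedKernel 𝒱 μ κ hε.1]
  refine ((isSummableKernel_dilatedKernel 𝒱 hG h𝒱 hκ hε.1).abs_integral_norm_sq_nilKernel_sub_le hν
    hG integrable_norm_sq (integrable_w.const_mul (D * ε ^ N))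
    fun y => hD ε hε x y hx).trans_eq ?_
  rw [integral_const_mul]
  ring

theorem exists_abs_integral_integral_norm_sq_nilKernel_sub_le (N : ℕ) :
    ∃ C : ℝ, ∀ ε ∈ Set.Ioc (0 : ℝ) 1,
      |∫ p, ∫ q, ‖nilKernel (dilatedKernel 𝒱 κ ε) p q‖ ^ 2 ∂ν ∂ν - (ε ^ homogeneousDim 𝒱)⁻¹ *
        ∫ q : G × NilManifold Γ, ‖κ q.2 q.1‖ ^ 2 ∂(μ.prod ν)| ≤ C * ε ^ N := by
  have : IsTopologicalGroup G := topologicalGroup_of_lieGroup 𝓘(ℝ, G) ∞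
  have : ProperSpace G := FiniteDimensional.proper ℝ G
  have : PolishSpace G := polishSpace_of_finiteDimensional G
  have : BorelSpace (NilManifold Γ) := NilManifold.borelSpace Γ
  have : μ.IsAddHaarMeasure := isAddHaarMeasure_of_isHaarMeasure 𝒱 hG h𝒱 μ
  have : IsFiniteMeasure ν := hν.isFiniteMeasure
  obtain ⟨C, hC⟩ := exists_abs_integral_norm_sq_nilKernel_sub_le 𝒱 hG h𝒱 hκ hν N
  refine ⟨C * ν.real Set.univ, fun ε hε => ?_⟩
  have summable_kernel := isSummableKernel_dilatedKernel 𝒱 hG h𝒱 hκ hε.1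
  obtain ⟨B, hB⟩ := summable_kernel.exists_norm_nilKernel_le
  have integrable_norm_sq := integrable_norm_sq_schwartz_uncurry (μ := μ) (ν := ν) hκ
  rw [integral_prod_symm _ integrable_norm_sq, ← integral_const_mul,
    ← integral_sub (integrable_integral_norm_sq_kernel ν summable_kernel.measurable_nilKernel hB)
      (integrable_norm_sq.integral_prod_right.const_mul _), ← Real.norm_eq_abs]
  exact (norm_integral_le_of_norm_le_const (Eventually.of_forall (hC ε hε))).trans_eq (by ring)

theorem exists_norm_integral_nilKernel_diag_sub_le (N : ℕ) :
    ∃ C : ℝ, ∀ ε ∈ Set.Ioc (0 : ℝ) 1, ‖∫ p, nilKernel (dilatedKernel 𝒱 κ ε) p p ∂ν -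
      (((ε ^ homogeneousDim 𝒱)⁻¹ : ℝ) : ℂ) * ∫ p, κ p 0 ∂ν‖ ≤ C * ε ^ N := by
  have : IsTopologicalGroup G := topologicalGroup_of_lieGroup 𝓘(ℝ, G) ∞
  have : ProperSpace G := FiniteDimensional.proper ℝ G
  have : PolishSpace G := polishSpace_of_finiteDimensional G
  have : BorelSpace (NilManifold Γ) := NilManifold.borelSpace Γ
  have : IsFiniteMeasure ν := hν.isFiniteMeasure
  obtain ⟨C, hC⟩ := exists_norm_nilKernel_diag_sub_le 𝒱 hG h𝒱 hκ N
  refine ⟨C * ν.real Set.univ, fun ε hε => ?_⟩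
  rw [← integral_const_mul, ← integral_sub
    (isSummableKernel_dilatedKernel 𝒱 hG h𝒱 hκ hε.1).integrable_nilKernel_diag
    ((integrable_schwartz_apply hκ 0).const_mul _)]
  exact (norm_integral_le_of_norm_le_const (Eventually.of_forall (hC ε hε))).trans_eq (by ring)

end Asymptotics

section TraceClass

variable {G : Type u} [NormedAddCommGroup G] [NormedSpace ℝ G] [FiniteDimensional ℝ G]
  (𝒱 : ℕ → Submodule ℝ G) [DirectSum.Decomposition 𝒱] [Group G]
  [LieGroup 𝓘(ℝ, G) ∞ G] [MeasurableSpace G] [BorelSpace G] {Γ : Subgroup G} [DiscreteTopology Γ]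
  [CompactSpace (NilManifold Γ)] (hG : IsExponentialCoordinates G) (h𝒱 : IsLieGradation 𝒱)
  {μ : Measure G} [μ.IsMulLeftInvariant] {ν : Measure (NilManifold Γ)} [IsFiniteMeasure ν]
  (hν : IsQuotientMeasure Γ μ ν) {κ : NilManifold Γ → 𝓢(G, ℂ)} (hκ : Continuous κ)

include 𝒱 hG h𝒱 hν hκ

theorem exists_isOp_schwartz :
    ∃ T : Lp ℂ 2 ν →L[ℂ] Lp ℂ 2 ν, IsOp μ Γ ν (fun p => ⇑(κ p)) T ∧
      HasHilbertSchmidtNorm T √(∫ p, ∫ q, ‖nilKernel (fun p => ⇑(κ p)) p q‖ ^ 2 ∂ν ∂ν) ∧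
      IsTraceClass T ∧ HasTrace T (∫ p, nilKernel (fun p => ⇑(κ p)) p p ∂ν) := by
  have : IsTopologicalGroup G := topologicalGroup_of_lieGroup 𝓘(ℝ, G) ∞
  have : TopologicalSpace.SeparableSpace (Lp ℂ 2 ν) := separableSpace_L2
  have summable_kernel := isSummableKernel_schwartz 𝒱 hG h𝒱 hκ
  have hm := summable_kernel.measurable_nilKernel
  obtain ⟨B, hB⟩ := summable_kernel.exists_norm_nilKernel_le
  obtain ⟨a, c, α, hα, ha, hc, haα, hc1, hac⟩ := exists_fourier_decomposition 𝒱 hG h𝒱 hκ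
  exact ⟨integralOperator ν hm hB, summable_kernel.isOp_integralOperator hν hm hB,
    hasHilbertSchmidtNorm_integralOperator ν hm hB,
    isTraceClass_and_hasTrace_integralOperator ν hm hB hα ha hc haα hc1 hac⟩

theorem exists_isOp_dilatedKernel {ε : ℝ} (hε : 0 < ε) :
    ∃ T : Lp ℂ 2 ν →L[ℂ] Lp ℂ 2 ν, IsOp μ Γ ν (dilatedKernel 𝒱 κ ε) T ∧
      HasHilbertSchmidtNorm T √(∫ p, ∫ q, ‖nilKernel (dilatedKernel 𝒱 κ ε) p q‖ ^ 2 ∂ν ∂ν) ∧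
      IsTraceClass T ∧ HasTrace T (∫ p, nilKernel (dilatedKernel 𝒱 κ ε) p p ∂ν) := by
  obtain ⟨κ', hκ', dilated_eq⟩ := exists_schwartz_eq_dilatedKernel 𝒱 hκ hε
  rw [dilated_eq]
  exact exists_isOp_schwartz 𝒱 hG h𝒱 hν hκ'

end TraceClass

end

theorem lemma4_general {G : Type u} [NormedAddCommGroup G] [NormedSpace ℝ G] [FiniteDimensional ℝ G]
    [MeasurableSpace G] [BorelSpace G] [Group G] [LieGroup 𝓘(ℝ, G) ∞ G]
    (hG : IsExponentialCoordinates G)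
    (𝒱 : ℕ → Submodule ℝ G) [DirectSum.Decomposition 𝒱] (h𝒱 : IsLieGradation 𝒱)
    (μ : Measure G) [μ.IsHaarMeasure]
    (Γ : Subgroup G) [DiscreteTopology Γ] [CompactSpace (NilManifold Γ)]
    (ν : Measure (NilManifold Γ)) (hν : IsQuotientMeasure Γ μ ν)
    (σ : SymbolField Γ) (κ : NilManifold Γ → 𝓢(G, ℂ)) (hκ : Continuous κ)
    (hσ : ∀ (p : NilManifold Γ) (H : Type) [NormedAddCommGroup H] [InnerProductSpace ℂ H]
      [CompleteSpace H] [TopologicalSpace.SeparableSpace H] (π : UnitaryIrrep G H),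
      IsFourierTransformAt μ (κ p) π (σ p H π)) :
    (∀ ε ∈ Set.Ioc (0 : ℝ) 1, IsKernelOfDilatedSymbol 𝒱 μ σ ε (dilatedKernel 𝒱 κ ε)) ∧
    Integrable (fun q : G × NilManifold Γ => ‖κ q.2 q.1‖ ^ 2) (μ.prod ν) ∧
    Integrable (fun p : NilManifold Γ => κ p 0) ν ∧
    ∃ (Op : ℝ → (Lp ℂ 2 ν →L[ℂ] Lp ℂ 2 ν)) (hs : ℝ → ℝ) (tr : ℝ → ℂ),
      (∀ ε ∈ Set.Ioc (0 : ℝ) 1,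
        IsOp μ Γ ν (dilatedKernel 𝒱 κ ε) (Op ε) ∧
        HasHilbertSchmidtNorm (Op ε) (hs ε) ∧ IsTraceClass (Op ε) ∧ HasTrace (Op ε) (tr ε)) ∧
      (∀ N : ℕ, ∃ C : ℝ, ∀ ε ∈ Set.Ioc (0 : ℝ) 1,
        |hs ε ^ 2 - (ε ^ homogeneousDim 𝒱)⁻¹ *
          ∫ q : G × NilManifold Γ, ‖κ q.2 q.1‖ ^ 2 ∂(μ.prod ν)| ≤ C * ε ^ N) ∧
      (∀ N : ℕ, ∃ C : ℝ, ∀ ε ∈ Set.Ioc (0 : ℝ) 1,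
        ‖tr ε - (((ε ^ homogeneousDim 𝒱)⁻¹ : ℝ) : ℂ) * ∫ p, κ p 0 ∂ν‖ ≤ C * ε ^ N) := by
  have : IsTopologicalGroup G := topologicalGroup_of_lieGroup 𝓘(ℝ, G) ∞
  have : ProperSpace G := FiniteDimensional.proper ℝ G
  have : PolishSpace G := polishSpace_of_finiteDimensional G
  have : BorelSpace (NilManifold Γ) := NilManifold.borelSpace Γ
  have : μ.IsAddHaarMeasure := isAddHaarMeasure_of_isHaarMeasure 𝒱 hG h𝒱 μ
  have : IsFiniteMeasure ν := hν.isFiniteMeasure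
  choose! Op hOp using fun ε (hε : ε ∈ Set.Ioc (0 : ℝ) 1) =>
    exists_isOp_dilatedKernel 𝒱 hG h𝒱 hν hκ hε.1
  refine ⟨fun ε hε => isKernelOfDilatedSymbol_dilatedKernel 𝒱 hG h𝒱 μ hσ hε.1,
    integrable_norm_sq_schwartz_uncurry hκ, integrable_schwartz_apply hκ 0, Op, _, _, hOp,
    fun N => ?_, exists_norm_integral_nilKernel_diag_sub_le 𝒱 hG h𝒱 hκ hν⟩
  simp only [Real.sq_sqrt
    (integral_nonneg fun _ => integral_nonneg fun _ => sq_nonneg _)]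
  exact exists_abs_integral_integral_norm_sq_nilKernel_sub_le 𝒱 hG h𝒱 hκ hν N

theorem lemma4 {G : Type u} [NormedAddCommGroup G] [NormedSpace ℝ G] [FiniteDimensional ℝ G]
    [MeasurableSpace G] [BorelSpace G] [Group G] [LieGroup 𝓘(ℝ, G) ∞ G]
    (hG : IsExponentialCoordinates G)
    (𝒱 : ℕ → Submodule ℝ G) [DirectSum.Decomposition 𝒱] (h𝒱 : IsLieGradation 𝒱)
    (μ : Measure G) [μ.IsHaarMeasure]
    (Γ : Subgroup G) [DiscreteTopology Γ] [CompactSpace (NilManifold Γ)]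
    (ν : Measure (NilManifold Γ)) (hν : IsQuotientMeasure Γ μ ν)
    (σ : SymbolField Γ) (κ : NilManifold Γ → 𝓢(G, ℂ)) (hσ : IsSymbolWithKernel μ Γ σ κ) :
    (∀ ε ∈ Set.Ioc (0 : ℝ) 1, IsKernelOfDilatedSymbol 𝒱 μ σ ε (dilatedKernel 𝒱 κ ε)) ∧
    Integrable (fun q : G × NilManifold Γ => ‖κ q.2 q.1‖ ^ 2) (μ.prod ν) ∧
    Integrable (fun p : NilManifold Γ => κ p 0) ν ∧
    ∃ (Op : ℝ → (Lp ℂ 2 ν →L[ℂ] Lp ℂ 2 ν)) (hs : ℝ → ℝ) (tr : ℝ → ℂ),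
      (∀ ε ∈ Set.Ioc (0 : ℝ) 1,
        IsOp μ Γ ν (dilatedKernel 𝒱 κ ε) (Op ε) ∧
        HasHilbertSchmidtNorm (Op ε) (hs ε) ∧ IsTraceClass (Op ε) ∧ HasTrace (Op ε) (tr ε)) ∧
      (∀ N : ℕ, ∃ C : ℝ, ∀ ε ∈ Set.Ioc (0 : ℝ) 1,
        |hs ε ^ 2 - (ε ^ homogeneousDim 𝒱)⁻¹ *
          ∫ q : G × NilManifold Γ, ‖κ q.2 q.1‖ ^ 2 ∂(μ.prod ν)| ≤ C * ε ^ N) ∧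
      (∀ N : ℕ, ∃ C : ℝ, ∀ ε ∈ Set.Ioc (0 : ℝ) 1,
        ‖tr ε - (((ε ^ homogeneousDim 𝒱)⁻¹ : ℝ) : ℂ) * ∫ p, κ p 0 ∂ν‖ ≤ C * ε ^ N) := by
  have : IsTopologicalGroup G := topologicalGroup_of_lieGroup 𝓘(ℝ, G) ∞
  exact lemma4_general hG 𝒱 h𝒱 μ Γ ν hν σ κ hσ.smooth.continuous hσ.fourier
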